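/- Let $\mathbb{B}$ be the open unit ball of the quaternions $\mathbb{H}$ and $\mathbb{S}=\{I\in\mathbb{H}: I^2=-1\}$. A function $f:\mathbb{B}\to\mathbb{H}$ is (slice) regular if for every $I\in\mathbb{S}$ the map $(x,y)\mapsto f(x+yI)$ is $C^1$ on the unit disc and $(\partial_x+I\partial_y)f(x+yI)=0$. For $0<p<\infty$ put $\|f\|_p=\sup_{I\in\mathbb{S}}\lim_{r\to1^-}\big(\frac1{2\pi}\int_0^{2\pi}|f(re^{I\theta})|^p\,d\theta\big)^{1/p}$, put $\|f\|_\infty=\sup_{\mathbb{B}}|f|$, and let $H^p(\mathbb{B})$ be the set of regular $f$ with $\|f\|_p<\infty$. Let $*$ be the regular product, $f^{-*}$ the regular reciprocal, and for $a\in\mathbb{B}$ let $$M_a(q)=(1-q\bar a)^{-*}*(a-q)\frac{\bar a}{|a|}\quad(a\neq0),\qquad M_0(q)=q .$$ For a finite or infinite sequence $(b_n)_{n<N}$ in $\mathbb{B}$ ($0\le N\le\infty$), its Blaschke product is the limit of the partial products $P_k=M_{b_0}*\cdots*M_{b_{k-1}}$ ($P_0=1$), provided they converge uniformly on compact subsets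 of $\mathbb{B}$ (for $N<\infty$ it is $P_N$). Multiplicities: for $y>0$ and $x+y\mathbb{S}\subset\mathbb{B}$ write $f(q)=((q-x)^2+y^2)^m(q-p_1)*\cdots*(q-p_n)*g(q)$ with $p_i\in x+y\mathbb{S}$, $p_i\ne\overline{p_{i+1}}$, and $g$ regular without zeros on $x+y\mathbb{S}$. The sphere has spherical multiplicity $2m$, the point $p_1$ has isolated multiplicity $n$ (if $n\geq 1$), and all other points of the sphere have isolated multiplicity $0$. A real $x$ has isolated multiplicity $k$ if $f(q)=(q-x)^kh(q)$ with $h$ regular and $h(x)\ne0$. A sequence of zeros of $f\not\equiv0$ is a finite or infinite sequence $(a_n)_{n<N}$ of zeros of $f$ in $\mathbb{B}$ in which each point is listed as often as its isolated multiplicity and, in addition, each sphere of spherical multiplicity $2m>0$ is represented by $m$ copies of a generator and $m$ copies of its conjugate; if $a_\ell$ lies on such a sphere and $a_{\ell-1}$ does not (or $\ell=0$), then $a_{\ell+2k}=a_\ell$ and $a_{\ell+2k+1}=\overline{a_\ell}$ for $0\le k<m$. **Proposition.** Let $p\in(0,\infty]$, let $f\in H^p(\mathbb{B})$, $f\not\equiv0$,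 and let $(a_n)_{n<N}$ be a sequence of zeros of $f$. Then there is a sequence $(b_n)_{n<N}$ in $\mathbb{B}$ whose Blaschke product $\widehat B$ exists and is regular on $\mathbb{B}$, such that $(a_n)_{n<N}$ is a sequence of zeros of $\widehat B$, and $\widehat B$ and $f$ have the same spherical multiplicity on every sphere $x+y\mathbb{S}\subset\mathbb{B}$ ($y>0$) and the same isolated multiplicity at every point of $\mathbb{B}$. Moreover, for every $n<N$, $b_n$ is a conjugate $w^{-1}a_nw$ of $a_n$ ($w\in\mathbb{H}\setminus\{0\}$); if $P_n(a_n)\ne0$, then $b_n=T_n(a_n)$ with $T_n(q)=P_n(q)^{-1}\,q\,P_n(q)$; and $P_n(a_n)\neq0$ whenever each earlier term $a_j$ ($j<n$) differs from $a_n$ and is either $\overline{a_n}$ or not on the sphere $\{w^{-1}a_nw : w\neq 0\}$ of $a_n$. -/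

import Mathlib

open scoped Quaternion ENNReal Topology
open Filter MeasureTheory

namespace QHardy

noncomputable section

/-- The open unit ball of the quaternions. -/
def unitBall : Set ℍ[ℝ] := Metric.ball 0 1

/-- The 2-sphere of imaginary units. -/
def imUnits : Set ℍ[ℝ] := {I | I ^ 2 = -1}

/-- The 2-sphere `x + y𝕊` (a single real point if `y = 0`). -/
def sphereOf (x y : ℝ) : Set ℍ[ℝ] := {q | ∃ J ∈ imUnits, q = (x : ℍ[ℝ]) + (y : ℍ[ℝ]) * J}

/-- Slice regularity on the unit ball: on each slice `f` is continuously differentiable and is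
annihilated by `(1/2)(∂/∂x + I ∂/∂y)`. Only the values of `f` on the unit ball matter. -/
def SliceRegular (f : ℍ[ℝ] → ℍ[ℝ]) : Prop :=
  ∀ I ∈ imUnits,
    ContDiffOn ℝ 1 (fun p : ℝ × ℝ => f ((p.1 : ℍ[ℝ]) + (p.2 : ℍ[ℝ]) * I))
      {p : ℝ × ℝ | p.1 ^ 2 + p.2 ^ 2 < 1} ∧
    ∀ z : ℝ × ℝ, z.1 ^ 2 + z.2 ^ 2 < 1 →
      (1 / 2 : ℝ) •
        (fderiv ℝ (fun p : ℝ × ℝ => f ((p.1 : ℍ[ℝ]) + (p.2 : ℍ[ℝ]) * I)) z (1, 0) +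
          I * fderiv ℝ (fun p : ℝ × ℝ => f ((p.1 : ℍ[ℝ]) + (p.2 : ℍ[ℝ]) * I)) z (0, 1)) = 0

/-! ### Hardy spaces -/

/-- The integral mean of order `p` (a finite exponent) of `f` on the circle of radius `r` in the
slice of `I`. -/
def integralMean (p : ℝ) (f : ℍ[ℝ] → ℍ[ℝ]) (I : ℍ[ℝ]) (r : ℝ) : ℝ≥0∞ :=
  (ENNReal.ofReal (1 / (2 * Real.pi)) *
    ∫⁻ θ in Set.Ioc (0 : ℝ) (2 * Real.pi),
      ‖f ((r : ℍ[ℝ]) * ((Real.cos θ : ℍ[ℝ]) + (Real.sin θ : ℍ[ℝ]) * I))‖ₑ ^ p) ^ (1 / p)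

/-- The Hardy norm. For regular `f` the integral means increase with `r`, so the upper limit as
`r → 1⁻` is a limit. -/
def hardyNorm (p : ℝ≥0∞) (f : ℍ[ℝ] → ℍ[ℝ]) : ℝ≥0∞ :=
  if p = ∞ then ⨆ q ∈ unitBall, ‖f q‖ₑ
  else ⨆ I ∈ imUnits, limsup (fun r : ℝ => integralMean p.toReal f I r) (𝓝[<] (1 : ℝ))

/-- The quaternionic Hardy space `H^p` of the unit ball (meant for `0 < p ≤ ∞`). -/
def MemHardy (p : ℝ≥0∞) (f : ℍ[ℝ] → ℍ[ℝ]) : Prop :=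
  SliceRegular f ∧ hardyNorm p f < ∞

/-! ### Regular product, conjugate, symmetrization, reciprocal

The splitting `f = F + G j` is taken on the slice of `i`, with the orthogonal unit `j`; the slice
of `i` is identified with `ℂ` through the coercion `ℂ → ℍ`. -/

/-- The imaginary unit `i`. -/
def unitI : ℍ[ℝ] := ⟨0, 1, 0, 0⟩

/-- The imaginary unit `j`. -/
def unitJ : ℍ[ℝ] := ⟨0, 0, 1, 0⟩

/-- First splitting component `F` of `f` on the slice of `i`. -/
def splitF (f : ℍ[ℝ] → ℍ[ℝ]) (z : ℂ) : ℂ := ⟨(f (z : ℍ[ℝ])).re, (f (z : ℍ[ℝ])).imI⟩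

/-- Second splitting component `G` of `f` on the slice of `i`. -/
def splitG (f : ℍ[ℝ] → ℍ[ℝ]) (z : ℂ) : ℂ := ⟨(f (z : ℍ[ℝ])).imJ, (f (z : ℍ[ℝ])).imK⟩

/-- The extension to the ball of a function `φ` on the slice of `i`: for `q = x + yJ`,
`ext φ q = (φ(x+yi) + φ(x-yi))/2 + J (i/2) (φ(x-yi) - φ(x+yi))`, with `y = ‖Im q‖` and
`J = Im q / y` (for `y = 0` the second term vanishes). -/
def ext (φ : ℂ → ℍ[ℝ]) (q : ℍ[ℝ]) : ℍ[ℝ] :=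
  (1 / 2 : ℝ) • (φ ⟨q.re, ‖q.im‖⟩ + φ ⟨q.re, -‖q.im‖⟩) +
    (‖q.im‖⁻¹ • q.im) * ((1 / 2 : ℝ) • unitI) * (φ ⟨q.re, -‖q.im‖⟩ - φ ⟨q.re, ‖q.im‖⟩)

/-- The regular product `f * g`. -/
def starProd (f g : ℍ[ℝ] → ℍ[ℝ]) : ℍ[ℝ] → ℍ[ℝ] :=
  ext fun z =>
    ((splitF f z * splitF g z
        - splitG f z * (starRingEnd ℂ) (splitG g ((starRingEnd ℂ) z)) : ℂ) : ℍ[ℝ]) +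
      ((splitF f z * splitG g z
        + splitG f z * (starRingEnd ℂ) (splitF g ((starRingEnd ℂ) z)) : ℂ) : ℍ[ℝ]) * unitJ

/-- The regular conjugate. -/
def regConj (f : ℍ[ℝ] → ℍ[ℝ]) : ℍ[ℝ] → ℍ[ℝ] :=
  ext fun z =>
    (((starRingEnd ℂ) (splitF f ((starRingEnd ℂ) z)) : ℂ) : ℍ[ℝ]) -
      ((splitG f z : ℂ) : ℍ[ℝ]) * unitJ

/-- The symmetrization. -/
def symmetrization (f : ℍ[ℝ] → ℍ[ℝ]) : ℍ[ℝ] → ℍ[ℝ] := starProd f (regConj f)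

/-- The regular reciprocal, meaningful off the zero set of the symmetrization. -/
def regRecip (f : ℍ[ℝ] → ℍ[ℝ]) : ℍ[ℝ] → ℍ[ℝ] := fun q => (symmetrization f q)⁻¹ * regConj f q

/-! ### Blaschke products -/

open Classical in
/-- The Blaschke factor `M_a`. -/
def blaschkeFactor (a : ℍ[ℝ]) : ℍ[ℝ] → ℍ[ℝ] :=
  if a = 0 then fun q => q
  else starProd (regRecip fun q => 1 - q * star a) fun q => (a - q) * (‖a‖⁻¹ • star a)

/-- The regular product of the factors `M_{b_0}, M_{b_1}, …` with index below both `k` and the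
length `N` of the sequence. -/
def partialProd (N : ℕ∞) (b : ℕ → ℍ[ℝ]) : ℕ → ℍ[ℝ] → ℍ[ℝ]
  | 0 => fun _ => 1
  | k + 1 =>
    if (k : ℕ∞) < N then starProd (partialProd N b k) (blaschkeFactor (b k))
    else partialProd N b k

/-- `B` is the Blaschke product of the (finite or infinite) sequence `(b_n)_{n < N}` of points of
the unit ball: the partial regular products converge to `B` uniformly on compact subsets. -/
def IsBlaschkeProduct (N : ℕ∞) (b : ℕ → ℍ[ℝ]) (B : ℍ[ℝ] → ℍ[ℝ]) : Prop :=
  (∀ n : ℕ, (n : ℕ∞) < N → b n ∈ unitBall) ∧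
    ∀ K : Set ℍ[ℝ], K ⊆ unitBall → IsCompact K →
      TendstoUniformlyOn (fun k => partialProd N b k) B atTop K

/-! ### Multiplicities and the sequence of zeros -/

/-- `(q - p₁) * ⋯ * (q - pₙ) * g` (regular products). -/
def linearFactors : List ℍ[ℝ] → (ℍ[ℝ] → ℍ[ℝ]) → ℍ[ℝ] → ℍ[ℝ]
  | [], g => g
  | p :: ps, g => starProd (fun q => q - p) (linearFactors ps g)

/-- `f(q) = ((q-x)² + y²)^m (q-p₁) * ⋯ * (q-pₙ) * g(q)` on the unit ball, with all `pᵢ` on the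
sphere `x + y𝕊`, `pᵢ` different from the conjugate of `pᵢ₊₁`, and `g` regular without zeros on
that sphere. -/
def IsSphereFactorization (f : ℍ[ℝ] → ℍ[ℝ]) (x y : ℝ) (m : ℕ) (ps : List ℍ[ℝ]) : Prop :=
  (∀ p ∈ ps, p ∈ sphereOf x y) ∧
    ps.IsChain (fun p p' => p ≠ star p') ∧
    ∃ g : ℍ[ℝ] → ℍ[ℝ], SliceRegular g ∧ (∀ q ∈ sphereOf x y, g q ≠ 0) ∧
      ∀ q ∈ unitBall,
        f q = ((q - (x : ℍ[ℝ])) ^ 2 + (y : ℍ[ℝ]) ^ 2) ^ m * linearFactors ps g q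

/-- The sphere `x + y𝕊`, `y ≠ 0`, has spherical multiplicity `k` (which is `0` when the sphere is
not a spherical zero). -/
def HasSphericalMultiplicity (f : ℍ[ℝ] → ℍ[ℝ]) (x y : ℝ) (k : ℕ) : Prop :=
  ∃ m ps, IsSphereFactorization f x y m ps ∧ k = 2 * m

open Classical in
/-- The point `p` has isolated multiplicity `n`. At a non-real `p` this is the number of linear
factors if `p` is the first point `p₁` in the factorization on the sphere of `p`, and `0`
otherwise. -/
def HasIsolatedMultiplicity (f : ℍ[ℝ] → ℍ[ℝ]) (p : ℍ[ℝ]) (n : ℕ) : Prop :=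
  if p.im = 0 then
    ∃ h : ℍ[ℝ] → ℍ[ℝ], SliceRegular h ∧ h p ≠ 0 ∧ ∀ q ∈ unitBall, f q = (q - p) ^ n * h q
  else
    ∃ m ps, IsSphereFactorization f p.re ‖p.im‖ m ps ∧
      n = if ps.head? = some p then ps.length else 0

open Classical in
/-- `(a_n)_{n < N}` is a sequence of zeros of `f`. The three parts: all terms are zeros of `f`;
every real point occurs as often as its isolated multiplicity says; on every sphere `x + y𝕊`
of spherical multiplicity `2m`, some generator `c` and its conjugate occur `m` times each, every
point occurs in addition as often as its isolated multiplicity says, and where the sequence enters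
a sphere it first runs `m` times through a generator and its conjugate. -/
def IsZeroSequence (f : ℍ[ℝ] → ℍ[ℝ]) (N : ℕ∞) (a : ℕ → ℍ[ℝ]) : Prop :=
  (∀ n : ℕ, (n : ℕ∞) < N → a n ∈ unitBall ∧ f (a n) = 0) ∧
  (∀ x : ℝ, (x : ℍ[ℝ]) ∈ unitBall →
    ∃ k : ℕ, HasIsolatedMultiplicity f (x : ℍ[ℝ]) k ∧
      {n : ℕ | (n : ℕ∞) < N ∧ a n = (x : ℍ[ℝ])}.encard = (k : ℕ∞)) ∧
  (∀ x y : ℝ, 0 < y → x ^ 2 + y ^ 2 < 1 →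
    ∃ m : ℕ, HasSphericalMultiplicity f x y (2 * m) ∧
      (∃ c ∈ sphereOf x y, ∀ q ∈ sphereOf x y,
        ∃ k : ℕ, HasIsolatedMultiplicity f q k ∧
          {n : ℕ | (n : ℕ∞) < N ∧ a n = q}.encard =
            (((if q = c ∨ q = star c then m else 0) + k : ℕ) : ℕ∞)) ∧
      ∀ l : ℕ, (l : ℕ∞) < N → a l ∈ sphereOf x y → (∀ j : ℕ, l = j + 1 → a j ∉ sphereOf x y) →
        ∀ k < m, ((l + 2 * k + 1 : ℕ) : ℕ∞) < N ∧
          a (l + 2 * k) = a l ∧ a (l + 2 * k + 1) = star (a l))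

end

end QHardy

/-! A regular f is encoded by its stem function: a holomorphic map F = α + iβ from the disc to the
complexified quaternions, symmetric under conjugation, with f(x + yJ) = α + Jβ at z = x + iy.
Regular products become pointwise products, and `normSq F`, the stem of the symmetrization, is an
ordinary holomorphic function. It vanishes at z exactly when f has a zero on the sphere of z; two
zeros on one sphere force F(z) = 0 (`eq_zero_of_evJ_two`); and (s * t)(q) = s(q) t(s(q)⁻¹ q s(q))
where s(q) ≠ 0 (`evJ_mul_of_ne_zero`).

The b_n come from successive division. Let f = P_n * g. At the sphere of a_n the order of `normSq F`
counts all terms of the zero sequence on that sphere, with weight two at real points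
(`IsZeroSequence.ordDet_eq`), while the order of P_n counts only the earlier ones. Hence g has a
zero on that sphere; any zero serves as b_n, and if P_n(a_n) ≠ 0 the product formula exhibits
T_n(a_n) as one. The Blaschke factor of b_n then splits off g on the left (`exists_division_step`,
`exists_factorization`).

Jensen's formula for `normSq F` gives Σ (1 - |a_n|) < ∞ (`IsZeroSequence.summable`). Since |b_n| =
|a_n| and the stem of M_b differs from 1 by O(1 - |b|) locally uniformly
(`norm_blaschkeStem_sub_one_le`), the product converges to a regular B.

Only finitely many terms lie on a given sphere. Past them, f = P * g and B = P * R with g and R free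
of zeros there (`exists_split`), so each factorization of one function on the sphere transfers to
the other (`exists_factor_transfer`), and all multiplicities agree.

For the last claim (`induced_mulSeq_ne_zero`), either P_n has order 0 at the sphere of a_n, or the
sequence enters that sphere at the conjugate of a_n just before index n. Then P_n has order 1 and
already vanishes at the conjugate; a second zero at a_n would raise the order to 2. -/

namespace QHardy

noncomputable section

/-! ### Component lemmas -/

/-- The quaternion with the given components. -/
def qmk {R : Type*} [CommRing R] (a b c d : R) : ℍ[R] := ⟨a, b, c, d⟩

section Components
variable {R : Type*} [CommRing R] (a b c d : R)

@[simp] theorem re_qmk : (qmk a b c d).re = a := rfl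
@[simp] theorem imI_qmk : (qmk a b c d).imI = b := rfl
@[simp] theorem imJ_qmk : (qmk a b c d).imJ = c := rfl
@[simp] theorem imK_qmk : (qmk a b c d).imK = d := rfl

end Components

@[simp] theorem re_unitI : unitI.re = 0 := rfl
@[simp] theorem imI_unitI : unitI.imI = 1 := rfl
@[simp] theorem imJ_unitI : unitI.imJ = 0 := rfl
@[simp] theorem imK_unitI : unitI.imK = 0 := rfl
@[simp] theorem re_unitJ : unitJ.re = 0 := rfl
@[simp] theorem imI_unitJ : unitJ.imI = 0 := rfl
@[simp] theorem imJ_unitJ : unitJ.imJ = 1 := rfl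
@[simp] theorem imK_unitJ : unitJ.imK = 0 := rfl

/-! ### Complexified quaternions as a Banach algebra -/

/-- The `ℓ¹` norm of the components. -/
instance instNormComplexQuaternion : Norm ℍ[ℂ] :=
  ⟨fun s => ‖s.re‖ + ‖s.imI‖ + ‖s.imJ‖ + ‖s.imK‖⟩

theorem norm_def (s : ℍ[ℂ]) : ‖s‖ = ‖s.re‖ + ‖s.imI‖ + ‖s.imJ‖ + ‖s.imK‖ := rfl

theorem normCore : NormedSpace.Core ℂ ℍ[ℂ] where
  norm_nonneg s := by rw [norm_def]; positivity
  norm_smul c s := by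
    simp only [norm_def, Quaternion.re_smul, Quaternion.imI_smul, Quaternion.imJ_smul,
      Quaternion.imK_smul, smul_eq_mul, norm_mul]
    ring
  norm_triangle s t := by
    simp only [norm_def, Quaternion.re_add, Quaternion.imI_add, Quaternion.imJ_add,
      Quaternion.imK_add]
    linarith [norm_add_le s.re t.re, norm_add_le s.imI t.imI, norm_add_le s.imJ t.imJ,
      norm_add_le s.imK t.imK]
  norm_eq_zero_iff s := by
    rw [norm_def]
    constructor
    · intro h
      have h1 := norm_nonneg s.re
      have h2 := norm_nonneg s.imI
      have h3 := norm_nonneg s.imJ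
      have h4 := norm_nonneg s.imK
      apply Quaternion.ext
      · exact norm_eq_zero.1 (by linarith)
      · exact norm_eq_zero.1 (by linarith)
      · exact norm_eq_zero.1 (by linarith)
      · exact norm_eq_zero.1 (by linarith)
    · rintro rfl
      simp

instance instNormedAddCommGroupComplexQuaternion : NormedAddCommGroup ℍ[ℂ] :=
  NormedAddCommGroup.ofCore normCore

/-- Each component of the product is a signed sum of four products, and together these are the
sixteen products in the expansion of the right-hand side. -/
theorem norm_mul_le_complexQuaternion (s t : ℍ[ℂ]) : ‖s * t‖ ≤ ‖s‖ * ‖t‖ := by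
  have key : ∀ a b c d : ℂ, ‖a‖ ≤ ‖a‖ ∧ ‖a - b - c - d‖ ≤ ‖a‖ + ‖b‖ + ‖c‖ + ‖d‖ ∧
      ‖a + b + c - d‖ ≤ ‖a‖ + ‖b‖ + ‖c‖ + ‖d‖ := by
    intro a b c d
    refine ⟨le_rfl, ?_, ?_⟩
    · linarith [norm_sub_le (a - b - c) d, norm_sub_le (a - b) c, norm_sub_le a b]
    · linarith [norm_sub_le (a + b + c) d, norm_add_le (a + b) c, norm_add_le a b]
  have key' : ∀ a b c d : ℂ, ‖a - b + c + d‖ ≤ ‖a‖ + ‖b‖ + ‖c‖ + ‖d‖ := by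
    intro a b c d
    linarith [norm_add_le (a - b + c) d, norm_add_le (a - b) c, norm_sub_le a b]
  have key'' : ∀ a b c d : ℂ, ‖a + b - c + d‖ ≤ ‖a‖ + ‖b‖ + ‖c‖ + ‖d‖ := by
    intro a b c d
    linarith [norm_add_le (a + b - c) d, norm_sub_le (a + b) c, norm_add_le a b]
  have h1 := (key (s.re * t.re) (s.imI * t.imI) (s.imJ * t.imJ) (s.imK * t.imK)).2.1
  have h2 := (key (s.re * t.imI) (s.imI * t.re) (s.imJ * t.imK) (s.imK * t.imJ)).2.2
  have h3 := key' (s.re * t.imJ) (s.imI * t.imK) (s.imJ * t.re) (s.imK * t.imI)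
  have h4 := key'' (s.re * t.imK) (s.imI * t.imJ) (s.imJ * t.imI) (s.imK * t.re)
  simp only [norm_mul] at h1 h2 h3 h4
  rw [norm_def, norm_def s, norm_def t, Quaternion.re_mul, Quaternion.imI_mul, Quaternion.imJ_mul,
    Quaternion.imK_mul]
  nlinarith [h1, h2, h3, h4]

instance instNormedRingComplexQuaternion : NormedRing ℍ[ℂ] where
  __ := instNormedAddCommGroupComplexQuaternion
  __ := (inferInstance : Ring ℍ[ℂ])
  norm_mul_le := norm_mul_le_complexQuaternion

instance instNormedAlgebraComplexQuaternion : NormedAlgebra ℂ ℍ[ℂ] where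
  norm_smul_le c s := (normCore.norm_smul c s).le

instance instNormOneClassComplexQuaternion : NormOneClass ℍ[ℂ] where
  norm_one := by simp [norm_def]

instance instCompleteSpaceComplexQuaternion : CompleteSpace ℍ[ℂ] :=
  FiniteDimensional.complete ℂ ℍ[ℂ]

/-- The real component as a continuous linear map. -/
def reL : ℍ[ℂ] →L[ℂ] ℂ :=
  LinearMap.mkContinuous ⟨⟨fun s => s.re, fun _ _ => rfl⟩, fun _ _ => rfl⟩ 1 fun s => by
    change ‖s.re‖ ≤ 1 * ‖s‖
    rw [norm_def]; linarith [norm_nonneg s.imI, norm_nonneg s.imJ, norm_nonneg s.imK]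

/-- The `i` component as a continuous linear map. -/
def imIL : ℍ[ℂ] →L[ℂ] ℂ :=
  LinearMap.mkContinuous ⟨⟨fun s => s.imI, fun _ _ => rfl⟩, fun _ _ => rfl⟩ 1 fun s => by
    change ‖s.imI‖ ≤ 1 * ‖s‖
    rw [norm_def]; linarith [norm_nonneg s.re, norm_nonneg s.imJ, norm_nonneg s.imK]

/-- The `j` component as a continuous linear map. -/
def imJL : ℍ[ℂ] →L[ℂ] ℂ :=
  LinearMap.mkContinuous ⟨⟨fun s => s.imJ, fun _ _ => rfl⟩, fun _ _ => rfl⟩ 1 fun s => by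
    change ‖s.imJ‖ ≤ 1 * ‖s‖
    rw [norm_def]; linarith [norm_nonneg s.re, norm_nonneg s.imI, norm_nonneg s.imK]

/-- The `k` component as a continuous linear map. -/
def imKL : ℍ[ℂ] →L[ℂ] ℂ :=
  LinearMap.mkContinuous ⟨⟨fun s => s.imK, fun _ _ => rfl⟩, fun _ _ => rfl⟩ 1 fun s => by
    change ‖s.imK‖ ≤ 1 * ‖s‖
    rw [norm_def]; linarith [norm_nonneg s.re, norm_nonneg s.imI, norm_nonneg s.imJ]

theorem eq_sum_components (s : ℍ[ℂ]) :
    s = s.re • (1 : ℍ[ℂ]) + s.imI • qmk (0 : ℂ) 1 0 0 + s.imJ • qmk (0 : ℂ) 0 1 0 +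
      s.imK • qmk (0 : ℂ) 0 0 1 := by
  apply Quaternion.ext <;> simp

theorem differentiableOn_iff_components {s : ℂ → ℍ[ℂ]} {U : Set ℂ} :
    DifferentiableOn ℂ s U ↔ DifferentiableOn ℂ (fun z => (s z).re) U ∧
      DifferentiableOn ℂ (fun z => (s z).imI) U ∧ DifferentiableOn ℂ (fun z => (s z).imJ) U ∧
      DifferentiableOn ℂ (fun z => (s z).imK) U := by
  constructor
  · intro h
    exact ⟨reL.differentiable.comp_differentiableOn h, imIL.differentiable.comp_differentiableOn h,
      imJL.differentiable.comp_differentiableOn h, imKL.differentiable.comp_differentiableOn h⟩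
  · rintro ⟨h0, h1, h2, h3⟩
    have := (((h0.smul_const (1 : ℍ[ℂ])).add (h1.smul_const (qmk (0 : ℂ) 1 0 0))).add
      (h2.smul_const (qmk (0 : ℂ) 0 1 0))).add (h3.smul_const (qmk (0 : ℂ) 0 0 1))
    refine this.congr fun z _ => ?_
    exact eq_sum_components (s z)

/-! ### Real and imaginary part, conjugation, embedding of the quaternions -/

/-- Componentwise complex conjugation. -/
def conjC (s : ℍ[ℂ]) : ℍ[ℂ] :=
  ⟨starRingEnd ℂ s.re, starRingEnd ℂ s.imI, starRingEnd ℂ s.imJ, starRingEnd ℂ s.imK⟩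

/-- Componentwise real part. -/
def reP (s : ℍ[ℂ]) : ℍ[ℝ] := ⟨s.re.re, s.imI.re, s.imJ.re, s.imK.re⟩

/-- Componentwise imaginary part. -/
def imP (s : ℍ[ℂ]) : ℍ[ℝ] := ⟨s.re.im, s.imI.im, s.imJ.im, s.imK.im⟩

/-- The inclusion of the real quaternions in the complex ones. -/
def incl (q : ℍ[ℝ]) : ℍ[ℂ] := ⟨q.re, q.imI, q.imJ, q.imK⟩

section
variable (s : ℍ[ℂ]) (q : ℍ[ℝ])

@[simp] theorem re_conjC : (conjC s).re = starRingEnd ℂ s.re := rfl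
@[simp] theorem imI_conjC : (conjC s).imI = starRingEnd ℂ s.imI := rfl
@[simp] theorem imJ_conjC : (conjC s).imJ = starRingEnd ℂ s.imJ := rfl
@[simp] theorem imK_conjC : (conjC s).imK = starRingEnd ℂ s.imK := rfl
@[simp] theorem re_reP : (reP s).re = s.re.re := rfl
@[simp] theorem imI_reP : (reP s).imI = s.imI.re := rfl
@[simp] theorem imJ_reP : (reP s).imJ = s.imJ.re := rfl
@[simp] theorem imK_reP : (reP s).imK = s.imK.re := rfl
@[simp] theorem re_imP : (imP s).re = s.re.im := rfl
@[simp] theorem imI_imP : (imP s).imI = s.imI.im := rfl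
@[simp] theorem imJ_imP : (imP s).imJ = s.imJ.im := rfl
@[simp] theorem imK_imP : (imP s).imK = s.imK.im := rfl
@[simp] theorem re_incl : (incl q).re = q.re := rfl
@[simp] theorem imI_incl : (incl q).imI = q.imI := rfl
@[simp] theorem imJ_incl : (incl q).imJ = q.imJ := rfl
@[simp] theorem imK_incl : (incl q).imK = q.imK := rfl

end

/-! ### Evaluation at an imaginary unit and zeros on one sphere -/

/-- Evaluation of `α + iβ` at the imaginary unit `J`. -/
def evJ (J : ℍ[ℝ]) (s : ℍ[ℂ]) : ℍ[ℝ] := reP s + J * imP s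

/-- The complex number `x + iy` that represents the sphere of `q`. -/
def toC (q : ℍ[ℝ]) : ℂ := ⟨q.re, ‖q.im‖⟩

/-- The imaginary unit of `q` (`0` for real `q`). -/
def dirOf (q : ℍ[ℝ]) : ℍ[ℝ] := ‖q.im‖⁻¹ • q.im

/-- The imaginary part of J² is 2 Re(J) Im(J). If Re(J) ≠ 0 it forces J to be real, and no real
square is -1. -/
theorem mem_imUnits {J : ℍ[ℝ]} : J ∈ imUnits ↔ J.re = 0 ∧ Quaternion.normSq J = 1 := by
  unfold imUnits
  rw [Set.mem_ofPred_eq, pow_two, Quaternion.ext_iff, Quaternion.normSq_def']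
  simp only [Quaternion.re_mul, Quaternion.imI_mul, Quaternion.imJ_mul, Quaternion.imK_mul,
    Quaternion.re_neg, Quaternion.imI_neg, Quaternion.imJ_neg, Quaternion.imK_neg,
    Quaternion.re_one, Quaternion.imI_one, Quaternion.imJ_one, Quaternion.imK_one]
  constructor
  · rintro ⟨h0, h1, h2, h3⟩
    have hr : J.re = 0 := by
      by_contra hr
      have e1 : J.imI = 0 := by
        have : J.re * J.imI = 0 := by linarith
        exact (mul_eq_zero.1 this).resolve_left hr
      have e2 : J.imJ = 0 := by
        have : J.re * J.imJ = 0 := by linarith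
        exact (mul_eq_zero.1 this).resolve_left hr
      have e3 : J.imK = 0 := by
        have : J.re * J.imK = 0 := by linarith
        exact (mul_eq_zero.1 this).resolve_left hr
      rw [e1, e2, e3] at h0
      nlinarith [sq_nonneg J.re]
    refine ⟨hr, ?_⟩
    rw [hr] at h0 ⊢
    linarith
  · rintro ⟨hr, h⟩
    rw [hr] at h ⊢
    refine ⟨by linarith, by ring, by ring, by ring⟩

theorem imUnits_mul_self {J : ℍ[ℝ]} (hJ : J ∈ imUnits) : J * J = -1 := by
  have : J ^ 2 = -1 := hJ
  rwa [pow_two] at this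

theorem imUnits_ne_zero {J : ℍ[ℝ]} (hJ : J ∈ imUnits) : J ≠ 0 := by
  rintro rfl
  have := (mem_imUnits.1 hJ).2
  simp at this

theorem neg_mem_imUnits {J : ℍ[ℝ]} (hJ : J ∈ imUnits) : -J ∈ imUnits := by
  have : J ^ 2 = -1 := hJ
  simpa [imUnits] using this

theorem unitI_mem : unitI ∈ imUnits := by
  rw [mem_imUnits, Quaternion.normSq_def']
  simp

theorem norm_imUnits {J : ℍ[ℝ]} (hJ : J ∈ imUnits) : ‖J‖ = 1 := by
  have := (mem_imUnits.1 hJ).2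
  rw [Quaternion.normSq_eq_norm_mul_self] at this
  nlinarith [norm_nonneg J]

/-- This form of the product rule also covers u = 0. It rests on J(α + Jβ) = Jα - β. -/
theorem evJ_mul {J u : ℍ[ℝ]} (hJ : J ∈ imUnits) (s t : ℍ[ℂ]) (hu : u = evJ J s) :
    evJ J (s * t) = u * reP t + J * u * imP t := by
  have h2 := imUnits_mul_self hJ
  have e1 : reP (s * t) = reP s * reP t - imP s * imP t := by
    apply Quaternion.ext <;> simp <;> ring
  have e2 : imP (s * t) = reP s * imP t + imP s * reP t := by
    apply Quaternion.ext <;> simp <;> ring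
  rw [hu, evJ, evJ, e1, e2]
  have : J * (reP s + J * imP s) * imP t = J * reP s * imP t + (J * J) * imP s * imP t := by
    noncomm_ring
  rw [this, h2]
  noncomm_ring

/-- `ev_J (s t) = ev_J(s) ev_{J'}(t)` with `J'` the conjugate of `J` by `ev_J(s)`. -/
theorem evJ_mul_of_ne_zero {J u : ℍ[ℝ]} (hJ : J ∈ imUnits) (s t : ℍ[ℂ]) (hu : u = evJ J s)
    (h0 : u ≠ 0) : evJ J (s * t) = u * evJ (u⁻¹ * J * u) t := by
  rw [evJ_mul hJ s t hu, evJ, mul_add, ← mul_assoc, ← mul_assoc, ← mul_assoc, mul_inv_cancel₀ h0,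
    one_mul]

theorem evJ_mul_eq_zero {J : ℍ[ℝ]} (hJ : J ∈ imUnits) {s : ℍ[ℂ]} (t : ℍ[ℂ]) (hs : evJ J s = 0) :
    evJ J (s * t) = 0 := by
  rw [evJ_mul hJ s t hs.symm]; simp

theorem conj_mem_imUnits {J u : ℍ[ℝ]} (hJ : J ∈ imUnits) (h0 : u ≠ 0) :
    u⁻¹ * J * u ∈ imUnits := by
  change (u⁻¹ * J * u) ^ 2 = -1
  have : (u⁻¹ * J * u) ^ 2 = u⁻¹ * J * (u * u⁻¹) * J * u := by noncomm_ring
  rw [this, mul_inv_cancel₀ h0, mul_one, mul_assoc u⁻¹, imUnits_mul_self hJ]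
  simp [h0]

theorem eq_zero_of_reP_imP {s : ℍ[ℂ]} (h1 : reP s = 0) (h2 : imP s = 0) : s = 0 := by
  rw [Quaternion.ext_iff] at h1 h2
  simp only [re_reP, imI_reP, imJ_reP, imK_reP, re_imP, imI_imP, imJ_imP, imK_imP,
    Quaternion.re_zero, Quaternion.imI_zero, Quaternion.imJ_zero, Quaternion.imK_zero] at h1 h2
  apply Quaternion.ext <;> apply Complex.ext <;> simp [h1, h2]

theorem normSq_re_im (s : ℍ[ℂ]) : Quaternion.normSq s =
    ⟨Quaternion.normSq (reP s) - Quaternion.normSq (imP s), 2 * (reP s * star (imP s)).re⟩ := by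
  rw [Quaternion.normSq_def', Quaternion.normSq_def', Quaternion.normSq_def']
  apply Complex.ext
  · simp [pow_two]; ring
  · simp [pow_two]; ring

/-- By `normSq_re_im` the condition is |α| = |β| and α ⊥ β, and α = -Jβ satisfies both. -/
theorem normSq_eq_zero_of_evJ {J : ℍ[ℝ]} (hJ : J ∈ imUnits) {s : ℍ[ℂ]} (h : evJ J s = 0) :
    Quaternion.normSq s = 0 := by
  have h1 : reP s = -(J * imP s) := eq_neg_of_add_eq_zero_left h
  obtain ⟨hr, hn⟩ := mem_imUnits.1 hJ
  rw [normSq_re_im, h1, Quaternion.normSq_neg, map_mul, hn]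
  apply Complex.ext
  · simp
  · have : -(J * imP s) * star (imP s) = -(J * (imP s * star (imP s))) := by noncomm_ring
    simp only [this, Quaternion.self_mul_star]
    simp [hr]

theorem exists_evJ_eq_zero {s : ℍ[ℂ]} (h : Quaternion.normSq s = 0) :
    ∃ J ∈ imUnits, evJ J s = 0 := by
  rw [normSq_re_im, Complex.ext_iff] at h
  simp only [Complex.zero_re, Complex.zero_im] at h
  obtain ⟨h1, h2⟩ := h
  by_cases hb : imP s = 0
  · refine ⟨unitI, unitI_mem, ?_⟩
    rw [hb] at h1
    simp only [map_zero, sub_zero, Quaternion.normSq_eq_zero] at h1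
    simp [evJ, hb, h1]
  · have hb' : Quaternion.normSq (imP s) ≠ 0 := by simpa using hb
    -- The equation α + Jβ = 0 determines J = -αβ⁻¹. Here |α| = |β| makes it a unit and α ⊥ β makes
    -- it purely imaginary.
    refine ⟨-(reP s * (imP s)⁻¹), ?_, ?_⟩
    · rw [mem_imUnits]
      constructor
      · rw [Quaternion.inv_def]
        simp only [mul_smul_comm, Quaternion.re_neg, Quaternion.re_smul, smul_eq_mul]
        have : (reP s * star (imP s)).re = 0 := by linarith
        rw [this]; simp
      · rw [Quaternion.normSq_neg, map_mul, Quaternion.normSq_inv]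
        have : Quaternion.normSq (reP s) = Quaternion.normSq (imP s) := by linarith
        rw [this, mul_inv_cancel₀ hb']
    · rw [evJ, neg_mul, mul_assoc, inv_mul_cancel₀ hb]; simp

/-- Subtracting the two equations leaves (J - J')β = 0. A sphere with two zeros is therefore a
spherical zero. -/
theorem eq_zero_of_evJ_two {J J' : ℍ[ℝ]} (hJ : J ≠ J') {s : ℍ[ℂ]} (h : evJ J s = 0)
    (h' : evJ J' s = 0) : s = 0 := by
  have h1 : (J - J') * imP s = 0 := by
    have : evJ J s - evJ J' s = (J - J') * imP s := by rw [evJ, evJ]; noncomm_ring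
    rw [← this, h, h', sub_zero]
  have h2 : imP s = 0 := (mul_eq_zero.1 h1).resolve_left (sub_ne_zero.2 hJ)
  have h3 : reP s = 0 := by simpa [evJ, h2] using h
  exact eq_zero_of_reP_imP h3 h2

/-- For u = 1 - Ii both products equal I + i. This u vanishes only for I = -i, where j conjugates
instead. -/
theorem exists_conj_unitI {I : ℍ[ℝ]} (hI : I ∈ imUnits) : ∃ u : ℍ[ℝ], u ≠ 0 ∧ u * unitI = I * u := by
  have hi := imUnits_mul_self unitI_mem
  by_cases h : I = -unitI
  · refine ⟨unitJ, ?_, ?_⟩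
    · intro h0
      have := congrArg (fun q : ℍ[ℝ] => q.imJ) h0
      simp at this
    · rw [h]
      apply Quaternion.ext <;> simp
  · refine ⟨1 - I * unitI, ?_, ?_⟩
    · intro h0
      apply h
      have h1 : I * unitI = 1 := (sub_eq_zero.1 h0).symm
      have : I * unitI * unitI = unitI := by rw [h1, one_mul]
      rw [mul_assoc, hi] at this
      simp only [mul_neg, mul_one] at this
      rw [← this]; simp
    · have h2 := imUnits_mul_self hI
      rw [sub_mul, mul_sub, mul_assoc I, hi, ← mul_assoc I I, h2]
      noncomm_ring

theorem exists_conj_imUnits {I J : ℍ[ℝ]} (hI : I ∈ imUnits) (hJ : J ∈ imUnits) :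
    ∃ w : ℍ[ℝ], w ≠ 0 ∧ J = w⁻¹ * I * w := by
  obtain ⟨u, hu, hu'⟩ := exists_conj_unitI hI
  obtain ⟨v, hv, hv'⟩ := exists_conj_unitI hJ
  refine ⟨u * v⁻¹, mul_ne_zero hu (inv_ne_zero hv), ?_⟩
  have e1 : I = u * unitI * u⁻¹ := by rw [hu', mul_assoc, mul_inv_cancel₀ hu, mul_one]
  have e2 : J = v * unitI * v⁻¹ := by rw [hv', mul_assoc, mul_inv_cancel₀ hv, mul_one]
  rw [e1, e2, mul_inv_rev, inv_inv]
  have : v * u⁻¹ * (u * unitI * u⁻¹) * (u * v⁻¹) = v * (u⁻¹ * u) * unitI * (u⁻¹ * u) * v⁻¹ := by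
    noncomm_ring
  rw [this, inv_mul_cancel₀ hu]; simp

theorem norm_im_sq (q : ℍ[ℝ]) : ‖q.im‖ ^ 2 = q.imI ^ 2 + q.imJ ^ 2 + q.imK ^ 2 := by
  rw [pow_two, ← Quaternion.normSq_eq_norm_mul_self, Quaternion.normSq_def']
  simp

theorem dirOf_mem {q : ℍ[ℝ]} (hq : q.im ≠ 0) : dirOf q ∈ imUnits := by
  have h : ‖q.im‖ ≠ 0 := norm_ne_zero_iff.2 hq
  rw [mem_imUnits]
  refine ⟨by simp [dirOf], ?_⟩
  rw [dirOf, Quaternion.normSq_smul, Quaternion.normSq_eq_norm_mul_self]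
  field_simp

theorem eq_re_add_dirOf (q : ℍ[ℝ]) : q = (q.re : ℍ[ℝ]) + (‖q.im‖ : ℍ[ℝ]) * dirOf q := by
  by_cases h : q.im = 0
  · conv_lhs => rw [← Quaternion.re_add_im q]
    simp [dirOf, h]
  · have h' : ‖q.im‖ ≠ 0 := norm_ne_zero_iff.2 h
    conv_lhs => rw [← Quaternion.re_add_im q]
    rw [dirOf, Quaternion.coe_mul_eq_smul, smul_smul, mul_inv_cancel₀ h', one_smul]

theorem norm_toC (q : ℍ[ℝ]) : ‖toC q‖ = ‖q‖ := by
  have h1 : ‖toC q‖ ^ 2 = ‖q‖ ^ 2 := by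
    rw [← Complex.normSq_eq_norm_sq, Complex.normSq_apply, pow_two ‖q‖,
      ← Quaternion.normSq_eq_norm_mul_self, Quaternion.normSq_def']
    have := norm_im_sq q
    simp only [toC]
    nlinarith
  exact (pow_left_inj₀ (norm_nonneg _) (norm_nonneg _) two_ne_zero).1 h1

section SlicePoint
variable {J : ℍ[ℝ]} (x y : ℝ)

theorem re_slice (hJ : J ∈ imUnits) : ((x : ℍ[ℝ]) + (y : ℍ[ℝ]) * J).re = x := by
  simp [(mem_imUnits.1 hJ).1]

theorem im_slice (hJ : J ∈ imUnits) : ((x : ℍ[ℝ]) + (y : ℍ[ℝ]) * J).im = y • J := by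
  apply Quaternion.ext <;> simp [(mem_imUnits.1 hJ).1]

theorem norm_im_slice (hJ : J ∈ imUnits) : ‖((x : ℍ[ℝ]) + (y : ℍ[ℝ]) * J).im‖ = |y| := by
  rw [im_slice x y hJ, norm_smul, norm_imUnits hJ, mul_one, Real.norm_eq_abs]

theorem toC_slice (hJ : J ∈ imUnits) (hy : 0 ≤ y) :
    toC ((x : ℍ[ℝ]) + (y : ℍ[ℝ]) * J) = ⟨x, y⟩ := by
  rw [toC, re_slice x y hJ, norm_im_slice x y hJ, abs_of_nonneg hy]

theorem dirOf_slice (hJ : J ∈ imUnits) (hy : 0 < y) :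
    dirOf ((x : ℍ[ℝ]) + (y : ℍ[ℝ]) * J) = J := by
  rw [dirOf, norm_im_slice x y hJ, im_slice x y hJ, abs_of_pos hy, smul_smul,
    inv_mul_cancel₀ hy.ne', one_smul]

end SlicePoint

theorem mem_sphereOf_iff {x y : ℝ} (hy : 0 ≤ y) {q : ℍ[ℝ]} :
    q ∈ sphereOf x y ↔ toC q = ⟨x, y⟩ := by
  constructor
  · rintro ⟨J, hJ, rfl⟩
    exact toC_slice x y hJ hy
  · intro h
    have h1 : q.re = x := congrArg Complex.re h
    have h2 : ‖q.im‖ = y := congrArg Complex.im h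
    by_cases hq : q.im = 0
    · refine ⟨unitI, unitI_mem, ?_⟩
      rw [← h2, hq, ← h1]
      conv_lhs => rw [← Quaternion.re_add_im q, hq]
      simp
    · refine ⟨dirOf q, dirOf_mem hq, ?_⟩
      rw [← h1, ← h2]
      exact eq_re_add_dirOf q

theorem mem_unitBall {q : ℍ[ℝ]} : q ∈ unitBall ↔ ‖q‖ < 1 := by simp [unitBall]

/-! ### Stem functions -/

section ConjC
variable (s t : ℍ[ℂ])

@[simp] theorem conjC_conjC : conjC (conjC s) = s := by
  apply Quaternion.ext <;> simp

theorem conjC_mul : conjC (s * t) = conjC s * conjC t := by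
  apply Quaternion.ext <;> simp

theorem conjC_add : conjC (s + t) = conjC s + conjC t := by
  apply Quaternion.ext <;> simp

theorem conjC_sub : conjC (s - t) = conjC s - conjC t := by
  apply Quaternion.ext <;> simp

theorem conjC_star : conjC (star s) = star (conjC s) := by
  apply Quaternion.ext <;> simp

theorem conjC_smul (c : ℂ) : conjC (c • s) = starRingEnd ℂ c • conjC s := by
  apply Quaternion.ext <;> simp

@[simp] theorem conjC_zero : conjC 0 = 0 := by
  apply Quaternion.ext <;> simp

@[simp] theorem conjC_one : conjC 1 = 1 := by
  apply Quaternion.ext <;> simp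

@[simp] theorem conjC_incl (q : ℍ[ℝ]) : conjC (incl q) = incl q := by
  apply Quaternion.ext <;> simp

theorem normSq_conjC : Quaternion.normSq (conjC s) = starRingEnd ℂ (Quaternion.normSq s) := by
  simp [Quaternion.normSq_def']

theorem norm_conjC : ‖conjC s‖ = ‖s‖ := by
  simp [norm_def]

theorem evJ_conjC (J : ℍ[ℝ]) : evJ J (conjC s) = evJ (-J) s := by
  have h1 : reP (conjC s) = reP s := by apply Quaternion.ext <;> simp
  have h2 : imP (conjC s) = -imP s := by apply Quaternion.ext <;> simp
  rw [evJ, evJ, h1, h2]; noncomm_ring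

end ConjC

/-- The symmetry of stem functions. -/
def IsStem (s : ℂ → ℍ[ℂ]) : Prop := ∀ z, s (starRingEnd ℂ z) = conjC (s z)

/-- The slice function induced by a stem function. -/
def induced (s : ℂ → ℍ[ℂ]) (q : ℍ[ℝ]) : ℍ[ℝ] := evJ (dirOf q) (s (toC q))

/-- The stem function of the slice function with splitting `A + B j` on the slice of `i`. -/
def stemSplit (A B : ℂ → ℂ) (z : ℂ) : ℍ[ℂ] :=
  qmk ((1 / 2) * (A z + starRingEnd ℂ (A (starRingEnd ℂ z))))
    ((Complex.I / 2) * (starRingEnd ℂ (A (starRingEnd ℂ z)) - A z))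
    ((1 / 2) * (B z + starRingEnd ℂ (B (starRingEnd ℂ z))))
    ((Complex.I / 2) * (starRingEnd ℂ (B (starRingEnd ℂ z)) - B z))

/-- The stem function of a slice function. -/
def stemOf (f : ℍ[ℝ] → ℍ[ℝ]) : ℂ → ℍ[ℂ] := stemSplit (splitF f) (splitG f)

theorem isStem_stemSplit (A B : ℂ → ℂ) : IsStem (stemSplit A B) := by
  intro z
  have h2 : starRingEnd ℂ 2 = 2 := Complex.conj_ofNat 2
  apply Quaternion.ext <;> simp [stemSplit, h2] <;> ring

theorem isStem_stemOf (f : ℍ[ℝ] → ℍ[ℝ]) : IsStem (stemOf f) := isStem_stemSplit _ _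

theorem ext_eq_induced (A B : ℂ → ℂ) :
    ext (fun z => (A z : ℍ[ℝ]) + (B z : ℍ[ℝ]) * unitJ) = induced (stemSplit A B) := by
  funext q
  have hc : starRingEnd ℂ (toC q) = ⟨q.re, -‖q.im‖⟩ := rfl
  have h1 : reP (stemSplit A B (toC q)) = (1 / 2 : ℝ) •
      (((A (toC q) : ℍ[ℝ]) + (B (toC q) : ℍ[ℝ]) * unitJ) +
        ((A ⟨q.re, -‖q.im‖⟩ : ℍ[ℝ]) + (B ⟨q.re, -‖q.im‖⟩ : ℍ[ℝ]) * unitJ)) := by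
    rw [stemSplit, hc]
    apply Quaternion.ext <;> simp [-Quaternion.coe_real_complex_mul] <;> ring
  have h2 : imP (stemSplit A B (toC q)) = ((1 / 2 : ℝ) • unitI) *
      (((A ⟨q.re, -‖q.im‖⟩ : ℍ[ℝ]) + (B ⟨q.re, -‖q.im‖⟩ : ℍ[ℝ]) * unitJ) -
        ((A (toC q) : ℍ[ℝ]) + (B (toC q) : ℍ[ℝ]) * unitJ)) := by
    rw [stemSplit, hc]
    apply Quaternion.ext <;> simp <;> ring
  rw [induced, evJ, h1, h2, ext, dirOf, mul_assoc]
  rfl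

/-- The splitting formula for the regular product is the product of complexified quaternions in
other coordinates, so the regular product inherits associativity and a multiplicative norm form. -/
theorem stemSplit_mul (f g : ℍ[ℝ] → ℍ[ℝ]) (z : ℂ) :
    stemSplit (fun z => splitF f z * splitF g z
        - splitG f z * (starRingEnd ℂ) (splitG g ((starRingEnd ℂ) z)))
      (fun z => splitF f z * splitG g z
        + splitG f z * (starRingEnd ℂ) (splitF g ((starRingEnd ℂ) z))) z =
      stemOf f z * stemOf g z := by
  have hI : Complex.I ^ 2 = -1 := Complex.I_sq
  simp only [stemOf, stemSplit]
  apply Quaternion.ext <;>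
    simp only [re_qmk, imI_qmk, imJ_qmk, imK_qmk, Quaternion.re_mul, Quaternion.imI_mul,
      Quaternion.imJ_mul, Quaternion.imK_mul, map_sub, map_add, map_mul, Complex.conj_conj] <;>
    ring_nf <;> (try simp only [hI]) <;> (try ring)

theorem starProd_eq_induced (f g : ℍ[ℝ] → ℍ[ℝ]) :
    starProd f g = induced fun z => stemOf f z * stemOf g z := by
  have := ext_eq_induced (fun z => splitF f z * splitF g z
        - splitG f z * (starRingEnd ℂ) (splitG g ((starRingEnd ℂ) z)))
      (fun z => splitF f z * splitG g z
        + splitG f z * (starRingEnd ℂ) (splitF g ((starRingEnd ℂ) z)))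
  rw [starProd, this]
  congr 1
  funext z
  exact stemSplit_mul f g z

theorem regConj_eq_induced (f : ℍ[ℝ] → ℍ[ℝ]) :
    regConj f = induced fun z => star (stemOf f z) := by
  have := ext_eq_induced (fun z => (starRingEnd ℂ) (splitF f ((starRingEnd ℂ) z)))
      (fun z => -splitG f z)
  have h2 : regConj f = ext fun z => (((starRingEnd ℂ) (splitF f ((starRingEnd ℂ) z)) : ℂ) : ℍ[ℝ]) +
      ((-splitG f z : ℂ) : ℍ[ℝ]) * unitJ := by
    rw [regConj]
    congr 1
    funext z
    apply Quaternion.ext <;> simp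
  rw [h2, this]
  congr 1
  funext z
  apply Quaternion.ext <;> simp [stemOf, stemSplit] <;> ring

/-- For y < 0 the direction is -J and the symmetry of the stem compensates. For y = 0 the symmetry
makes the imaginary part of the stem vanish, so the direction, which is 0 there, does not matter. -/
theorem induced_slice {s : ℂ → ℍ[ℂ]} (hs : IsStem s) {J : ℍ[ℝ]} (hJ : J ∈ imUnits) (x y : ℝ) :
    induced s ((x : ℍ[ℝ]) + (y : ℍ[ℝ]) * J) = evJ J (s ⟨x, y⟩) := by
  rcases lt_trichotomy y 0 with hy | hy | hy
  · have e : (x : ℍ[ℝ]) + (y : ℍ[ℝ]) * J = (x : ℍ[ℝ]) + ((-y : ℝ) : ℍ[ℝ]) * (-J) := by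
      simp
    rw [e, induced, dirOf_slice x (-y) (neg_mem_imUnits hJ) (by linarith),
      toC_slice x (-y) (neg_mem_imUnits hJ) (by linarith), ← evJ_conjC, ← hs]
    congr 2
    apply Complex.ext <;> simp
  · subst hy
    rw [induced, toC_slice x 0 hJ le_rfl, dirOf, im_slice x 0 hJ]
    have h := hs ⟨x, 0⟩
    have e : starRingEnd ℂ (⟨x, 0⟩ : ℂ) = ⟨x, 0⟩ := by apply Complex.ext <;> simp
    rw [e] at h
    have him : imP (s ⟨x, 0⟩) = 0 := by
      have h2 := congrArg imP h
      rw [Quaternion.ext_iff] at h2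
      simp only [re_imP, imI_imP, imJ_imP, imK_imP, re_conjC, imI_conjC, imJ_conjC, imK_conjC,
        Complex.conj_im] at h2
      obtain ⟨a, b, c, d⟩ := h2
      apply Quaternion.ext
      · simp; linarith
      · simp; linarith
      · simp; linarith
      · simp; linarith
    rw [evJ, evJ, him]; simp
  · rw [induced, dirOf_slice x y hJ hy, toC_slice x y hJ hy.le]

/-- `dirOf q` is 0 at real q; this supplies a genuine imaginary unit at every point. -/
theorem induced_eq_evJ {s : ℂ → ℍ[ℂ]} (hs : IsStem s) (q : ℍ[ℝ]) :
    ∃ J ∈ imUnits, q = (q.re : ℍ[ℝ]) + (‖q.im‖ : ℍ[ℝ]) * J ∧ induced s q = evJ J (s (toC q)) := by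
  have h : q ∈ sphereOf q.re ‖q.im‖ := (mem_sphereOf_iff (norm_nonneg _)).2 rfl
  obtain ⟨J, hJ, hq⟩ := h
  refine ⟨J, hJ, hq, ?_⟩
  conv_lhs => rw [hq]
  rw [induced_slice hs hJ]; rfl

theorem coeComplex_eq (z : ℂ) : (z : ℍ[ℝ]) = (z.re : ℍ[ℝ]) + (z.im : ℍ[ℝ]) * unitI := by
  apply Quaternion.ext <;> simp

theorem splitF_induced {s : ℂ → ℍ[ℂ]} (hs : IsStem s) (z : ℂ) :
    splitF (induced s) z = (s z).re + Complex.I * (s z).imI := by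
  rw [splitF, coeComplex_eq, induced_slice hs unitI_mem]
  apply Complex.ext
  · simp [evJ]
  · simp [evJ]; ring

theorem splitG_induced {s : ℂ → ℍ[ℂ]} (hs : IsStem s) (z : ℂ) :
    splitG (induced s) z = (s z).imJ + Complex.I * (s z).imK := by
  rw [splitG, coeComplex_eq, induced_slice hs unitI_mem]
  apply Complex.ext
  · simp [evJ]
  · simp [evJ]; ring

theorem stemSplit_components {s : ℂ → ℍ[ℂ]} (hs : IsStem s) :
    stemSplit (fun z => (s z).re + Complex.I * (s z).imI)
      (fun z => (s z).imJ + Complex.I * (s z).imK) = s := by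
  funext z
  have hI : Complex.I ^ 2 = -1 := Complex.I_sq
  rw [stemSplit, hs z]
  apply Quaternion.ext <;> simp <;> ring_nf <;> simp [hI]

theorem stemOf_induced {s : ℂ → ℍ[ℂ]} (hs : IsStem s) : stemOf (induced s) = s := by
  rw [stemOf]
  conv_rhs => rw [← stemSplit_components hs]
  congr 1
  · funext z; exact splitF_induced hs z
  · funext z; exact splitG_induced hs z

theorem IsStem.mul {s t : ℂ → ℍ[ℂ]} (hs : IsStem s) (ht : IsStem t) :
    IsStem fun z => s z * t z := fun z => by
  simp only []; rw [hs z, ht z, conjC_mul]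

theorem IsStem.star {s : ℂ → ℍ[ℂ]} (hs : IsStem s) : IsStem fun z => star (s z) := fun z => by
  simp only []; rw [hs z, conjC_star]

theorem IsStem.smul {c : ℂ → ℂ} {s : ℂ → ℍ[ℂ]}
    (hc : ∀ z, c (starRingEnd ℂ z) = starRingEnd ℂ (c z)) (hs : IsStem s) :
    IsStem fun z => c z • s z := fun z => by
  simp only []; rw [hs z, hc z, conjC_smul]

theorem isStem_one : IsStem fun _ => 1 := fun _ => by simp

theorem stemOf_starProd (f g : ℍ[ℝ] → ℍ[ℝ]) :
    stemOf (starProd f g) = fun z => stemOf f z * stemOf g z := by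
  rw [starProd_eq_induced, stemOf_induced ((isStem_stemOf f).mul (isStem_stemOf g))]

/-- Slice functions with scalar stem act by left multiplication. -/
theorem induced_smul {c : ℂ → ℂ} {s : ℂ → ℍ[ℂ]}
    (hc : ∀ z, c (starRingEnd ℂ z) = starRingEnd ℂ (c z)) (hs : IsStem s) (q : ℍ[ℝ]) :
    induced (fun z => c z • s z) q = induced (fun z => c z • (1 : ℍ[ℂ])) q * induced s q := by
  have hJ := (mem_sphereOf_iff (norm_nonneg q.im)).2 (rfl : toC q = ⟨q.re, ‖q.im‖⟩)
  obtain ⟨J, hJ, hq⟩ := hJ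
  rw [hq, induced_slice (hs.smul hc) hJ, induced_slice (isStem_one.smul hc) hJ,
    induced_slice hs hJ]
  have e : c ⟨q.re, ‖q.im‖⟩ • s ⟨q.re, ‖q.im‖⟩ =
    (c ⟨q.re, ‖q.im‖⟩ • (1 : ℍ[ℂ])) * s ⟨q.re, ‖q.im‖⟩ := by rw [smul_mul_assoc, one_mul]
  rw [e, evJ_mul hJ _ _ rfl]
  generalize c ⟨q.re, ‖q.im‖⟩ = c
  have h1 : reP (c • (1 : ℍ[ℂ])) = (c.re : ℍ[ℝ]) := by apply Quaternion.ext <;> simp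
  have h2 : imP (c • (1 : ℍ[ℂ])) = (c.im : ℍ[ℝ]) := by apply Quaternion.ext <;> simp
  -- A scalar stem takes values in the slice ℝ + ℝJ, which is commutative.
  have hcomm : J * evJ J (c • (1 : ℍ[ℂ])) = evJ J (c • (1 : ℍ[ℂ])) * J := by
    rw [evJ, h1, h2, mul_add, add_mul, Quaternion.coe_commutes c.re J, mul_assoc J _ J,
      Quaternion.coe_commutes c.im J]
  rw [hcomm]
  simp only [evJ]
  noncomm_ring

theorem induced_scalar_mul {c d : ℂ → ℂ} (hc : ∀ z, c (starRingEnd ℂ z) = starRingEnd ℂ (c z))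
    (hd : ∀ z, d (starRingEnd ℂ z) = starRingEnd ℂ (d z)) (q : ℍ[ℝ]) :
    induced (fun z => (c z * d z) • (1 : ℍ[ℂ])) q =
      induced (fun z => c z • (1 : ℍ[ℂ])) q * induced (fun z => d z • (1 : ℍ[ℂ])) q := by
  rw [← induced_smul hc (isStem_one.smul hd)]
  simp [induced, mul_smul]

theorem induced_one (q : ℍ[ℝ]) : induced (fun _ => (1 : ℍ[ℂ])) q = 1 := by
  rw [induced, evJ]
  apply Quaternion.ext <;> simp

theorem induced_scalar_pow {c : ℂ → ℂ} (hc : ∀ z, c (starRingEnd ℂ z) = starRingEnd ℂ (c z))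
    (q : ℍ[ℝ]) (n : ℕ) : induced (fun z => (c z ^ n) • (1 : ℍ[ℂ])) q =
      induced (fun z => c z • (1 : ℍ[ℂ])) q ^ n := by
  induction n with
  | zero => simpa using induced_one q
  | succ n ih =>
    simp only [pow_succ]
    rw [induced_scalar_mul (c := fun z => c z ^ n) (d := c) (fun z => by simp [hc]) hc, ih]

/-- No condition on zeros of c is needed: there both inverses are 0 by convention. -/
theorem induced_scalar_inv {c : ℂ → ℂ} (hc : ∀ z, c (starRingEnd ℂ z) = starRingEnd ℂ (c z))
    (q : ℍ[ℝ]) : induced (fun z => (c z)⁻¹ • (1 : ℍ[ℂ])) q =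
      (induced (fun z => c z • (1 : ℍ[ℂ])) q)⁻¹ := by
  by_cases h : c (toC q) = 0
  · have h1 : induced (fun z => c z • (1 : ℍ[ℂ])) q = 0 := by
      rw [induced, h, evJ]; apply Quaternion.ext <;> simp
    have h2 : induced (fun z => (c z)⁻¹ • (1 : ℍ[ℂ])) q = 0 := by
      rw [induced, h, evJ]; apply Quaternion.ext <;> simp
    rw [h1, h2, inv_zero]
  · have := induced_scalar_mul (c := fun z => (c z)⁻¹) (d := c) (fun z => by simp [hc]) hc q
    apply eq_inv_of_mul_eq_one_left
    rw [← this]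
    rw [induced]
    simp only [inv_mul_cancel₀ h, one_smul]
    exact induced_one q

theorem induced_id (q : ℍ[ℝ]) : induced (fun z => z • (1 : ℍ[ℂ])) q = q := by
  have h1 : reP (toC q • (1 : ℍ[ℂ])) = (q.re : ℍ[ℝ]) := by
    apply Quaternion.ext <;> simp [toC]
  have h2 : imP (toC q • (1 : ℍ[ℂ])) = (‖q.im‖ : ℍ[ℝ]) := by
    apply Quaternion.ext <;> simp [toC]
  rw [induced, evJ, h1, h2, ← Quaternion.coe_commutes]
  exact (eq_re_add_dirOf q).symm

theorem induced_add (s t : ℂ → ℍ[ℂ]) (q : ℍ[ℝ]) :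
    induced (fun z => s z + t z) q = induced s q + induced t q := by
  have h1 : reP (s (toC q) + t (toC q)) = reP (s (toC q)) + reP (t (toC q)) := by
    apply Quaternion.ext <;> simp
  have h2 : imP (s (toC q) + t (toC q)) = imP (s (toC q)) + imP (t (toC q)) := by
    apply Quaternion.ext <;> simp
  simp only [induced, evJ, h1, h2]; noncomm_ring

theorem induced_sub (s t : ℂ → ℍ[ℂ]) (q : ℍ[ℝ]) :
    induced (fun z => s z - t z) q = induced s q - induced t q := by
  have := induced_add (fun z => s z - t z) t q
  simp only [sub_add_cancel] at this
  exact eq_sub_of_add_eq this.symm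

theorem induced_incl (a q : ℍ[ℝ]) : induced (fun _ => incl a) q = a := by
  rw [induced, evJ]
  have h1 : reP (incl a) = a := by apply Quaternion.ext <;> simp
  have h2 : imP (incl a) = 0 := by apply Quaternion.ext <;> simp
  rw [h1, h2, mul_zero, add_zero]

theorem isStem_incl (a : ℍ[ℝ]) : IsStem fun _ => incl a := fun _ => (conjC_incl a).symm

theorem isStem_scalar {c : ℂ → ℂ} (hc : ∀ z, c (starRingEnd ℂ z) = starRingEnd ℂ (c z)) :
    IsStem fun z => c z • (1 : ℍ[ℂ]) := isStem_one.smul hc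

theorem IsStem.sub {s t : ℂ → ℍ[ℂ]} (hs : IsStem s) (ht : IsStem t) :
    IsStem fun z => s z - t z := fun z => by
  simp only []; rw [hs z, ht z, conjC_sub]

/-- Right multiplication by a constant. -/
theorem induced_mul_incl (s : ℂ → ℍ[ℂ]) (a q : ℍ[ℝ]) :
    induced (fun z => s z * incl a) q = induced s q * a := by
  have h1 : reP (s (toC q) * incl a) = reP (s (toC q)) * a := by
    apply Quaternion.ext <;> simp
  have h2 : imP (s (toC q) * incl a) = imP (s (toC q)) * a := by
    apply Quaternion.ext <;> simp
  simp only [induced, evJ, h1, h2]; noncomm_ring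

/-- The symmetrization has a scalar stem, and for such stems pointwise inversion and left
multiplication of slice functions agree with the operations on stems. -/
theorem regRecip_eq_induced (f : ℍ[ℝ] → ℍ[ℝ]) :
    regRecip f = induced fun z => (Quaternion.normSq (stemOf f z))⁻¹ • star (stemOf f z) := by
  have hc : ∀ z, Quaternion.normSq (stemOf f (starRingEnd ℂ z)) =
      starRingEnd ℂ (Quaternion.normSq (stemOf f z)) := fun z => by
    rw [isStem_stemOf f z, normSq_conjC]
  have hsym : symmetrization f =
      induced fun z => Quaternion.normSq (stemOf f z) • (1 : ℍ[ℂ]) := by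
    rw [symmetrization, starProd_eq_induced, regConj_eq_induced,
      stemOf_induced (isStem_stemOf f).star]
    congr 1
    funext z
    rw [Quaternion.self_mul_star, ← Quaternion.coe_mul_eq_smul, mul_one]
  funext q
  rw [regRecip, hsym, regConj_eq_induced, ← induced_scalar_inv hc,
    ← induced_smul (c := fun z => (Quaternion.normSq (stemOf f z))⁻¹)
      (fun z => by rw [hc]; simp) (isStem_stemOf f).star]

theorem norm_evJ_le {J : ℍ[ℝ]} (hJ : ‖J‖ ≤ 1) (s : ℍ[ℂ]) : ‖evJ J s‖ ≤ 4 * ‖s‖ := by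
  have aux : ∀ q : ℍ[ℝ], ‖q‖ ≤ |q.re| + |q.imI| + |q.imJ| + |q.imK| := by
    intro q
    apply abs_le_of_sq_le_sq' _ (by positivity) |>.2
    rw [pow_two, ← Quaternion.normSq_eq_norm_mul_self, Quaternion.normSq_def', ← sq_abs q.re,
      ← sq_abs q.imI, ← sq_abs q.imJ, ← sq_abs q.imK]
    have := abs_nonneg q.re
    have := abs_nonneg q.imI
    have := abs_nonneg q.imJ
    have := abs_nonneg q.imK
    have h : 0 ≤ |q.re| * (|q.imI| + |q.imJ| + |q.imK|) + |q.imI| * (|q.imJ| + |q.imK|) +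
      |q.imJ| * |q.imK| := by positivity
    nlinarith
  have h1 : ‖reP s‖ ≤ ‖s‖ := by
    refine (aux _).trans ?_
    rw [norm_def]
    simp only [re_reP, imI_reP, imJ_reP, imK_reP]
    linarith [Complex.abs_re_le_norm s.re, Complex.abs_re_le_norm s.imI,
      Complex.abs_re_le_norm s.imJ, Complex.abs_re_le_norm s.imK]
  have h2 : ‖imP s‖ ≤ ‖s‖ := by
    refine (aux _).trans ?_
    rw [norm_def]
    simp only [re_imP, imI_imP, imJ_imP, imK_imP]
    linarith [Complex.abs_im_le_norm s.re, Complex.abs_im_le_norm s.imI,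
      Complex.abs_im_le_norm s.imJ, Complex.abs_im_le_norm s.imK]
  calc ‖evJ J s‖ ≤ ‖reP s‖ + ‖J‖ * ‖imP s‖ := by
        rw [evJ, ← norm_mul]; exact norm_add_le _ _
    _ ≤ ‖s‖ + 1 * ‖s‖ := by gcongr
    _ ≤ 4 * ‖s‖ := by linarith [norm_nonneg s]

theorem norm_dirOf_le (q : ℍ[ℝ]) : ‖dirOf q‖ ≤ 1 := by
  by_cases h : q.im = 0
  · simp [dirOf, h]
  · exact (norm_imUnits (dirOf_mem h)).le

/-! ### Slice regular functions and holomorphic stem functions -/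

/-- Stem functions that are holomorphic on the unit disc. -/
def HolStem (s : ℂ → ℍ[ℂ]) : Prop :=
  IsStem s ∧ DifferentiableOn ℂ s (Metric.ball 0 1)

/-- The embedding of `ℂ` in the quaternions with `i ↦ I`. -/
def sliceL (I : ℍ[ℝ]) : ℂ →L[ℝ] ℍ[ℝ] :=
  Complex.reCLM.smulRight (1 : ℍ[ℝ]) + Complex.imCLM.smulRight I

theorem sliceL_apply (I : ℍ[ℝ]) (w : ℂ) : sliceL I w = w.re • (1 : ℍ[ℝ]) + w.im • I := rfl

theorem sliceL_I_mul {I : ℍ[ℝ]} (hI : I ∈ imUnits) (w : ℂ) :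
    sliceL I (Complex.I * w) = I * sliceL I w := by
  rw [sliceL_apply, sliceL_apply, mul_add, mul_smul_comm, mul_smul_comm, imUnits_mul_self hI]
  simp [add_comm]

/-- The four holomorphic components enter through the slice of I, and the constants stand on the
right, out of reach of the left operator ∂x + I∂y. -/
theorem evJ_eq_sliceL (I : ℍ[ℝ]) (s : ℍ[ℂ]) :
    evJ I s = sliceL I s.re * 1 + sliceL I s.imI * qmk 0 1 0 0 + sliceL I s.imJ * qmk 0 0 1 0 +
      sliceL I s.imK * qmk 0 0 0 1 := by
  simp only [sliceL_apply, evJ]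
  apply Quaternion.ext <;> simp <;> ring

/-- The condition of slice regularity on one slice, for a function on the unit disc of the plane. -/
def RegularOnSlice (I : ℍ[ℝ]) (φ : ℝ × ℝ → ℍ[ℝ]) : Prop :=
  ContDiffOn ℝ 1 φ {p : ℝ × ℝ | p.1 ^ 2 + p.2 ^ 2 < 1} ∧
    ∀ z : ℝ × ℝ, z.1 ^ 2 + z.2 ^ 2 < 1 →
      (1 / 2 : ℝ) • (fderiv ℝ φ z (1, 0) + I * fderiv ℝ φ z (0, 1)) = 0

theorem isOpen_disc : IsOpen {p : ℝ × ℝ | p.1 ^ 2 + p.2 ^ 2 < 1} :=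
  isOpen_lt (by fun_prop) (by fun_prop)

theorem RegularOnSlice.differentiableAt {I : ℍ[ℝ]} {φ : ℝ × ℝ → ℍ[ℝ]} (h : RegularOnSlice I φ)
    {z : ℝ × ℝ} (hz : z.1 ^ 2 + z.2 ^ 2 < 1) : DifferentiableAt ℝ φ z :=
  (h.1.differentiableOn one_ne_zero).differentiableAt (isOpen_disc.mem_nhds hz)

theorem RegularOnSlice.add {I : ℍ[ℝ]} {φ ψ : ℝ × ℝ → ℍ[ℝ]} (h : RegularOnSlice I φ)
    (h' : RegularOnSlice I ψ) : RegularOnSlice I fun p => φ p + ψ p := by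
  refine ⟨h.1.add h'.1, fun z hz => ?_⟩
  rw [fderiv_fun_add (h.differentiableAt hz) (h'.differentiableAt hz)]
  have e1 := h.2 z hz
  have e2 := h'.2 z hz
  calc _ = (1 / 2 : ℝ) • (fderiv ℝ φ z (1, 0) + I * fderiv ℝ φ z (0, 1)) +
        (1 / 2 : ℝ) • (fderiv ℝ ψ z (1, 0) + I * fderiv ℝ ψ z (0, 1)) := by
        rw [← smul_add]
        simp only [add_apply]
        noncomm_ring
    _ = 0 := by rw [e1, e2, add_zero]

theorem RegularOnSlice.sub {I : ℍ[ℝ]} {φ ψ : ℝ × ℝ → ℍ[ℝ]} (h : RegularOnSlice I φ)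
    (h' : RegularOnSlice I ψ) : RegularOnSlice I fun p => φ p - ψ p := by
  refine ⟨h.1.sub h'.1, fun z hz => ?_⟩
  rw [fderiv_fun_sub (h.differentiableAt hz) (h'.differentiableAt hz)]
  have e1 := h.2 z hz
  have e2 := h'.2 z hz
  calc _ = (1 / 2 : ℝ) • (fderiv ℝ φ z (1, 0) + I * fderiv ℝ φ z (0, 1)) -
        (1 / 2 : ℝ) • (fderiv ℝ ψ z (1, 0) + I * fderiv ℝ ψ z (0, 1)) := by
        rw [← smul_sub]
        simp only [sub_apply]
        noncomm_ring
    _ = 0 := by rw [e1, e2, sub_zero]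

theorem toC_mem_ball {p : ℝ × ℝ} (hp : p.1 ^ 2 + p.2 ^ 2 < 1) :
    (⟨p.1, p.2⟩ : ℂ) ∈ Metric.ball (0 : ℂ) 1 := by
  rw [mem_ball_zero_iff, ← sq_lt_one_iff₀ (norm_nonneg _), ← Complex.normSq_eq_norm_sq,
    Complex.normSq_mk]
  nlinarith

/-- With d the image of g′ in the slice, the partial derivatives are de and Ide, and d + I·Id = 0.
-/
theorem regularOnSlice_sliceL {I : ℍ[ℝ]} (hI : I ∈ imUnits) {g : ℂ → ℂ}
    (hg : DifferentiableOn ℂ g (Metric.ball 0 1)) (e : ℍ[ℝ]) :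
    RegularOnSlice I fun p => sliceL I (g ⟨p.1, p.2⟩) * e := by
  have hL : (fun p : ℝ × ℝ => sliceL I (g ⟨p.1, p.2⟩) * e) =
      fun p => ((ContinuousLinearMap.mul ℝ ℍ[ℝ]).flip e).comp (sliceL I)
        (g (Complex.equivRealProdCLM.symm p)) := by
    funext p; rfl
  set T := ((ContinuousLinearMap.mul ℝ ℍ[ℝ]).flip e).comp (sliceL I) with hT
  have hTapp : ∀ w, T w = sliceL I w * e := fun w => rfl
  rw [hL]
  constructor
  · have h1 : ContDiffOn ℝ 1 g (Metric.ball 0 1) :=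
      (hg.contDiffOn Metric.isOpen_ball).restrict_scalars ℝ
    have h2 : ContDiffOn ℝ 1 (fun p : ℝ × ℝ => g (Complex.equivRealProdCLM.symm p))
        {p : ℝ × ℝ | p.1 ^ 2 + p.2 ^ 2 < 1} :=
      h1.comp Complex.equivRealProdCLM.symm.contDiff.contDiffOn fun p hp => toC_mem_ball hp
    exact T.contDiff.comp_contDiffOn h2
  · intro z hz
    have hd : HasDerivAt g (deriv g (Complex.equivRealProdCLM.symm z))
        (Complex.equivRealProdCLM.symm z) :=
      (hg.differentiableAt (Metric.isOpen_ball.mem_nhds (toC_mem_ball hz))).hasDerivAt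
    have h3 := T.hasFDerivAt.comp z ((hd.hasFDerivAt.restrictScalars ℝ).comp z
      Complex.equivRealProdCLM.symm.hasFDerivAt)
    have h4 := h3.fderiv
    have h5 : fderiv ℝ (fun p : ℝ × ℝ => T (g (Complex.equivRealProdCLM.symm p))) z = _ := h4
    rw [h5]
    generalize deriv g (Complex.equivRealProdCLM.symm z) = d
    have e1 : Complex.equivRealProdCLM.symm ((1, 0) : ℝ × ℝ) = 1 := by
      apply Complex.ext <;> rfl
    have e2 : Complex.equivRealProdCLM.symm ((0, 1) : ℝ × ℝ) = Complex.I := by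
      apply Complex.ext <;> rfl
    simp only [ContinuousLinearMap.comp_apply, ContinuousLinearEquiv.coe_coe, e1, e2,
      ContinuousLinearMap.coe_restrictScalars', ContinuousLinearMap.toSpanSingleton_apply,
      smul_eq_mul, one_mul, hTapp]
    rw [sliceL_I_mul hI, mul_assoc, ← mul_assoc I I, imUnits_mul_self hI]
    simp

theorem HolStem.regularOnSlice {s : ℂ → ℍ[ℂ]} (hs : HolStem s) {I : ℍ[ℝ]} (hI : I ∈ imUnits) :
    RegularOnSlice I fun p => induced s ((p.1 : ℍ[ℝ]) + (p.2 : ℍ[ℝ]) * I) := by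
  have e : (fun p : ℝ × ℝ => induced s ((p.1 : ℍ[ℝ]) + (p.2 : ℍ[ℝ]) * I)) = fun p =>
      sliceL I (s ⟨p.1, p.2⟩).re * 1 + sliceL I (s ⟨p.1, p.2⟩).imI * qmk 0 1 0 0 +
      sliceL I (s ⟨p.1, p.2⟩).imJ * qmk 0 0 1 0 + sliceL I (s ⟨p.1, p.2⟩).imK * qmk 0 0 0 1 := by
    funext p
    rw [induced_slice hs.1 hI, evJ_eq_sliceL]
  obtain ⟨h0, h1, h2, h3⟩ := differentiableOn_iff_components.1 hs.2
  rw [e]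
  exact (((regularOnSlice_sliceL hI h0 _).add (regularOnSlice_sliceL hI h1 _)).add
    (regularOnSlice_sliceL hI h2 _)).add (regularOnSlice_sliceL hI h3 _)

theorem HolStem.sliceRegular {s : ℂ → ℍ[ℂ]} (hs : HolStem s) : SliceRegular (induced s) :=
  fun _ hI => hs.regularOnSlice hI

/-- The first complex component of a quaternion. -/
def splitL₁ : ℍ[ℝ] →ₗ[ℝ] ℂ where
  toFun q := ⟨q.re, q.imI⟩
  map_add' p q := by apply Complex.ext <;> simp
  map_smul' c q := by apply Complex.ext <;> simp

/-- The second complex component of a quaternion. -/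
def splitL₂ : ℍ[ℝ] →ₗ[ℝ] ℂ where
  toFun q := ⟨q.imJ, q.imK⟩
  map_add' p q := by apply Complex.ext <;> simp
  map_smul' c q := by apply Complex.ext <;> simp

theorem splitL₁_unitI_mul (q : ℍ[ℝ]) : splitL₁ (unitI * q) = Complex.I * splitL₁ q := by
  apply Complex.ext <;> simp [splitL₁]

theorem splitL₂_unitI_mul (q : ℍ[ℝ]) : splitL₂ (unitI * q) = Complex.I * splitL₂ q := by
  apply Complex.ext <;> simp [splitL₂]

/-- Left multiplication by u⁻¹ turns the Cauchy–Riemann equation for I into the one for i, and T is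
complex linear for left multiplication by i. -/
theorem differentiableOn_of_regularOnSlice {I u : ℍ[ℝ]} (hu : u ≠ 0) (huI : u * unitI = I * u)
    {φ : ℝ × ℝ → ℍ[ℝ]} (h : RegularOnSlice I φ) (T : ℍ[ℝ] →ₗ[ℝ] ℂ)
    (hT : ∀ q, T (unitI * q) = Complex.I * T q) :
    DifferentiableOn ℂ (fun z : ℂ => T (u⁻¹ * φ (z.re, z.im))) (Metric.ball 0 1) := by
  intro z hz
  have hz' : (Complex.equivRealProdCLM z).1 ^ 2 + (Complex.equivRealProdCLM z).2 ^ 2 < 1 := by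
    rw [mem_ball_zero_iff, ← sq_lt_one_iff₀ (norm_nonneg _), ← Complex.normSq_eq_norm_sq,
      Complex.normSq_apply] at hz
    simp only [Complex.equivRealProdCLM_apply]
    nlinarith
  apply DifferentiableAt.differentiableWithinAt
  set S : ℍ[ℝ] →L[ℝ] ℂ := (LinearMap.toContinuousLinearMap T).comp (ContinuousLinearMap.mul ℝ ℍ[ℝ] u⁻¹)
    with hS
  have hSapp : ∀ q, S q = T (u⁻¹ * q) := fun q => rfl
  have hd := (h.differentiableAt hz').hasFDerivAt
  have h3 : HasFDerivAt (fun z : ℂ => T (u⁻¹ * φ (z.re, z.im))) _ z :=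
    S.hasFDerivAt.comp z (hd.comp z Complex.equivRealProdCLM.hasFDerivAt)
  rw [differentiableAt_complex_iff_differentiableAt_real]
  refine ⟨h3.differentiableAt, ?_⟩
  rw [h3.fderiv]
  have e1 : Complex.equivRealProdCLM (1 : ℂ) = (1, 0) := rfl
  have e2 : Complex.equivRealProdCLM Complex.I = (0, 1) := by
    simp [Complex.equivRealProdCLM_apply]
  simp only [ContinuousLinearMap.comp_apply, ContinuousLinearEquiv.coe_coe, e1, e2, hSapp]
  have e3 := h.2 _ hz'
  have e4 := (smul_eq_zero.1 e3).resolve_left (by norm_num)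
  generalize fderiv ℝ φ (Complex.equivRealProdCLM z) (1, 0) = a at e4 ⊢
  generalize fderiv ℝ φ (Complex.equivRealProdCLM z) (0, 1) = b at e4 ⊢
  have ha : a = -(I * b) := eq_neg_of_add_eq_zero_left e4
  have e5 : u⁻¹ * (I * b) = unitI * (u⁻¹ * b) := by
    have : I = u * unitI * u⁻¹ := by rw [huI, mul_assoc, mul_inv_cancel₀ hu, mul_one]
    rw [this]
    have : u⁻¹ * (u * unitI * u⁻¹ * b) = (u⁻¹ * u) * unitI * u⁻¹ * b := by noncomm_ring
    rw [this, inv_mul_cancel₀ hu, one_mul, mul_assoc]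
  rw [ha, mul_neg, e5, map_neg, hT, smul_eq_mul]
  linear_combination (T (u⁻¹ * b)) * Complex.I_mul_I

theorem splitL_eq_zero {q : ℍ[ℝ]} (h1 : splitL₁ q = 0) (h2 : splitL₂ q = 0) : q = 0 := by
  have a := congrArg Complex.re h1
  have b := congrArg Complex.im h1
  have c := congrArg Complex.re h2
  have d := congrArg Complex.im h2
  apply Quaternion.ext
  exacts [a, b, c, d]

theorem eq_zero_on_ball_of_real {g : ℂ → ℂ} (hg : DifferentiableOn ℂ g (Metric.ball 0 1))
    (h0 : ∀ x : ℝ, |x| < 1 → g x = 0) : ∀ z ∈ Metric.ball (0 : ℂ) 1, g z = 0 := by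
  have ha : AnalyticOnNhd ℂ g (Metric.ball 0 1) := hg.analyticOnNhd Metric.isOpen_ball
  have hfreq : ∃ᶠ z in 𝓝[≠] (0 : ℂ), g z = 0 := by
    have ht : Tendsto (fun n : ℕ => (((1 / 2 : ℝ) ^ (n + 1) : ℝ) : ℂ)) atTop (𝓝[≠] 0) := by
      rw [tendsto_nhdsWithin_iff]
      constructor
      · have : Tendsto (fun n : ℕ => (1 / 2 : ℝ) ^ (n + 1)) atTop (𝓝 0) :=
          (tendsto_pow_atTop_nhds_zero_of_lt_one (by norm_num) (by norm_num)).comp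
            (tendsto_add_atTop_nat 1)
        exact (Complex.continuous_ofReal.tendsto 0).comp this
      · refine Eventually.of_forall fun n => ?_
        have : ((1 / 2 : ℝ) ^ (n + 1)) ≠ 0 := by positivity
        simp only [Set.mem_compl_iff, Set.mem_singleton_iff]
        exact_mod_cast this
    refine ht.frequently (Frequently.of_forall fun n => h0 _ ?_)
    rw [abs_of_pos (by positivity)]
    exact pow_lt_one₀ (by norm_num) (by norm_num) (by simp)
  intro z hz
  exact ha.eqOn_zero_of_preconnected_of_frequently_eq_zero
    (convex_ball (0 : ℂ) 1).isPreconnected (by simp) hfreq hz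

theorem regularOnSlice_eq_zero {I : ℍ[ℝ]} (hI : I ∈ imUnits) {φ : ℝ × ℝ → ℍ[ℝ]}
    (h : RegularOnSlice I φ) (h0 : ∀ x : ℝ, |x| < 1 → φ (x, 0) = 0) {p : ℝ × ℝ}
    (hp : p.1 ^ 2 + p.2 ^ 2 < 1) : φ p = 0 := by
  obtain ⟨u, hu, hu'⟩ := exists_conj_unitI hI
  have key : ∀ T : ℍ[ℝ] →ₗ[ℝ] ℂ, (∀ q, T (unitI * q) = Complex.I * T q) →
      T (u⁻¹ * φ p) = 0 := by
    intro T hT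
    have := eq_zero_on_ball_of_real (differentiableOn_of_regularOnSlice hu hu' h T hT)
      (fun x hx => by simp [h0 x hx]) ⟨p.1, p.2⟩ (toC_mem_ball hp)
    exact this
  have := splitL_eq_zero (key _ splitL₁_unitI_mul) (key _ splitL₂_unitI_mul)
  exact (mul_eq_zero.1 this).resolve_left (inv_ne_zero hu)

/-- The splitting components on the slice of i are holomorphic, and so are their reflections z ↦
conj g(z̄), from which the stem is combined. -/
theorem SliceRegular.holStem {f : ℍ[ℝ] → ℍ[ℝ]} (hf : SliceRegular f) : HolStem (stemOf f) := by
  refine ⟨isStem_stemOf f, ?_⟩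
  have key : ∀ T : ℍ[ℝ] →ₗ[ℝ] ℂ, (∀ q, T (unitI * q) = Complex.I * T q) →
      DifferentiableOn ℂ (fun z : ℂ => T (f (z : ℍ[ℝ]))) (Metric.ball 0 1) := by
    intro T hT
    have := differentiableOn_of_regularOnSlice (one_ne_zero) (by rw [one_mul, mul_one])
      (show RegularOnSlice unitI _ from hf unitI unitI_mem) T hT
    refine this.congr fun z _ => ?_
    rw [inv_one, one_mul, coeComplex_eq]
  have conj : ∀ g : ℂ → ℂ, DifferentiableOn ℂ g (Metric.ball 0 1) →
      DifferentiableOn ℂ (fun z => starRingEnd ℂ (g (starRingEnd ℂ z))) (Metric.ball 0 1) := by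
    intro g hg z hz
    have hz' : starRingEnd ℂ z ∈ Metric.ball (0 : ℂ) 1 := by simpa using hz
    have := (hg.differentiableAt (Metric.isOpen_ball.mem_nhds hz')).conj_conj
    rw [Complex.conj_conj] at this
    exact this.differentiableWithinAt
  have hF : DifferentiableOn ℂ (splitF f) (Metric.ball 0 1) := key splitL₁ splitL₁_unitI_mul
  have hG : DifferentiableOn ℂ (splitG f) (Metric.ball 0 1) := key splitL₂ splitL₂_unitI_mul
  have hF' := conj _ hF
  have hG' := conj _ hG
  rw [differentiableOn_iff_components]
  exact ⟨(hF.add hF').const_mul _, (hF'.sub hF).const_mul _, (hG.add hG').const_mul _,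
    (hG'.sub hG).const_mul _⟩

theorem induced_stemOf_coeComplex (f : ℍ[ℝ] → ℍ[ℝ]) (z : ℂ) :
    induced (stemOf f) (z : ℍ[ℝ]) = f z := by
  have hI : Complex.I * Complex.I = -1 := Complex.I_mul_I
  have h1 : splitF (induced (stemOf f)) z = splitF f z := by
    rw [splitF_induced (isStem_stemOf f)]
    simp only [stemOf, stemSplit, re_qmk, imI_qmk]
    linear_combination (1 / 2) * (starRingEnd ℂ (splitF f (starRingEnd ℂ z)) - splitF f z) * hI
  have h2 : splitG (induced (stemOf f)) z = splitG f z := by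
    rw [splitG_induced (isStem_stemOf f)]
    simp only [stemOf, stemSplit, imJ_qmk, imK_qmk]
    linear_combination (1 / 2) * (starRingEnd ℂ (splitG f (starRingEnd ℂ z)) - splitG f z) * hI
  have a := congrArg Complex.re h1
  have b := congrArg Complex.im h1
  have c := congrArg Complex.re h2
  have d := congrArg Complex.im h2
  apply Quaternion.ext
  exacts [a, b, c, d]

theorem exists_slice {q : ℍ[ℝ]} (hq : q ∈ unitBall) :
    ∃ J ∈ imUnits, q = (q.re : ℍ[ℝ]) + (‖q.im‖ : ℍ[ℝ]) * J ∧ q.re ^ 2 + ‖q.im‖ ^ 2 < 1 := by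
  have h : q ∈ sphereOf q.re ‖q.im‖ := (mem_sphereOf_iff (norm_nonneg _)).2 rfl
  obtain ⟨J, hJ, hq'⟩ := h
  refine ⟨J, hJ, hq', ?_⟩
  have h1 := norm_toC q
  have h2 : ‖toC q‖ < 1 := by rw [h1]; exact mem_unitBall.1 hq
  rw [← sq_lt_one_iff₀ (norm_nonneg _), ← Complex.normSq_eq_norm_sq, toC,
    Complex.normSq_mk] at h2
  nlinarith

/-- The representation formula: the stem knows f only on the slice of i, but on every slice both
sides are regular and agree on the real axis, so the identity theorem applies. -/
theorem SliceRegular.eq_induced {f : ℍ[ℝ] → ℍ[ℝ]} (hf : SliceRegular f) {q : ℍ[ℝ]}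
    (hq : q ∈ unitBall) : f q = induced (stemOf f) q := by
  obtain ⟨J, hJ, hq', hlt⟩ := exists_slice hq
  have h := (show RegularOnSlice J _ from hf J hJ).sub (hf.holStem.regularOnSlice hJ)
  have := regularOnSlice_eq_zero hJ h (fun x _ => by
    have := induced_stemOf_coeComplex f (x : ℂ)
    rw [Quaternion.coeComplex_coe] at this
    simp [this]) (p := (q.re, ‖q.im‖)) hlt
  simp only [← hq'] at this
  exact sub_eq_zero.1 this

theorem stemOf_congr {f g : ℍ[ℝ] → ℍ[ℝ]} (h : ∀ q ∈ unitBall, f q = g q) {z : ℂ}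
    (hz : z ∈ Metric.ball (0 : ℂ) 1) : stemOf f z = stemOf g z := by
  have hb : ∀ w : ℂ, w ∈ Metric.ball (0 : ℂ) 1 → ((w : ℍ[ℝ]) : ℍ[ℝ]) ∈ unitBall := by
    intro w hw
    rw [mem_unitBall, ← sq_lt_one_iff₀ (norm_nonneg _), pow_two,
      ← Quaternion.normSq_eq_norm_mul_self, Quaternion.normSq_def']
    rw [mem_ball_zero_iff, ← sq_lt_one_iff₀ (norm_nonneg _), ← Complex.normSq_eq_norm_sq,
      Complex.normSq_apply] at hw
    simp
    nlinarith
  have hz' : starRingEnd ℂ z ∈ Metric.ball (0 : ℂ) 1 := by simpa using hz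
  simp only [stemOf, stemSplit, splitF, splitG, h _ (hb z hz), h _ (hb _ hz')]

theorem toC_mem {q : ℍ[ℝ]} (hq : q ∈ unitBall) : toC q ∈ Metric.ball (0 : ℂ) 1 := by
  rw [mem_ball_zero_iff, norm_toC]; exact mem_unitBall.1 hq

theorem induced_congr {s t : ℂ → ℍ[ℂ]} (h : ∀ z ∈ Metric.ball (0 : ℂ) 1, s z = t z) {q : ℍ[ℝ]}
    (hq : q ∈ unitBall) : induced s q = induced t q := by
  rw [induced, induced, h _ (toC_mem hq)]

/-! ### Algebra and division of holomorphic stem functions -/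

/-- A scalar holomorphic stem function. -/
def HolScalar (c : ℂ → ℂ) : Prop :=
  (∀ z, c (starRingEnd ℂ z) = starRingEnd ℂ (c z)) ∧ DifferentiableOn ℂ c (Metric.ball 0 1)

theorem HolStem.mul {s t : ℂ → ℍ[ℂ]} (hs : HolStem s) (ht : HolStem t) :
    HolStem fun z => s z * t z := ⟨hs.1.mul ht.1, hs.2.mul ht.2⟩

theorem HolStem.sub {s t : ℂ → ℍ[ℂ]} (hs : HolStem s) (ht : HolStem t) :
    HolStem fun z => s z - t z := ⟨hs.1.sub ht.1, hs.2.sub ht.2⟩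

theorem HolStem.smul {c : ℂ → ℂ} {s : ℂ → ℍ[ℂ]} (hc : HolScalar c) (hs : HolStem s) :
    HolStem fun z => c z • s z := ⟨hs.1.smul hc.1, hc.2.smul hs.2⟩

theorem HolStem.star {s : ℂ → ℍ[ℂ]} (hs : HolStem s) : HolStem fun z => star (s z) := by
  refine ⟨hs.1.star, ?_⟩
  obtain ⟨h0, h1, h2, h3⟩ := differentiableOn_iff_components.1 hs.2
  rw [differentiableOn_iff_components]
  simp only [Quaternion.re_star, Quaternion.imI_star, Quaternion.imJ_star, Quaternion.imK_star]
  exact ⟨h0, h1.neg, h2.neg, h3.neg⟩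

theorem holStem_const (a : ℍ[ℝ]) : HolStem fun _ => incl a :=
  ⟨isStem_incl a, differentiableOn_const _⟩

theorem holStem_one : HolStem fun _ => 1 := ⟨isStem_one, differentiableOn_const _⟩

theorem HolStem.normSq {s : ℂ → ℍ[ℂ]} (hs : HolStem s) :
    HolScalar fun z => Quaternion.normSq (s z) := by
  refine ⟨fun z => by simp only [hs.1 z, normSq_conjC], ?_⟩
  obtain ⟨h0, h1, h2, h3⟩ := differentiableOn_iff_components.1 hs.2
  simp only [Quaternion.normSq_def']
  exact (((h0.pow 2).add (h1.pow 2)).add (h2.pow 2)).add (h3.pow 2)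

theorem HolScalar.mul {c d : ℂ → ℂ} (hc : HolScalar c) (hd : HolScalar d) :
    HolScalar fun z => c z * d z := ⟨fun z => by simp [hc.1, hd.1], hc.2.mul hd.2⟩

theorem HolScalar.pow {c : ℂ → ℂ} (hc : HolScalar c) (n : ℕ) :
    HolScalar fun z => c z ^ n := ⟨fun z => by simp [hc.1], hc.2.pow n⟩

theorem HolScalar.analyticAt {c : ℂ → ℂ} (hc : HolScalar c) {z : ℂ}
    (hz : z ∈ Metric.ball (0 : ℂ) 1) : AnalyticAt ℂ c z :=
  hc.2.analyticOnNhd Metric.isOpen_ball z hz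

/-- A holomorphic function with a nonzero value can be cancelled. -/
theorem eq_zero_of_smul_eq_zero {c : ℂ → ℂ} (hc : HolScalar c) {w : ℂ}
    (hw : w ∈ Metric.ball (0 : ℂ) 1) (hcw : c w ≠ 0) {u : ℂ → ℍ[ℂ]}
    (hu : DifferentiableOn ℂ u (Metric.ball 0 1))
    (h : ∀ z ∈ Metric.ball (0 : ℂ) 1, c z • u z = 0) : ∀ z ∈ Metric.ball (0 : ℂ) 1, u z = 0 := by
  rcases AnalyticOnNhd.eq_zero_or_eq_zero_of_smul_eq_zero
    (hc.2.analyticOnNhd Metric.isOpen_ball) (hu.analyticOnNhd Metric.isOpen_ball) h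
    (convex_ball (0 : ℂ) 1).isPreconnected with h' | h'
  · exact absurd (h' w hw) hcw
  · exact h'

theorem eq_of_smul_eq_smul {c : ℂ → ℂ} (hc : HolScalar c) {w : ℂ}
    (hw : w ∈ Metric.ball (0 : ℂ) 1) (hcw : c w ≠ 0) {u v : ℂ → ℍ[ℂ]}
    (hu : HolStem u) (hv : HolStem v)
    (h : ∀ z ∈ Metric.ball (0 : ℂ) 1, c z • u z = c z • v z) :
    ∀ z ∈ Metric.ball (0 : ℂ) 1, u z = v z := by
  intro z hz
  have := eq_zero_of_smul_eq_zero hc hw hcw (u := fun z => u z - v z) (hu.sub hv).2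
    (fun z hz => by rw [smul_sub, h z hz, sub_self]) z hz
  exact sub_eq_zero.1 this

/-- The real polynomial of least degree with zero `z₀`. -/
def realFactor (z₀ z : ℂ) : ℂ :=
  if z₀.im = 0 then z - z₀ else (z - z₀) * (z - starRingEnd ℂ z₀)

theorem holScalar_realFactor (z₀ : ℂ) : HolScalar (realFactor z₀) := by
  constructor
  · intro z
    unfold realFactor
    split_ifs with h
    · simp [Complex.conj_eq_iff_im.2 h]
    · simp [mul_comm]
  · unfold realFactor
    split_ifs with h
    · fun_prop
    · fun_prop

theorem realFactor_ne_zero {z₀ z : ℂ} (h1 : z ≠ z₀) (h2 : z ≠ starRingEnd ℂ z₀) :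
    realFactor z₀ z ≠ 0 := by
  unfold realFactor
  split_ifs
  · exact sub_ne_zero.2 h1
  · exact mul_ne_zero (sub_ne_zero.2 h1) (sub_ne_zero.2 h2)

@[simp] theorem realFactor_self (z₀ : ℂ) : realFactor z₀ z₀ = 0 := by
  simp [realFactor]

theorem exists_realFactor_ne_zero (z₀ : ℂ) :
    ∃ w ∈ Metric.ball (0 : ℂ) 1, realFactor z₀ w ≠ 0 := by
  have h : ({z₀, starRingEnd ℂ z₀} : Set ℂ).Finite := Set.toFinite _
  have h2 : (Metric.ball (0 : ℂ) 1).Infinite :=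
    infinite_of_mem_nhds 0 (Metric.ball_mem_nhds 0 one_pos)
  obtain ⟨w, hw, hw'⟩ := (h2.sdiff h).nonempty
  simp only [Set.mem_insert_iff, Set.mem_singleton_iff, not_or] at hw'
  exact ⟨w, hw, realFactor_ne_zero hw'.1 hw'.2⟩

theorem differentiableOn_conj_conj {t : ℂ → ℍ[ℂ]} (ht : DifferentiableOn ℂ t (Metric.ball 0 1)) :
    DifferentiableOn ℂ (fun z => conjC (t (starRingEnd ℂ z))) (Metric.ball 0 1) := by
  have conj : ∀ g : ℂ → ℂ, DifferentiableOn ℂ g (Metric.ball 0 1) →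
      DifferentiableOn ℂ (fun z => starRingEnd ℂ (g (starRingEnd ℂ z))) (Metric.ball 0 1) := by
    intro g hg z hz
    have hz' : starRingEnd ℂ z ∈ Metric.ball (0 : ℂ) 1 := by simpa using hz
    have := (hg.differentiableAt (Metric.isOpen_ball.mem_nhds hz')).conj_conj
    rw [Complex.conj_conj] at this
    exact this.differentiableWithinAt
  obtain ⟨h0, h1, h2, h3⟩ := differentiableOn_iff_components.1 ht
  rw [differentiableOn_iff_components]
  exact ⟨conj _ h0, conj _ h1, conj _ h2, conj _ h3⟩

/-- A quotient by a scalar stem function can be made symmetric. -/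
theorem exists_holStem_of_smul {c : ℂ → ℂ} (hc : HolScalar c) {u t : ℂ → ℍ[ℂ]} (hu : IsStem u)
    (ht : DifferentiableOn ℂ t (Metric.ball 0 1))
    (h : ∀ z ∈ Metric.ball (0 : ℂ) 1, u z = c z • t z) :
    ∃ t', HolStem t' ∧ ∀ z ∈ Metric.ball (0 : ℂ) 1, u z = c z • t' z := by
  have hhalf : starRingEnd ℂ (1 / 2 : ℂ) = 1 / 2 := by
    have := Complex.conj_ofReal (1 / 2)
    push_cast at this
    exact this
  -- As u and c are symmetric, the reflection of t is also a quotient of u by c; the average of the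
  -- two is symmetric.
  refine ⟨fun z => (1 / 2 : ℂ) • (t z + conjC (t (starRingEnd ℂ z))), ⟨fun z => ?_, ?_⟩, ?_⟩
  · simp only [conjC_smul, hhalf, conjC_add, conjC_conjC, Complex.conj_conj, add_comm]
  · exact (ht.fun_add (differentiableOn_conj_conj ht)).fun_const_smul (1 / 2 : ℂ)
  · intro z hz
    have hz' : starRingEnd ℂ z ∈ Metric.ball (0 : ℂ) 1 := by simpa using hz
    have h2 := h _ hz'
    rw [hu z, hc.1] at h2
    have h3 : u z = c z • conjC (t (starRingEnd ℂ z)) := by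
      rw [← conjC_conjC (u z), h2, conjC_smul, Complex.conj_conj]
    rw [smul_comm, smul_add, ← h z hz, ← h3, ← two_smul ℂ (u z), smul_smul]
    norm_num

/-- A stem function that vanishes at `z₀` is divisible by `realFactor z₀`. -/
theorem HolStem.exists_eq_realFactor_smul {u : ℂ → ℍ[ℂ]} (hu : HolStem u) {z₀ : ℂ}
    (hz₀ : z₀ ∈ Metric.ball (0 : ℂ) 1) (h0 : u z₀ = 0) :
    ∃ t, HolStem t ∧ ∀ z ∈ Metric.ball (0 : ℂ) 1, u z = realFactor z₀ z • t z := by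
  have hd : DifferentiableOn ℂ (dslope u z₀) (Metric.ball 0 1) :=
    (Complex.differentiableOn_dslope (Metric.isOpen_ball.mem_nhds hz₀)).2 hu.2
  by_cases him : z₀.im = 0
  · refine exists_holStem_of_smul (holScalar_realFactor z₀) hu.1 hd fun z _ => ?_
    rw [realFactor, if_pos him, sub_smul_dslope, h0, sub_zero]
  · have hz₁ : starRingEnd ℂ z₀ ∈ Metric.ball (0 : ℂ) 1 := by simpa using hz₀
    have hne : starRingEnd ℂ z₀ ≠ z₀ := fun h => him (Complex.conj_eq_iff_im.1 h)
    -- By symmetry u vanishes at the conjugate of z₀ too, so the difference quotient has a zero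
    -- there and can be divided again.
    have h1 : dslope u z₀ (starRingEnd ℂ z₀) = 0 := by
      have := sub_smul_dslope u z₀ (starRingEnd ℂ z₀)
      rw [hu.1 z₀, h0, conjC_zero, sub_zero] at this
      exact (smul_eq_zero.1 this).resolve_left (sub_ne_zero.2 hne)
    have hd2 : DifferentiableOn ℂ (dslope (dslope u z₀) (starRingEnd ℂ z₀)) (Metric.ball 0 1) :=
      (Complex.differentiableOn_dslope (Metric.isOpen_ball.mem_nhds hz₁)).2 hd
    refine exists_holStem_of_smul (holScalar_realFactor z₀) hu.1 hd2 fun z _ => ?_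
    rw [realFactor, if_neg him, mul_smul, sub_smul_dslope, h1, sub_zero, sub_smul_dslope, h0,
      sub_zero]

/-- If `n u` is divisible by a power of `realFactor z₀` and `n z₀ ≠ 0`, then so is `u`. -/
theorem HolStem.exists_eq_realFactor_pow_smul {z₀ : ℂ} (hz₀ : z₀ ∈ Metric.ball (0 : ℂ) 1)
    {n : ℂ → ℂ} (hn : HolScalar n) (hn0 : n z₀ ≠ 0) (K : ℕ) :
    ∀ {u w : ℂ → ℍ[ℂ]}, HolStem u → HolStem w →
      (∀ z ∈ Metric.ball (0 : ℂ) 1, n z • u z = realFactor z₀ z ^ K • w z) →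
      ∃ t, HolStem t ∧ ∀ z ∈ Metric.ball (0 : ℂ) 1, u z = realFactor z₀ z ^ K • t z := by
  induction K with
  | zero => intro u w hu _ _; exact ⟨u, hu, fun z _ => by simp⟩
  | succ K ih =>
    intro u w hu hw h
    have hu0 : u z₀ = 0 := by
      have := h z₀ hz₀
      rw [realFactor_self, zero_pow K.succ_ne_zero, zero_smul] at this
      exact (smul_eq_zero.1 this).resolve_left hn0
    obtain ⟨t, ht, hut⟩ := hu.exists_eq_realFactor_smul hz₀ hu0
    obtain ⟨v, hv, hv0⟩ := exists_realFactor_ne_zero z₀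
    have h2 := eq_of_smul_eq_smul (holScalar_realFactor z₀) hv hv0 (HolStem.smul hn ht)
      (HolStem.smul ((holScalar_realFactor z₀).pow K) hw) fun z hz => by
        rw [smul_comm, ← hut z hz, h z hz, smul_smul, pow_succ']
    obtain ⟨t', ht', htt'⟩ := ih ht hw h2
    refine ⟨t', ht', fun z hz => ?_⟩
    rw [hut z hz, htt' z hz, smul_smul, pow_succ']

theorem star_mul_self_smul (s t : ℍ[ℂ]) : star s * (s * t) = Quaternion.normSq s • t := by
  rw [← mul_assoc, Quaternion.star_mul_self, Quaternion.coe_mul_eq_smul]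

theorem self_mul_star_smul (s t : ℍ[ℂ]) : s * (star s * t) = Quaternion.normSq s • t := by
  rw [← mul_assoc, Quaternion.self_mul_star, Quaternion.coe_mul_eq_smul]

/-- If `B = P R` and `P g = L h` with `g`, `R`, `h` invertible at `z₀` and `L` invertible off
`z₀` and its conjugate, then `B` is `L` times a stem function that is invertible at `z₀`. -/
theorem exists_factor_transfer {z₀ : ℂ} (hz₀ : z₀ ∈ Metric.ball (0 : ℂ) 1) {K : ℕ}
    {P R g L h B : ℂ → ℍ[ℂ]} (hR : HolStem R) (hg : HolStem g) (hL : HolStem L)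
    (hh : HolStem h) (hB : HolStem B)
    (hBPR : ∀ z ∈ Metric.ball (0 : ℂ) 1, B z = P z * R z)
    (hPg : ∀ z ∈ Metric.ball (0 : ℂ) 1, P z * g z = L z * h z)
    (hLK : ∀ z ∈ Metric.ball (0 : ℂ) 1, Quaternion.normSq (L z) = realFactor z₀ z ^ K)
    (hg0 : Quaternion.normSq (g z₀) ≠ 0) (hR0 : Quaternion.normSq (R z₀) ≠ 0)
    (hh0 : Quaternion.normSq (h z₀) ≠ 0) :
    ∃ t, HolStem t ∧ Quaternion.normSq (t z₀) ≠ 0 ∧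
      ∀ z ∈ Metric.ball (0 : ℂ) 1, B z = L z * t z := by
  obtain ⟨v, hv, hv0⟩ := exists_realFactor_ne_zero z₀
  have hvL : Quaternion.normSq (L v) ≠ 0 := by rw [hLK v hv]; exact pow_ne_zero _ hv0
  -- Formally B = P R = L h g⁻¹ R. This is that identity with denominators cleared, g⁻¹ being `star
  -- g` over `normSq g`.
  have h1 : ∀ z ∈ Metric.ball (0 : ℂ) 1, Quaternion.normSq (g z) • (star (L z) * B z) =
      realFactor z₀ z ^ K • (h z * (star (g z) * R z)) := by
    intro z hz
    calc Quaternion.normSq (g z) • (star (L z) * B z)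
        = star (L z) * (P z * (Quaternion.normSq (g z) • R z)) := by
          rw [hBPR z hz, mul_smul_comm, mul_smul_comm]
      _ = star (L z) * ((P z * g z) * (star (g z) * R z)) := by
          rw [← self_mul_star_smul]; noncomm_ring
      _ = Quaternion.normSq (L z) • (h z * (star (g z) * R z)) := by
          rw [hPg z hz, mul_assoc, star_mul_self_smul]
      _ = _ := by rw [hLK z hz]
  obtain ⟨t, ht, hut⟩ := HolStem.exists_eq_realFactor_pow_smul hz₀ hg.normSq hg0 K
    (hL.star.mul hB) (hh.mul (hg.star.mul hR)) h1
  have h2 : ∀ z ∈ Metric.ball (0 : ℂ) 1, B z = L z * t z := by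
    refine eq_of_smul_eq_smul hL.normSq hv hvL hB (hL.mul ht) fun z hz => ?_
    rw [← self_mul_star_smul, hut z hz, ← hLK z hz, mul_smul_comm]
  refine ⟨t, ht, ?_, h2⟩
  -- The three factorizations give N(t) N(g) = N(h) N(R) for N = `normSq`, once N(L) is cancelled.
  -- The right-hand side is nonzero at z₀, hence so is N(t).
  have h3 : ∀ z ∈ Metric.ball (0 : ℂ) 1,
      Quaternion.normSq (L z) • ((Quaternion.normSq (t z) * Quaternion.normSq (g z)) • (1 : ℍ[ℂ])) =
      Quaternion.normSq (L z) •
        ((Quaternion.normSq (h z) * Quaternion.normSq (R z)) • (1 : ℍ[ℂ])) := by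
    intro z hz
    have e1 := congrArg Quaternion.normSq (hBPR z hz)
    have e2 := congrArg Quaternion.normSq (hPg z hz)
    have e3 := congrArg Quaternion.normSq (h2 z hz)
    rw [map_mul] at e1 e2 e3
    rw [map_mul] at e2
    rw [smul_smul, smul_smul]
    congr 1
    linear_combination Quaternion.normSq (R z) * e2 - Quaternion.normSq (g z) * e3 +
      Quaternion.normSq (g z) * e1
  have h4 := eq_of_smul_eq_smul hL.normSq hv hvL (HolStem.smul (ht.normSq.mul hg.normSq) holStem_one)
    (HolStem.smul (hh.normSq.mul hR.normSq) holStem_one) h3 z₀ hz₀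
  have h5 := congrArg (fun q : ℍ[ℂ] => q.re) h4
  simp only [Quaternion.re_smul, Quaternion.re_one, smul_eq_mul, mul_one] at h5
  intro h6
  rw [h6, zero_mul] at h5
  exact mul_ne_zero hh0 hR0 h5.symm

/-! ### Linear factors -/

/-- The stem function of `q ↦ q - p`. -/
def linStem (p : ℍ[ℝ]) (z : ℂ) : ℍ[ℂ] := z • 1 - incl p

theorem holScalar_id : HolScalar fun z => z := ⟨fun _ => rfl, differentiableOn_id⟩

theorem holStem_linStem (p : ℍ[ℝ]) : HolStem (linStem p) :=
  (HolStem.smul holScalar_id holStem_one).sub (holStem_const p)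

theorem induced_linStem (p q : ℍ[ℝ]) : induced (linStem p) q = q - p := by
  have := induced_sub (fun z => z • (1 : ℍ[ℂ])) (fun _ => incl p) q
  rw [induced_id, induced_incl] at this
  exact this

theorem stemOf_sub_const (p : ℍ[ℝ]) : stemOf (fun q => q - p) = linStem p := by
  rw [← stemOf_induced (holStem_linStem p).1]
  congr 1
  funext q
  exact (induced_linStem p q).symm

theorem toC_real_iff {p : ℍ[ℝ]} : (toC p).im = 0 ↔ p.im = 0 := by
  simp [toC]

theorem normSq_linStem (p : ℍ[ℝ]) (z : ℂ) : Quaternion.normSq (linStem p z) =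
    (z - toC p) * (z - starRingEnd ℂ (toC p)) := by
  have h : ((‖p.im‖ : ℂ)) ^ 2 = p.imI ^ 2 + p.imJ ^ 2 + p.imK ^ 2 := by
    exact_mod_cast congrArg (fun x : ℝ => (x : ℂ)) (norm_im_sq p)
  have h1 : toC p = p.re + ‖p.im‖ * Complex.I := by
    apply Complex.ext <;> simp [toC]
  rw [Quaternion.normSq_def', linStem]
  simp only [Quaternion.re_sub, Quaternion.imI_sub, Quaternion.imJ_sub, Quaternion.imK_sub,
    Quaternion.re_smul, Quaternion.imI_smul, Quaternion.imJ_smul, Quaternion.imK_smul,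
    Quaternion.re_one, Quaternion.imI_one, Quaternion.imJ_one, Quaternion.imK_one, re_incl,
    imI_incl, imJ_incl, imK_incl, smul_eq_mul, h1, map_add, map_mul, Complex.conj_ofReal,
    Complex.conj_I]
  linear_combination (-1 : ℂ) * h + (‖p.im‖ : ℂ) ^ 2 * Complex.I_sq

theorem normSq_linStem_of_nonreal {p : ℍ[ℝ]} (hp : p.im ≠ 0) (z : ℂ) :
    Quaternion.normSq (linStem p z) = realFactor (toC p) z := by
  rw [normSq_linStem, realFactor, if_neg (mt toC_real_iff.1 hp)]

/-- The stem function of `(q - p₁) * ⋯ * (q - pₙ)`. -/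
def linProd : List ℍ[ℝ] → ℂ → ℍ[ℂ]
  | [], _ => 1
  | p :: ps, z => linStem p z * linProd ps z

theorem holStem_linProd (ps : List ℍ[ℝ]) : HolStem (linProd ps) := by
  induction ps with
  | nil => exact holStem_one
  | cons p ps ih => exact (holStem_linStem p).mul ih

theorem stemOf_linearFactors (ps : List ℍ[ℝ]) (g : ℍ[ℝ] → ℍ[ℝ]) (z : ℂ) :
    stemOf (linearFactors ps g) z = linProd ps z * stemOf g z := by
  induction ps with
  | nil => simp [linearFactors, linProd]
  | cons p ps ih =>
    rw [linearFactors, stemOf_starProd, linProd, mul_assoc, ← ih, stemOf_sub_const]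

theorem linearFactors_eq_induced (ps : List ℍ[ℝ]) {g : ℍ[ℝ] → ℍ[ℝ]} (hg : SliceRegular g)
    {q : ℍ[ℝ]} (hq : q ∈ unitBall) :
    linearFactors ps g q = induced (fun z => linProd ps z * stemOf g z) q := by
  cases ps with
  | nil => simpa [linearFactors, linProd] using hg.eq_induced hq
  | cons p ps =>
    rw [linearFactors, starProd_eq_induced]
    simp only [stemOf_linearFactors, stemOf_sub_const, linProd, mul_assoc]

theorem normSq_linProd {z₀ : ℂ} (hz₀ : z₀.im ≠ 0) (ps : List ℍ[ℝ]) (hps : ∀ p ∈ ps, toC p = z₀)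
    (z : ℂ) : Quaternion.normSq (linProd ps z) = realFactor z₀ z ^ ps.length := by
  induction ps with
  | nil => simp [linProd]
  | cons p ps ih =>
    have hp : toC p = z₀ := hps p (by simp)
    have hp' : p.im ≠ 0 := fun h => hz₀ (hp ▸ toC_real_iff.2 h)
    rw [linProd, map_mul, ih fun p' hp' => hps p' (by simp [hp']), normSq_linStem_of_nonreal hp',
      hp, List.length_cons, pow_succ']

/-! ### Multiplicities in terms of stem functions -/

theorem forall_induced_ne_zero_iff {s : ℂ → ℍ[ℂ]} (hs : IsStem s) (x : ℝ) {y : ℝ} :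
    (∀ q ∈ sphereOf x y, induced s q ≠ 0) ↔ Quaternion.normSq (s ⟨x, y⟩) ≠ 0 := by
  constructor
  · intro h h0
    obtain ⟨J, hJ, hJ0⟩ := exists_evJ_eq_zero h0
    exact h _ ⟨J, hJ, rfl⟩ (by rw [induced_slice hs hJ, hJ0])
  · rintro h q ⟨J, hJ, rfl⟩ h0
    rw [induced_slice hs hJ] at h0
    exact h (normSq_eq_zero_of_evJ hJ h0)

/-- `F = Q^m (q - p₁) * ⋯ * (q - pₙ) * t` on the disc, with `Q = realFactor z₀` and `t` invertible
at `z₀`. -/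
def StemFactor (F : ℂ → ℍ[ℂ]) (z₀ : ℂ) (m : ℕ) (ps : List ℍ[ℝ]) : Prop :=
  ∃ t, HolStem t ∧ Quaternion.normSq (t z₀) ≠ 0 ∧
    ∀ z ∈ Metric.ball (0 : ℂ) 1, F z = realFactor z₀ z ^ m • (linProd ps z * t z)

theorem smul_one_eq_incl (r : ℝ) : (r : ℂ) • (1 : ℍ[ℂ]) = incl (r : ℍ[ℝ]) := by
  apply Quaternion.ext <;> simp [-Complex.coe_smul]

theorem induced_realFactor {x y : ℝ} (hy : y ≠ 0) (q : ℍ[ℝ]) :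
    induced (fun z => realFactor ⟨x, y⟩ z • (1 : ℍ[ℂ])) q =
      (q - (x : ℍ[ℝ])) ^ 2 + (y : ℍ[ℝ]) ^ 2 := by
  have h1 : (fun z => realFactor ⟨x, y⟩ z • (1 : ℍ[ℂ])) =
      fun z : ℂ => ((z - x) ^ 2) • (1 : ℍ[ℂ]) + incl ((y ^ 2 : ℝ) : ℍ[ℝ]) := by
    funext z
    rw [← smul_one_eq_incl, ← add_smul]
    congr 1
    have e1 : (⟨x, y⟩ : ℂ) = x + y * Complex.I := by apply Complex.ext <;> simp
    rw [realFactor, if_neg hy, e1]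
    simp only [map_add, map_mul, Complex.conj_ofReal, Complex.conj_I]
    push_cast
    linear_combination -(y : ℂ) ^ 2 * Complex.I_sq
  rw [h1, induced_add, induced_incl, induced_scalar_pow (c := fun z => z - x) (fun z => by simp)]
  have h2 : (fun z : ℂ => (z - x) • (1 : ℍ[ℂ])) = linStem (x : ℍ[ℝ]) := by
    funext z
    rw [sub_smul, smul_one_eq_incl]; rfl
  rw [h2, induced_linStem, Quaternion.coe_pow]

/-- The polynomial (q - x)² + y² has a real scalar stem, so multiplying by it pointwise is a regular
product. That g has no zeros on the sphere becomes invertibility of its stem at x + iy. -/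
theorem isSphereFactorization_iff {f : ℍ[ℝ] → ℍ[ℝ]} (hf : SliceRegular f) {x y : ℝ} (hy : 0 < y)
    (hxy : (⟨x, y⟩ : ℂ) ∈ Metric.ball (0 : ℂ) 1) (m : ℕ) (ps : List ℍ[ℝ]) :
    IsSphereFactorization f x y m ps ↔ (∀ p ∈ ps, p ∈ sphereOf x y) ∧
      ps.IsChain (fun p p' => p ≠ star p') ∧ StemFactor (stemOf f) ⟨x, y⟩ m ps := by
  have hQ := holScalar_realFactor ⟨x, y⟩
  have hQm : ∀ z, realFactor ⟨x, y⟩ (starRingEnd ℂ z) ^ m =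
      starRingEnd ℂ (realFactor ⟨x, y⟩ z ^ m) := (hQ.pow m).1
  have key : ∀ {s : ℂ → ℍ[ℂ]}, IsStem s → ∀ q,
      induced (fun z => realFactor ⟨x, y⟩ z ^ m • s z) q =
        ((q - (x : ℍ[ℝ])) ^ 2 + (y : ℍ[ℝ]) ^ 2) ^ m * induced s q := by
    intro s hs q
    rw [induced_smul hQm hs, induced_scalar_pow hQ.1, induced_realFactor hy.ne']
  constructor
  · rintro ⟨h1, h2, g, hg, hg0, hfg⟩
    refine ⟨h1, h2, stemOf g, hg.holStem, ?_, fun z hz => ?_⟩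
    · rw [← forall_induced_ne_zero_iff (isStem_stemOf g)]
      rintro q hq
      have hb : q ∈ unitBall := by
        rw [mem_unitBall, ← norm_toC, (mem_sphereOf_iff hy.le).1 hq]
        exact mem_ball_zero_iff.1 hxy
      rw [← hg.eq_induced hb]
      exact hg0 q hq
    · have : ∀ q ∈ unitBall, f q =
          induced (fun z => realFactor ⟨x, y⟩ z ^ m • (linProd ps z * stemOf g z)) q := by
        intro q hq
        rw [hfg q hq, key ((holStem_linProd ps).1.mul (isStem_stemOf g)),
          linearFactors_eq_induced ps hg hq]
      rw [stemOf_congr this hz, stemOf_induced]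
      exact ((holStem_linProd ps).1.mul (isStem_stemOf g)).smul hQm
  · rintro ⟨h1, h2, t, ht, ht0, hft⟩
    refine ⟨h1, h2, induced t, ht.sliceRegular, (forall_induced_ne_zero_iff ht.1 x).2 ht0, ?_⟩
    intro q hq
    rw [hf.eq_induced hq, induced_congr hft hq, key ((holStem_linProd ps).1.mul ht.1),
      linearFactors_eq_induced ps ht.sliceRegular hq, stemOf_induced ht.1]

/-- The isolated multiplicity at a real point. -/
theorem hasIsolatedMultiplicity_real_iff {f : ℍ[ℝ] → ℍ[ℝ]} (hf : SliceRegular f) {p : ℍ[ℝ]}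
    (hp : p.im = 0) (hpb : p ∈ unitBall) (k : ℕ) :
    HasIsolatedMultiplicity f p k ↔ StemFactor (stemOf f) (toC p) k [] := by
  have hpre : p = (p.re : ℍ[ℝ]) := by
    conv_lhs => rw [← Quaternion.re_add_im p, hp, add_zero]
  have hC : toC p = ⟨p.re, 0⟩ := by rw [toC, hp, norm_zero]
  have hsp : ∀ q, q ∈ sphereOf p.re 0 ↔ q = p := by
    intro q
    constructor
    · rintro ⟨J, _, rfl⟩
      rw [hpre]; simp
    · rintro rfl
      exact ⟨unitI, unitI_mem, by rw [hpre]; simp⟩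
  have hQ := holScalar_realFactor (toC p)
  have hQk : ∀ z, realFactor (toC p) (starRingEnd ℂ z) ^ k =
      starRingEnd ℂ (realFactor (toC p) z ^ k) := (hQ.pow k).1
  have hlin : (fun z => realFactor (toC p) z • (1 : ℍ[ℂ])) = linStem p := by
    funext z
    have : toC p = ((p.re : ℝ) : ℂ) := by rw [hC]; rfl
    rw [realFactor, if_pos (toC_real_iff.2 hp), sub_smul, this, smul_one_eq_incl, ← hpre]
    rfl
  have key : ∀ {s : ℂ → ℍ[ℂ]}, IsStem s → ∀ q,
      induced (fun z => realFactor (toC p) z ^ k • s z) q = (q - p) ^ k * induced s q := by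
    intro s hs q
    rw [induced_smul hQk hs, induced_scalar_pow hQ.1, hlin, induced_linStem]
  rw [HasIsolatedMultiplicity, if_pos hp]
  constructor
  · rintro ⟨h, hh, hh0, hfh⟩
    refine ⟨stemOf h, hh.holStem, ?_, fun z hz => ?_⟩
    · rw [hC, ← forall_induced_ne_zero_iff (isStem_stemOf h)]
      intro q hq
      rw [(hsp q).1 hq, ← hh.eq_induced hpb]
      exact hh0
    · have : ∀ q ∈ unitBall, f q =
          induced (fun z => realFactor (toC p) z ^ k • stemOf h z) q := by
        intro q hq
        rw [hfh q hq, key (isStem_stemOf h), hh.eq_induced hq]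
      rw [stemOf_congr this hz, stemOf_induced ((isStem_stemOf h).smul hQk), linProd, one_mul]
  · rintro ⟨t, ht, ht0, hft⟩
    refine ⟨induced t, ht.sliceRegular, ?_, fun q hq => ?_⟩
    · rw [hC] at ht0
      exact (forall_induced_ne_zero_iff ht.1 _).2 ht0 p ((hsp p).2 rfl)
    · rw [hf.eq_induced hq, induced_congr hft hq]
      simp only [linProd, one_mul]
      exact key ht.1 q

/-- The points in the linear factors lie on the sphere of `z₀`, and there are none for real `z₀`. -/
def OnSphere (z₀ : ℂ) (ps : List ℍ[ℝ]) : Prop := ∀ p ∈ ps, toC p = z₀ ∧ z₀.im ≠ 0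

theorem holStem_factor (z₀ : ℂ) (m : ℕ) (ps : List ℍ[ℝ]) :
    HolStem fun z => realFactor z₀ z ^ m • linProd ps z :=
  HolStem.smul ((holScalar_realFactor z₀).pow m) (holStem_linProd ps)

theorem normSq_factor {z₀ : ℂ} (m : ℕ) {ps : List ℍ[ℝ]} (hps : OnSphere z₀ ps) (z : ℂ) :
    Quaternion.normSq (realFactor z₀ z ^ m • linProd ps z) =
      realFactor z₀ z ^ (2 * m + ps.length) := by
  have h : Quaternion.normSq (linProd ps z) = realFactor z₀ z ^ ps.length := by
    cases ps with
    | nil => simp [linProd]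
    | cons p ps => exact normSq_linProd (hps p (by simp)).2 _ (fun q hq => (hps q hq).1) z
  rw [Quaternion.normSq_smul, h]
  ring

/-- F and B share the left factor P up to right factors invertible at z₀. The hypotheses are
symmetric in F and B when both right factors are holomorphic, so the lemma serves in both
directions. -/
theorem StemFactor.transfer {z₀ : ℂ} (hz₀ : z₀ ∈ Metric.ball (0 : ℂ) 1) {m : ℕ}
    {ps : List ℍ[ℝ]} (hps : OnSphere z₀ ps) {P R g F B : ℂ → ℍ[ℂ]} (hR : HolStem R)
    (hg : HolStem g) (hB : HolStem B) (hBPR : ∀ z ∈ Metric.ball (0 : ℂ) 1, B z = P z * R z)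
    (hPg : ∀ z ∈ Metric.ball (0 : ℂ) 1, F z = P z * g z)
    (hg0 : Quaternion.normSq (g z₀) ≠ 0) (hR0 : Quaternion.normSq (R z₀) ≠ 0)
    (h : StemFactor F z₀ m ps) : StemFactor B z₀ m ps := by
  obtain ⟨t, ht, ht0, hFt⟩ := h
  obtain ⟨t', ht', ht0', hBt⟩ := exists_factor_transfer hz₀ hR hg (holStem_factor z₀ m ps) ht hB
    hBPR (fun z hz => by rw [← hPg z hz, hFt z hz, smul_mul_assoc])
    (fun z _ => normSq_factor m hps z) hg0 hR0 ht0
  exact ⟨t', ht', ht0', fun z hz => by rw [hBt z hz, smul_mul_assoc]⟩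

theorem star_slice {J : ℍ[ℝ]} (hJ : J ∈ imUnits) (x y : ℝ) :
    star ((x : ℍ[ℝ]) + (y : ℍ[ℝ]) * J) = (x : ℍ[ℝ]) + (y : ℍ[ℝ]) * (-J) := by
  have h := (mem_imUnits.1 hJ).1
  apply Quaternion.ext <;> simp [h, mul_comm]

theorem evJ_linStem {J : ℍ[ℝ]} (hJ : J ∈ imUnits) (x y : ℝ) :
    evJ J (linStem ((x : ℍ[ℝ]) + (y : ℍ[ℝ]) * J) ⟨x, y⟩) = 0 := by
  rw [← induced_slice (holStem_linStem _).1 hJ, induced_linStem, sub_self]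

/-- At the conjugate of p = x + yJ the factor q - p has the value -2yJ. This is invertible and
commutes with -J, so the product rule moves the zero to W at the same point. -/
theorem evJ_neg_of_linStem_mul {J : ℍ[ℝ]} (hJ : J ∈ imUnits) (x : ℝ) {y : ℝ} (hy : y ≠ 0)
    {W : ℍ[ℂ]} (h : linStem ((x : ℍ[ℝ]) + (y : ℍ[ℝ]) * J) ⟨x, y⟩ * W = 0) : evJ (-J) W = 0 := by
  have hJ2 := imUnits_mul_self hJ
  have e1 : reP (linStem ((x : ℍ[ℝ]) + (y : ℍ[ℝ]) * J) ⟨x, y⟩) = -((y : ℍ[ℝ]) * J) := by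
    apply Quaternion.ext <;> simp [linStem]
  have e2 : imP (linStem ((x : ℍ[ℝ]) + (y : ℍ[ℝ]) * J) ⟨x, y⟩) = (y : ℍ[ℝ]) := by
    apply Quaternion.ext <;> simp [linStem]
  have hJ' := neg_mem_imUnits hJ
  have h3 := evJ_mul hJ' (linStem ((x : ℍ[ℝ]) + (y : ℍ[ℝ]) * J) ⟨x, y⟩) W rfl
  have e3 : evJ (-J) (linStem ((x : ℍ[ℝ]) + (y : ℍ[ℝ]) * J) ⟨x, y⟩) = (-(2 * y) : ℝ) • J := by
    rw [evJ, e1, e2]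
    apply Quaternion.ext <;> simp <;> ring
  rw [h, e3] at h3
  have h4 : (-(2 * y) : ℝ) • (J * evJ (-J) W) = 0 := by
    have h5 : evJ (-J) 0 = 0 := by
      rw [evJ]; apply Quaternion.ext <;> simp
    rw [h5] at h3
    rw [evJ, mul_add, smul_add, h3]
    simp only [smul_mul_assoc, mul_smul_comm, neg_mul, mul_neg, mul_assoc]
  rcases smul_eq_zero.1 h4 with h5 | h5
  · exact absurd h5 (by simpa using hy)
  · exact (mul_eq_zero.1 h5).resolve_left (imUnits_ne_zero hJ)

theorem exists_slice_of_toC {p : ℍ[ℝ]} {x y : ℝ} (hy : 0 ≤ y) (hp : toC p = ⟨x, y⟩) :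
    ∃ J ∈ imUnits, p = (x : ℍ[ℝ]) + (y : ℍ[ℝ]) * J := (mem_sphereOf_iff hy).2 hp

/-- If the product vanished at x + iy, the product of the tail would vanish at the conjugate of p as
well as at its own first point p'. These differ by the chain condition, so the tail would be zero,
against induction. -/
theorem linProd_ne_zero {x y : ℝ} (hy : 0 < y) {ps : List ℍ[ℝ]}
    (hps : OnSphere ⟨x, y⟩ ps) (hc : ps.IsChain (fun p p' => p ≠ star p')) :
    linProd ps ⟨x, y⟩ ≠ 0 := by
  induction ps with
  | nil => simp [linProd]
  | cons p ps ih =>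
    have ih' := ih (fun q hq => hps q (by simp [hq])) hc.of_cons
    intro h0
    obtain ⟨J, hJ, hpJ⟩ := exists_slice_of_toC hy.le (hps p (by simp)).1
    rw [linProd, hpJ] at h0
    have h1 := evJ_neg_of_linStem_mul hJ x hy.ne' h0
    cases ps with
    | nil =>
      simp only [linProd, evJ] at h1
      have := congrArg (fun q : ℍ[ℝ] => q.re) h1
      simp [(mem_imUnits.1 hJ).1] at this
    | cons p' ps =>
      obtain ⟨J', hJ', hpJ'⟩ := exists_slice_of_toC hy.le (hps p' (by simp)).1
      have h2 : evJ J' (linProd (p' :: ps) ⟨x, y⟩) = 0 := by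
        rw [linProd]
        exact evJ_mul_eq_zero hJ' _ (by rw [hpJ']; exact evJ_linStem hJ' x y)
      refine ih' (eq_zero_of_evJ_two ?_ h2 h1)
      rintro rfl
      have hne : p ≠ star p' := hc.rel
      apply hne
      rw [hpJ, hpJ', star_slice hJ', neg_neg]

/-- If the exponents differed, cancelling the smaller power would leave a factor vanishing at z₀ on
one side only. -/
theorem realFactor_pow_cancel {z₀ : ℂ} (hz₀ : z₀ ∈ Metric.ball (0 : ℂ) 1) {a b : ℕ}
    {u v : ℂ → ℍ[ℂ]} (hu : HolStem u) (hv : HolStem v) (hu0 : u z₀ ≠ 0) (hv0 : v z₀ ≠ 0)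
    (h : ∀ z ∈ Metric.ball (0 : ℂ) 1, realFactor z₀ z ^ a • u z = realFactor z₀ z ^ b • v z) :
    a = b ∧ ∀ z ∈ Metric.ball (0 : ℂ) 1, u z = v z := by
  obtain ⟨w, hw, hw0⟩ := exists_realFactor_ne_zero z₀
  have key : ∀ {a b : ℕ} {u v : ℂ → ℍ[ℂ]}, HolStem u → HolStem v → u z₀ ≠ 0 →
      (∀ z ∈ Metric.ball (0 : ℂ) 1, realFactor z₀ z ^ a • u z = realFactor z₀ z ^ b • v z) →
      b ≤ a := by
    intro a b u v hu hv hu0 h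
    by_contra! hab
    obtain ⟨d, rfl⟩ := Nat.exists_eq_add_of_lt hab
    have h1 := eq_of_smul_eq_smul ((holScalar_realFactor z₀).pow a) hw (pow_ne_zero _ hw0) hu
      (HolStem.smul ((holScalar_realFactor z₀).pow (d + 1)) hv) (fun z hz => by
        rw [h z hz, smul_smul, ← pow_add, add_assoc])
    apply hu0
    rw [h1 z₀ hz₀]
    simp
  have hab : a = b := le_antisymm (key hv hu hv0 fun z hz => (h z hz).symm) (key hu hv hu0 h)
  subst hab
  exact ⟨rfl, eq_of_smul_eq_smul ((holScalar_realFactor z₀).pow a) hw (pow_ne_zero _ hw0) hu hv h⟩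

theorem mul_ne_zero_of_normSq {s t : ℍ[ℂ]} (hs : s ≠ 0) (ht : Quaternion.normSq t ≠ 0) :
    s * t ≠ 0 := by
  intro h
  have h1 : s * t * star t = 0 := by rw [h, zero_mul]
  rw [mul_assoc, Quaternion.self_mul_star, Quaternion.mul_coe_eq_smul] at h1
  exact hs ((smul_eq_zero.1 h1).resolve_left ht)

/-- Uniqueness of the spherical multiplicity, the number of linear factors, and the first one. -/
theorem StemFactor.unique {x y : ℝ} (hy : 0 < y) (hxy : (⟨x, y⟩ : ℂ) ∈ Metric.ball (0 : ℂ) 1)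
    {F : ℂ → ℍ[ℂ]} {m m' : ℕ} {ps ps' : List ℍ[ℝ]} (hps : OnSphere ⟨x, y⟩ ps)
    (hps' : OnSphere ⟨x, y⟩ ps') (hc : ps.IsChain (fun p p' => p ≠ star p'))
    (hc' : ps'.IsChain (fun p p' => p ≠ star p')) (h : StemFactor F ⟨x, y⟩ m ps)
    (h' : StemFactor F ⟨x, y⟩ m' ps') :
    m = m' ∧ ps.length = ps'.length ∧ ps.head? = ps'.head? := by
  obtain ⟨t, ht, ht0, hFt⟩ := h
  obtain ⟨t', ht', ht0', hFt'⟩ := h'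
  have hne := mul_ne_zero_of_normSq (linProd_ne_zero hy hps hc) ht0
  have hne' := mul_ne_zero_of_normSq (linProd_ne_zero hy hps' hc') ht0'
  obtain ⟨hm, heq⟩ := realFactor_pow_cancel hxy ((holStem_linProd ps).mul ht)
    ((holStem_linProd ps').mul ht') hne hne' (fun z hz => (hFt z hz).symm.trans (hFt' z hz))
  have hnorm : ∀ {c : ℂ}, c ≠ 0 → c • (1 : ℍ[ℂ]) ≠ 0 := fun hc => smul_ne_zero hc one_ne_zero
  have hpow : ∀ {ps : List ℍ[ℝ]}, OnSphere ⟨x, y⟩ ps → ∀ z,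
      Quaternion.normSq (linProd ps z) = realFactor ⟨x, y⟩ z ^ ps.length := by
    intro ps hps z
    simpa using normSq_factor 0 hps z
  -- Applying `normSq` turns each list into a power of the real factor with exponent its length.
  obtain ⟨hl, -⟩ := realFactor_pow_cancel hxy (HolStem.smul ht.normSq holStem_one)
    (HolStem.smul ht'.normSq holStem_one) (hnorm ht0) (hnorm ht0') (a := ps.length)
    (b := ps'.length) (fun z hz => by
      have := congrArg Quaternion.normSq (heq z hz)
      rw [map_mul, map_mul, hpow hps, hpow hps'] at this
      rw [smul_smul, smul_smul, this])
  refine ⟨hm, hl, ?_⟩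
  cases ps with
  | nil =>
    rw [List.eq_nil_of_length_eq_zero hl.symm]
  | cons p ps =>
    cases ps' with
    | nil => simp at hl
    | cons p' ps' =>
      obtain ⟨J, hJ, hpJ⟩ := exists_slice_of_toC hy.le (hps p (by simp)).1
      obtain ⟨J', hJ', hpJ'⟩ := exists_slice_of_toC hy.le (hps' p' (by simp)).1
      have e1 : evJ J (linProd (p :: ps) ⟨x, y⟩ * t ⟨x, y⟩) = 0 := by
        rw [linProd, mul_assoc]
        exact evJ_mul_eq_zero hJ _ (by rw [hpJ]; exact evJ_linStem hJ x y)
      have e2 : evJ J' (linProd (p :: ps) ⟨x, y⟩ * t ⟨x, y⟩) = 0 := by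
        rw [heq _ hxy, linProd, mul_assoc]
        exact evJ_mul_eq_zero hJ' _ (by rw [hpJ']; exact evJ_linStem hJ' x y)
      -- Both first points are zeros of one stem value, which is nonzero and so has at most one
      -- zero.
      have : J = J' := by
        by_contra hJJ
        exact hne (eq_zero_of_evJ_two hJJ e1 e2)
      rw [hpJ, hpJ', this]
      rfl

/-! ### Blaschke factors -/

section Incl
variable (a b : ℍ[ℝ])

theorem incl_mul : incl (a * b) = incl a * incl b := by
  apply Quaternion.ext <;> simp

theorem incl_star : incl (star a) = star (incl a) := by
  apply Quaternion.ext <;> simp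

theorem incl_smul (r : ℝ) : incl (r • a) = (r : ℂ) • incl a := by
  apply Quaternion.ext <;> simp [-Complex.coe_smul]

theorem norm_incl_le : ‖incl a‖ ≤ 4 * ‖a‖ := by
  have key : ∀ r : ℝ, r ^ 2 ≤ ‖a‖ ^ 2 → |r| ≤ ‖a‖ := fun r h => abs_le_of_sq_le_sq h (norm_nonneg _)
  have h : ‖a‖ ^ 2 = a.re ^ 2 + a.imI ^ 2 + a.imJ ^ 2 + a.imK ^ 2 := by
    rw [pow_two, ← Quaternion.normSq_eq_norm_mul_self, Quaternion.normSq_def']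
  have h0 := key a.re (by rw [h]; nlinarith [sq_nonneg a.imI, sq_nonneg a.imJ, sq_nonneg a.imK])
  have h1 := key a.imI (by rw [h]; nlinarith [sq_nonneg a.re, sq_nonneg a.imJ, sq_nonneg a.imK])
  have h2 := key a.imJ (by rw [h]; nlinarith [sq_nonneg a.imI, sq_nonneg a.re, sq_nonneg a.imK])
  have h3 := key a.imK (by rw [h]; nlinarith [sq_nonneg a.imI, sq_nonneg a.imJ, sq_nonneg a.re])
  rw [norm_def]
  simp only [re_incl, imI_incl, imJ_incl, imK_incl, Complex.norm_real, Real.norm_eq_abs]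
  linarith

end Incl

/-- The stem function of the Blaschke factor. -/
def blaschkeStem (b : ℍ[ℝ]) : ℂ → ℍ[ℂ] := stemOf (blaschkeFactor b)

/-- The stem function of `1 - q b̄`. -/
def denomStem (b : ℍ[ℝ]) (z : ℂ) : ℍ[ℂ] := 1 - z • incl (star b)

theorem holStem_denomStem (b : ℍ[ℝ]) : HolStem (denomStem b) :=
  holStem_one.sub (HolStem.smul holScalar_id (holStem_const _))

theorem star_denomStem (b : ℍ[ℝ]) (z : ℂ) : star (denomStem b z) = 1 - z • incl b := by
  rw [denomStem, star_sub, star_one, Quaternion.star_smul, incl_star, star_star]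

theorem normSq_denomStem (b : ℍ[ℝ]) (z : ℂ) : Quaternion.normSq (denomStem b z) =
    (1 - z * toC b) * (1 - z * starRingEnd ℂ (toC b)) := by
  have h : ((‖b.im‖ : ℂ)) ^ 2 = b.imI ^ 2 + b.imJ ^ 2 + b.imK ^ 2 := by
    exact_mod_cast congrArg (fun x : ℝ => (x : ℂ)) (norm_im_sq b)
  have h1 : toC b = b.re + ‖b.im‖ * Complex.I := by
    apply Complex.ext <;> simp [toC]
  rw [Quaternion.normSq_def', denomStem]
  simp only [Quaternion.re_sub, Quaternion.imI_sub, Quaternion.imJ_sub, Quaternion.imK_sub,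
    Quaternion.re_smul, Quaternion.imI_smul, Quaternion.imJ_smul, Quaternion.imK_smul,
    Quaternion.re_one, Quaternion.imI_one, Quaternion.imJ_one, Quaternion.imK_one, re_incl,
    imI_incl, imJ_incl, imK_incl, smul_eq_mul, h1, map_add, map_mul, Complex.conj_ofReal,
    Complex.conj_I, Quaternion.re_star, Quaternion.imI_star, Quaternion.imJ_star,
    Quaternion.imK_star]
  push_cast
  linear_combination (-z ^ 2 : ℂ) * h + z ^ 2 * (‖b.im‖ : ℂ) ^ 2 * Complex.I_sq

theorem sq_one_sub_norm_le_normSq_denomStem {b : ℍ[ℝ]} (hb : b ∈ unitBall) {z : ℂ}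
    (hz : ‖z‖ < 1) : (1 - ‖z‖) ^ 2 ≤ ‖Quaternion.normSq (denomStem b z)‖ := by
  have key : ∀ w : ℂ, ‖w‖ ≤ 1 → 1 - ‖z‖ ≤ ‖1 - z * w‖ := by
    intro w hw
    have h1 := norm_sub_norm_le (1 : ℂ) (z * w)
    rw [norm_one, norm_mul] at h1
    nlinarith [norm_nonneg z, norm_nonneg w]
  have hw : ‖toC b‖ ≤ 1 := by rw [norm_toC]; exact (mem_unitBall.1 hb).le
  rw [normSq_denomStem, norm_mul, pow_two]
  have h0 : 0 ≤ 1 - ‖z‖ := by linarith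
  exact mul_le_mul (key _ hw) (key _ (by simpa using hw)) h0 (norm_nonneg _)

theorem normSq_denomStem_ne_zero {b : ℍ[ℝ]} (hb : b ∈ unitBall) {z : ℂ}
    (hz : z ∈ Metric.ball (0 : ℂ) 1) : Quaternion.normSq (denomStem b z) ≠ 0 := by
  have hz' : ‖z‖ < 1 := mem_ball_zero_iff.1 hz
  have h := sq_one_sub_norm_le_normSq_denomStem hb hz'
  have : 0 < (1 - ‖z‖) ^ 2 := by have : 0 < 1 - ‖z‖ := by linarith
                                 positivity
  exact norm_pos_iff.1 (by linarith)

theorem conj_inv_normSq_denomStem (b : ℍ[ℝ]) (z : ℂ) :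
    (Quaternion.normSq (denomStem b (starRingEnd ℂ z)))⁻¹ =
      starRingEnd ℂ (Quaternion.normSq (denomStem b z))⁻¹ := by
  have := (holStem_denomStem b).normSq.1 z
  simp only at this
  rw [this, map_inv₀]

theorem isStem_id : IsStem fun z => z • (1 : ℍ[ℂ]) :=
  isStem_scalar (c := fun z => z) fun _ => rfl

theorem holScalar_inv_normSq_denomStem {b : ℍ[ℝ]} (hb : b ∈ unitBall) :
    HolScalar fun z => (Quaternion.normSq (denomStem b z))⁻¹ :=
  ⟨conj_inv_normSq_denomStem b,
    (holStem_denomStem b).normSq.2.inv fun _ hz => normSq_denomStem_ne_zero hb hz⟩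

theorem blaschkeStem_eq {b : ℍ[ℝ]} (hb0 : b ≠ 0) (z : ℂ) : blaschkeStem b z =
    ((Quaternion.normSq (denomStem b z))⁻¹ • star (denomStem b z)) *
      (-(linStem b z) * incl (‖b‖⁻¹ • star b)) := by
  have h1 : stemOf (fun q => 1 - q * star b) = denomStem b := by
    have hs : IsStem fun z => 1 - (z • 1) * incl (star b) :=
      isStem_one.sub (isStem_id.mul (isStem_incl _))
    have : (fun q => 1 - q * star b) = induced fun z => 1 - (z • 1) * incl (star b) := by
      funext q
      rw [induced_sub, induced_one, induced_mul_incl, induced_id]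
    rw [this, stemOf_induced hs]
    funext z
    rw [denomStem, smul_mul_assoc, one_mul]
  have h2 : stemOf (fun q => (b - q) * (‖b‖⁻¹ • star b)) =
      fun z => -(linStem b z) * incl (‖b‖⁻¹ • star b) := by
    have hs : IsStem fun z => (incl b - z • 1) * incl (‖b‖⁻¹ • star b) :=
      ((isStem_incl b).sub isStem_id).mul (isStem_incl _)
    have : (fun q => (b - q) * (‖b‖⁻¹ • star b)) =
        induced fun z => (incl b - z • 1) * incl (‖b‖⁻¹ • star b) := by
      funext q
      rw [induced_mul_incl, induced_sub, induced_incl, induced_id]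
    rw [this, stemOf_induced hs]
    funext z
    rw [linStem, neg_sub]
  have hst : IsStem fun z => (Quaternion.normSq (denomStem b z))⁻¹ • star (denomStem b z) :=
    IsStem.smul (c := fun z => (Quaternion.normSq (denomStem b z))⁻¹)
      (conj_inv_normSq_denomStem b) (holStem_denomStem b).star.1
  rw [blaschkeStem, blaschkeFactor, if_neg hb0, stemOf_starProd, h2, regRecip_eq_induced, h1,
    stemOf_induced hst]

theorem blaschkeStem_zero (z : ℂ) : blaschkeStem 0 z = z • 1 := by
  have : blaschkeFactor 0 = induced fun z => z • (1 : ℍ[ℂ]) := by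
    funext q
    rw [blaschkeFactor, if_pos rfl, induced_id]
  rw [blaschkeStem, this, stemOf_induced isStem_id]

open Classical in
/-- The invertible cofactor of `q - b` in the Blaschke factor. -/
def cofactorStem (b : ℍ[ℝ]) (z : ℂ) : ℍ[ℂ] :=
  if b = 0 then 1 else
    -((Quaternion.normSq (denomStem b z))⁻¹ • (star (denomStem b z) * incl (‖b‖⁻¹ • star b)))

theorem holStem_cofactorStem {b : ℍ[ℝ]} (hb : b ∈ unitBall) : HolStem (cofactorStem b) := by
  by_cases h : b = 0
  · have : cofactorStem b = fun _ => 1 := by funext z; rw [cofactorStem, if_pos h]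
    rw [this]; exact holStem_one
  · have : cofactorStem b = fun z => -((Quaternion.normSq (denomStem b z))⁻¹ •
        (star (denomStem b z) * incl (‖b‖⁻¹ • star b))) := by
      funext z; rw [cofactorStem, if_neg h]
    rw [this]
    have h1 := HolStem.smul (holScalar_inv_normSq_denomStem hb)
      ((holStem_denomStem b).star.mul (holStem_const (‖b‖⁻¹ • star b)))
    have h0 : HolStem fun _ => 0 := ⟨fun _ => by simp, differentiableOn_const _⟩
    simpa using h0.sub h1

/-- `star (denomStem b z)` is 1 - zb and the scalar z is central, so it commutes with z - b and the
zero can be moved to the left. -/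
theorem blaschkeStem_eq_linStem_mul (b : ℍ[ℝ]) (z : ℂ) :
    blaschkeStem b z = linStem b z * cofactorStem b z := by
  by_cases h : b = 0
  · rw [cofactorStem, if_pos h, h, blaschkeStem_zero, linStem, mul_one]
    have : incl 0 = 0 := by apply Quaternion.ext <;> simp
    rw [this, sub_zero]
  · have hcomm : star (denomStem b z) * linStem b z = linStem b z * star (denomStem b z) := by
      rw [star_denomStem, linStem]
      simp only [sub_mul, mul_sub, one_mul, mul_one, smul_mul_assoc, mul_smul_comm, smul_sub]
      abel
    rw [cofactorStem, if_neg h, blaschkeStem_eq h, smul_mul_assoc, mul_neg, mul_smul_comm,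
      ← smul_neg]
    congr 1
    rw [← mul_assoc, mul_neg, hcomm]
    noncomm_ring

theorem holStem_blaschkeStem {b : ℍ[ℝ]} (hb : b ∈ unitBall) : HolStem (blaschkeStem b) := by
  have : blaschkeStem b = fun z => linStem b z * cofactorStem b z := by
    funext z; exact blaschkeStem_eq_linStem_mul b z
  rw [this]
  exact (holStem_linStem b).mul (holStem_cofactorStem hb)

theorem normSq_incl (a : ℍ[ℝ]) : Quaternion.normSq (incl a) = ((‖a‖ ^ 2 : ℝ) : ℂ) := by
  rw [pow_two, ← Quaternion.normSq_eq_norm_mul_self, Quaternion.normSq_def', Quaternion.normSq_def']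
  simp

theorem normSq_cofactorStem_ne_zero {b : ℍ[ℝ]} (hb : b ∈ unitBall) {z : ℂ}
    (hz : z ∈ Metric.ball (0 : ℂ) 1) : Quaternion.normSq (cofactorStem b z) ≠ 0 := by
  by_cases h : b = 0
  · rw [cofactorStem, if_pos h]; simp
  · have h1 := normSq_denomStem_ne_zero hb hz
    have h2 : (‖b‖ : ℂ) ≠ 0 := by exact_mod_cast norm_ne_zero_iff.2 h
    rw [cofactorStem, if_neg h, Quaternion.normSq_neg, Quaternion.normSq_smul, map_mul,
      Quaternion.normSq_star, normSq_incl, norm_smul, norm_star, norm_inv, norm_norm,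
      inv_mul_cancel₀ (norm_ne_zero_iff.2 h)]
    simp [h1]

/-- With c = b̄/|b|, numerator minus denominator is (b - z)c - (1 - zb̄) = -(1 - |b|)(1 + zc); the
normalization by c produces the small factor. The constant 25 bounds the product of two terms of
norm at most 1 + 4, where `norm_incl_le` gives the 4. -/
theorem norm_blaschkeStem_sub_one_le {b : ℍ[ℝ]} (hb : b ∈ unitBall) {z : ℂ}
    (hz : z ∈ Metric.ball (0 : ℂ) 1) :
    ‖blaschkeStem b z - 1‖ ≤ 25 * (1 - ‖b‖) / (1 - ‖z‖) ^ 2 := by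
  have hz' : ‖z‖ < 1 := mem_ball_zero_iff.1 hz
  have hb' : ‖b‖ < 1 := mem_unitBall.1 hb
  have hpos : 0 < (1 - ‖z‖) ^ 2 := by have : 0 < 1 - ‖z‖ := by linarith
                                      positivity
  by_cases h : b = 0
  · subst h
    rw [blaschkeStem_zero, le_div_iff₀ hpos]
    have e1 : ‖z • (1 : ℍ[ℂ]) - 1‖ ≤ 2 := by
      refine (norm_sub_le _ _).trans ?_
      rw [norm_smul, norm_one]; linarith
    have e2 : (1 - ‖z‖) ^ 2 ≤ 1 := by nlinarith [norm_nonneg z]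
    simp only [norm_zero]
    nlinarith [norm_nonneg (z • (1 : ℍ[ℂ]) - 1)]
  · have hb0 : ‖b‖ ≠ 0 := norm_ne_zero_iff.2 h
    set c : ℍ[ℝ] := ‖b‖⁻¹ • star b with hc
    have hcn : ‖c‖ = 1 := by
      rw [hc, norm_smul, norm_inv, norm_norm, norm_star, inv_mul_cancel₀ hb0]
    have hbc : incl b * incl c = (‖b‖ : ℂ) • 1 := by
      rw [← incl_mul, hc, mul_smul_comm, Quaternion.self_mul_star,
        Quaternion.normSq_eq_norm_mul_self, smul_one_eq_incl]
      congr 1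
      rw [Quaternion.smul_coe, ← mul_assoc, inv_mul_cancel₀ hb0, one_mul]
    have hsb : incl (star b) = (‖b‖ : ℂ) • incl c := by
      rw [← incl_smul, hc, smul_smul, mul_inv_cancel₀ hb0, one_smul]
    have hn := normSq_denomStem_ne_zero hb hz
    have h1 : (1 : ℍ[ℂ]) = ((Quaternion.normSq (denomStem b z))⁻¹ • star (denomStem b z)) *
        denomStem b z := by
      rw [smul_mul_assoc, Quaternion.star_mul_self, ← mul_one (Quaternion.coe _),
        Quaternion.coe_mul_eq_smul, smul_smul, inv_mul_cancel₀ hn, one_smul]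
    have h2 : -(linStem b z) * incl c - denomStem b z =
        (-(1 - ‖b‖ : ℂ)) • (1 + z • incl c) := by
      rw [linStem, denomStem, hsb, neg_sub, sub_mul, hbc]
      simp only [smul_mul_assoc, one_mul, smul_add, smul_smul]
      module
    have h3 : blaschkeStem b z - 1 = (Quaternion.normSq (denomStem b z))⁻¹ •
        ((-(1 - ‖b‖ : ℂ)) • (star (denomStem b z) * (1 + z • incl c))) := by
      have : blaschkeStem b z - 1 =
          ((Quaternion.normSq (denomStem b z))⁻¹ • star (denomStem b z)) *
            (-(linStem b z) * incl c) -
          ((Quaternion.normSq (denomStem b z))⁻¹ • star (denomStem b z)) * denomStem b z := by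
        rw [← h1, blaschkeStem_eq h]
      rw [this, ← mul_sub, h2, smul_mul_assoc, mul_smul_comm]
    have e1 : ‖star (denomStem b z)‖ ≤ 5 := by
      rw [star_denomStem]
      refine (norm_sub_le _ _).trans ?_
      rw [norm_one, norm_smul]
      nlinarith [norm_incl_le b, norm_nonneg z, norm_nonneg (incl b), norm_nonneg b]
    have e2 : ‖1 + z • incl c‖ ≤ 5 := by
      refine (norm_add_le _ _).trans ?_
      rw [norm_one, norm_smul]
      nlinarith [norm_incl_le c, norm_nonneg z, norm_nonneg (incl c)]
    have e3 : ‖(-(1 - ‖b‖ : ℂ))‖ = 1 - ‖b‖ := by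
      rw [norm_neg]
      have : (1 - ‖b‖ : ℂ) = ((1 - ‖b‖ : ℝ) : ℂ) := by push_cast; rfl
      rw [this, Complex.norm_real, Real.norm_eq_abs, abs_of_nonneg (by linarith)]
    have e4 := sq_one_sub_norm_le_normSq_denomStem hb hz'
    have hnb : 0 ≤ 1 - ‖b‖ := by linarith
    have e5 : ‖star (denomStem b z) * (1 + z • incl c)‖ ≤ 25 := by
      refine (norm_mul_le _ _).trans ?_
      nlinarith [norm_nonneg (star (denomStem b z)), norm_nonneg (1 + z • incl c)]
    rw [h3, norm_smul, norm_smul, norm_inv, e3, div_eq_inv_mul]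
    calc _ ≤ ((1 - ‖z‖) ^ 2)⁻¹ * ((1 - ‖b‖) * 25) := by gcongr
      _ = _ := by ring

/-- A stem function that vanishes at `b = x + yJ` is divisible by the Blaschke factor of `b`. -/
theorem exists_eq_blaschkeStem_mul {g : ℂ → ℍ[ℂ]} (hg : HolStem g) {x y : ℝ} (hy : 0 ≤ y)
    {J : ℍ[ℝ]} (hJ : J ∈ imUnits) (hb : (x : ℍ[ℝ]) + (y : ℍ[ℝ]) * J ∈ unitBall)
    (h0 : evJ J (g ⟨x, y⟩) = 0) :
    ∃ g', HolStem g' ∧ ∀ z ∈ Metric.ball (0 : ℂ) 1,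
      g z = blaschkeStem ((x : ℍ[ℝ]) + (y : ℍ[ℝ]) * J) z * g' z := by
  set b := (x : ℍ[ℝ]) + (y : ℍ[ℝ]) * J with hbdef
  have hC : toC b = ⟨x, y⟩ := toC_slice x y hJ hy
  have hz₀ : (⟨x, y⟩ : ℂ) ∈ Metric.ball (0 : ℂ) 1 := hC ▸ toC_mem hb
  have hlin : ∃ h, HolStem h ∧ ∀ z ∈ Metric.ball (0 : ℂ) 1, g z = linStem b z * h z := by
    rcases hy.eq_or_lt with rfl | hy
    -- At a real point J and -J give the same value, so g vanishes at two distinct units.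
    · have hgz : g ⟨x, 0⟩ = 0 := by
        have e1 := induced_slice hg.1 hJ x 0
        have e2 := induced_slice hg.1 (neg_mem_imUnits hJ) x 0
        simp only [Quaternion.coe_zero, zero_mul] at e1 e2
        refine eq_zero_of_evJ_two (J := J) (J' := -J) ?_ h0 (by rw [← e2, e1, h0])
        intro h
        have h2 : (2 : ℝ) • J = 0 := by
          rw [two_smul]
          nth_rewrite 2 [h]
          exact add_neg_cancel J
        exact imUnits_ne_zero hJ ((smul_eq_zero.1 h2).resolve_left two_ne_zero)
      obtain ⟨t, ht, hgt⟩ := hg.exists_eq_realFactor_smul hz₀ hgz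
      refine ⟨t, ht, fun z hz => ?_⟩
      have hx : (⟨x, 0⟩ : ℂ) = ((x : ℝ) : ℂ) := rfl
      rw [hgt z hz, realFactor, if_pos rfl, hbdef, linStem, hx]
      simp only [Quaternion.coe_zero, zero_mul, add_zero]
      rw [← smul_one_eq_incl, ← sub_smul, smul_mul_assoc, one_mul]
    · have hbim : b.im ≠ 0 := by
        intro h
        have := congrArg Complex.im hC
        simp [toC, h] at this
        exact hy.ne this
      -- A zero of g at b makes the conjugate linear factor times g vanish on the whole sphere.
      -- Dividing by the real factor gives t, and multiplying back by `linStem b` gives g = `linStem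
      -- b` times t.
      have hgz : star (linStem b ⟨x, y⟩) * g ⟨x, y⟩ = 0 := by
        have hα : reP (g ⟨x, y⟩) = -(J * imP (g ⟨x, y⟩)) := eq_neg_of_add_eq_zero_left h0
        have hr := (mem_imUnits.1 hJ).1
        have hs1 : reP (star (linStem b ⟨x, y⟩)) = (y : ℍ[ℝ]) * J := by
          apply Quaternion.ext <;> simp [hbdef, linStem, hr]
        have hs2 : imP (star (linStem b ⟨x, y⟩)) = (y : ℍ[ℝ]) := by
          apply Quaternion.ext <;> simp [hbdef, linStem, hr]
        generalize star (linStem b ⟨x, y⟩) = s at hs1 hs2 ⊢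
        generalize g ⟨x, y⟩ = t at hα ⊢
        have e1 : reP (s * t) = reP s * reP t - imP s * imP t := by
          apply Quaternion.ext <;> simp <;> ring
        have e2 : imP (s * t) = reP s * imP t + imP s * reP t := by
          apply Quaternion.ext <;> simp <;> ring
        refine eq_zero_of_reP_imP ?_ ?_
        · rw [e1, hs1, hs2, hα, mul_neg, mul_assoc, ← mul_assoc J J, imUnits_mul_self hJ]
          noncomm_ring
        · rw [e2, hs1, hs2, hα]
          noncomm_ring
      obtain ⟨t, ht, hgt⟩ := ((holStem_linStem b).star.mul hg).exists_eq_realFactor_smul hz₀ hgz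
      refine ⟨t, ht, ?_⟩
      obtain ⟨w, hw, hw0⟩ := exists_realFactor_ne_zero (⟨x, y⟩ : ℂ)
      refine eq_of_smul_eq_smul (holScalar_realFactor ⟨x, y⟩) hw hw0 hg
        ((holStem_linStem b).mul ht) fun z hz => ?_
      rw [← mul_smul_comm, ← hgt z hz, self_mul_star_smul, normSq_linStem_of_nonreal hbim, hC]
  obtain ⟨h, hh, hgh⟩ := hlin
  have hU := holStem_cofactorStem hb
  -- The quotient is h multiplied on the left by the inverse of the cofactor.
  refine ⟨fun z => (Quaternion.normSq (cofactorStem b z))⁻¹ • (star (cofactorStem b z) * h z),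
    HolStem.smul ⟨fun z => by simp only [hU.normSq.1 z, map_inv₀],
      hU.normSq.2.inv fun z hz => normSq_cofactorStem_ne_zero hb hz⟩ (hU.star.mul hh),
    fun z hz => ?_⟩
  rw [hgh z hz, blaschkeStem_eq_linStem_mul, mul_smul_comm, mul_assoc, self_mul_star_smul,
    mul_smul_comm, smul_smul, inv_mul_cancel₀ (normSq_cofactorStem_ne_zero hb hz), one_smul]

theorem conj_eq_slice {a J : ℍ[ℝ]} (haJ : a = (a.re : ℍ[ℝ]) + (‖a.im‖ : ℍ[ℝ]) * J) {w : ℍ[ℝ]}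
    (hw : w ≠ 0) : w⁻¹ * a * w = (a.re : ℍ[ℝ]) + (‖a.im‖ : ℍ[ℝ]) * (w⁻¹ * J * w) := by
  conv_lhs => rw [haJ]
  rw [mul_add, add_mul, ← Quaternion.coe_commutes, mul_assoc, inv_mul_cancel₀ hw, mul_one]
  congr 1
  rw [← mul_assoc, ← Quaternion.coe_commutes]
  noncomm_ring

/-- One step of the division of a regular function by Blaschke factors. -/
theorem exists_division_step {P g : ℂ → ℍ[ℂ]} (hP : IsStem P) (hg : HolStem g) {a : ℍ[ℝ]}
    (ha : a ∈ unitBall) (hPga : induced (fun z => P z * g z) a = 0)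
    (hga : Quaternion.normSq (g (toC a)) = 0) :
    ∃ (b : ℍ[ℝ]) (g' : ℂ → ℍ[ℂ]), HolStem g' ∧ (∃ w : ℍ[ℝ], w ≠ 0 ∧ b = w⁻¹ * a * w) ∧
      (∀ z ∈ Metric.ball (0 : ℂ) 1, g z = blaschkeStem b z * g' z) ∧
      (induced P a ≠ 0 → b = (induced P a)⁻¹ * a * induced P a) := by
  obtain ⟨J, hJ, haJ, -⟩ := exists_slice ha
  have hconj : ∀ {w : ℍ[ℝ]}, w ≠ 0 → w⁻¹ * a * w =
      (a.re : ℍ[ℝ]) + (‖a.im‖ : ℍ[ℝ]) * (w⁻¹ * J * w) := conj_eq_slice haJ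
  have key : ∀ {J' : ℍ[ℝ]}, J' ∈ imUnits → evJ J' (g (toC a)) = 0 → ∃ g', HolStem g' ∧
      ∀ z ∈ Metric.ball (0 : ℂ) 1,
        g z = blaschkeStem ((a.re : ℍ[ℝ]) + (‖a.im‖ : ℍ[ℝ]) * J') z * g' z := by
    intro J' hJ' h0
    refine exists_eq_blaschkeStem_mul hg (norm_nonneg _) hJ' ?_ h0
    rw [mem_unitBall, ← norm_toC, toC_slice _ _ hJ' (norm_nonneg _)]
    exact mem_ball_zero_iff.1 (toC_mem ha)
  have hPa : induced P a = evJ J (P (toC a)) := by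
    conv_lhs => rw [haJ]
    exact induced_slice hP hJ _ _
  by_cases hu : induced P a = 0
  -- Here P already accounts for the zero at a, so the zero of g on the sphere may be any point.
  · obtain ⟨J', hJ', h0⟩ := exists_evJ_eq_zero hga
    obtain ⟨w, hw, rfl⟩ := exists_conj_imUnits hJ hJ'
    obtain ⟨g', hg', hgg⟩ := key hJ' h0
    exact ⟨_, g', hg', ⟨w, hw, (hconj hw).symm⟩, hgg, fun h => absurd hu h⟩
  · have h1 : evJ J (P (toC a) * g (toC a)) = 0 := by
      rw [← hPga]
      conv_rhs => rw [haJ]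
      exact (induced_slice (hP.mul hg.1) hJ _ _).symm
    rw [evJ_mul_of_ne_zero hJ _ _ hPa hu] at h1
    -- By the product rule 0 = u · g(u⁻¹au) with u = P(a) ≠ 0.
    obtain ⟨g', hg', hgg⟩ := key (conj_mem_imUnits hJ hu) ((mul_eq_zero.1 h1).resolve_left hu)
    exact ⟨_, g', hg', ⟨_, hu, (hconj hu).symm⟩, hgg, fun _ => (hconj hu).symm⟩

/-! ### Orders of the symmetrization and counting of zeros -/

/-- The order of the symmetrization at `z₀`. -/
def ordDet (F : ℂ → ℍ[ℂ]) (z₀ : ℂ) : ℕ∞ := analyticOrderAt (fun z => Quaternion.normSq (F z)) z₀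

/-- The order of `normSq (q - p)` at the point `z₀` of `p`. -/
def wt (z₀ : ℂ) : ℕ∞ := if z₀.im = 0 then 2 else 1

theorem wt_ne_zero (z₀ : ℂ) : wt z₀ ≠ 0 := by unfold wt; split_ifs <;> simp

theorem wt_ne_top (z₀ : ℂ) : wt z₀ ≠ ⊤ := by
  unfold wt; split_ifs
  · exact ENat.natCast_ne_top 2
  · exact ENat.natCast_ne_top 1

theorem ordDet_congr {F G : ℂ → ℍ[ℂ]} {z₀ : ℂ} (hz₀ : z₀ ∈ Metric.ball (0 : ℂ) 1)
    (h : ∀ z ∈ Metric.ball (0 : ℂ) 1, F z = G z) : ordDet F z₀ = ordDet G z₀ := by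
  apply analyticOrderAt_congr
  filter_upwards [Metric.isOpen_ball.mem_nhds hz₀] with z hz
  rw [h z hz]

theorem ordDet_mul {s t : ℂ → ℍ[ℂ]} (hs : HolStem s) (ht : HolStem t) {z₀ : ℂ}
    (hz₀ : z₀ ∈ Metric.ball (0 : ℂ) 1) :
    ordDet (fun z => s z * t z) z₀ = ordDet s z₀ + ordDet t z₀ := by
  have := analyticOrderAt_mul (hs.normSq.analyticAt hz₀) (ht.normSq.analyticAt hz₀)
  rw [ordDet, ordDet, ordDet, ← this]
  congr 1
  funext z
  simp

theorem ordDet_eq_zero_iff {s : ℂ → ℍ[ℂ]} (hs : HolStem s) {z₀ : ℂ}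
    (hz₀ : z₀ ∈ Metric.ball (0 : ℂ) 1) : ordDet s z₀ = 0 ↔ Quaternion.normSq (s z₀) ≠ 0 :=
  (hs.normSq.analyticAt hz₀).analyticOrderAt_eq_zero

theorem analyticOrderAt_realFactor (z₀ : ℂ) : analyticOrderAt (realFactor z₀) z₀ = 1 := by
  by_cases h : z₀.im = 0
  · have : realFactor z₀ = fun z => z - z₀ := by funext z; rw [realFactor, if_pos h]
    rw [this]
    exact analyticOrderAt_id_sub_const_self
  · have h1 : realFactor z₀ = (fun z => z - z₀) * (fun z => z - starRingEnd ℂ z₀) := by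
      funext z; rw [realFactor, if_neg h]; rfl
    have hne : starRingEnd ℂ z₀ ≠ z₀ := fun h' => h (Complex.conj_eq_iff_im.1 h')
    rw [h1, analyticOrderAt_mul (by fun_prop) (by fun_prop)]
    have e1 : analyticOrderAt (fun z => z - z₀) z₀ = 1 := analyticOrderAt_id_sub_const_self
    have e2 : analyticOrderAt (fun z => z - starRingEnd ℂ z₀) z₀ = 0 := by
      rw [AnalyticAt.analyticOrderAt_eq_zero (by fun_prop)]
      exact sub_ne_zero.2 hne.symm
    rw [e1, e2, add_zero]

theorem StemFactor.ordDet_eq {F : ℂ → ℍ[ℂ]} {z₀ : ℂ} (hz₀ : z₀ ∈ Metric.ball (0 : ℂ) 1) {m : ℕ}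
    {ps : List ℍ[ℝ]} (hps : OnSphere z₀ ps) (h : StemFactor F z₀ m ps) :
    ordDet F z₀ = ((2 * m + ps.length : ℕ) : ℕ∞) := by
  obtain ⟨t, ht, ht0, hF⟩ := h
  have h1 : ordDet F z₀ =
      ordDet (fun z => (realFactor z₀ z ^ m • linProd ps z) * t z) z₀ :=
    ordDet_congr hz₀ fun z hz => by rw [hF z hz, smul_mul_assoc]
  rw [h1, ordDet_mul (holStem_factor z₀ m ps) ht hz₀, (ordDet_eq_zero_iff ht hz₀).2 ht0, add_zero,
    ordDet]
  have h2 : (fun z => Quaternion.normSq (realFactor z₀ z ^ m • linProd ps z)) =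
      realFactor z₀ ^ (2 * m + ps.length) := by
    funext z; exact normSq_factor m hps z
  rw [h2, analyticOrderAt_pow ((holScalar_realFactor z₀).analyticAt hz₀),
    analyticOrderAt_realFactor]
  simp

theorem analyticOrderAt_normSq_linStem (b : ℍ[ℝ]) {z₀ : ℂ} (him : 0 ≤ z₀.im) :
    ordDet (linStem b) z₀ = if toC b = z₀ then wt z₀ else 0 := by
  have h1 : (fun z => Quaternion.normSq (linStem b z)) =
      (fun z => z - toC b) * (fun z => z - starRingEnd ℂ (toC b)) := by
    funext z; exact normSq_linStem b z
  have e1 : ∀ w : ℂ, analyticOrderAt (fun z => z - w) w = 1 := fun w =>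
    analyticOrderAt_id_sub_const_self
  have e2 : ∀ w : ℂ, z₀ ≠ w → analyticOrderAt (fun z => z - w) z₀ = 0 := fun w hw => by
    rw [AnalyticAt.analyticOrderAt_eq_zero (by fun_prop)]
    exact sub_ne_zero.2 hw
  rw [ordDet, h1, analyticOrderAt_mul (by fun_prop) (by fun_prop)]
  split_ifs with h
  · rw [h, e1]
    by_cases hi : z₀.im = 0
    · rw [Complex.conj_eq_iff_im.2 hi, e1, wt, if_pos hi, one_add_one_eq_two]
    · rw [e2 _ fun h' => hi (Complex.conj_eq_iff_im.1 h'.symm), wt, if_neg hi, add_zero]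
  · rw [e2 _ (Ne.symm h), e2 _, add_zero]
    intro h'
    have hb : 0 ≤ (toC b).im := norm_nonneg _
    have h2 : z₀.im = -(toC b).im := by rw [h']; simp
    have h3 : (toC b).im = 0 := by linarith
    rw [Complex.conj_eq_iff_im.2 h3] at h'
    exact h h'.symm

theorem ordDet_blaschkeStem {b : ℍ[ℝ]} (hb : b ∈ unitBall) {z₀ : ℂ}
    (hz₀ : z₀ ∈ Metric.ball (0 : ℂ) 1) (him : 0 ≤ z₀.im) :
    ordDet (blaschkeStem b) z₀ = if toC b = z₀ then wt z₀ else 0 := by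
  rw [ordDet_congr hz₀ fun z _ => blaschkeStem_eq_linStem_mul b z,
    ordDet_mul (holStem_linStem b) (holStem_cofactorStem hb) hz₀,
    (ordDet_eq_zero_iff (holStem_cofactorStem hb) hz₀).2 (normSq_cofactorStem_ne_zero hb hz₀),
    add_zero, analyticOrderAt_normSq_linStem b him]

/-- A stem function of order less than two of the symmetrization does not vanish at the point. -/
theorem two_le_ordDet {s : ℂ → ℍ[ℂ]} (hs : HolStem s) {z₀ : ℂ}
    (hz₀ : z₀ ∈ Metric.ball (0 : ℂ) 1) (h : s z₀ = 0) : 2 ≤ ordDet s z₀ := by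
  obtain ⟨t, ht, hst⟩ := hs.exists_eq_realFactor_smul hz₀ h
  have h1 : ∀ z ∈ Metric.ball (0 : ℂ) 1, s z = (realFactor z₀ z ^ 1 • linProd [] z) * t z := by
    intro z hz
    rw [hst z hz, linProd, pow_one, smul_mul_assoc, one_mul]
  have h2 := StemFactor.ordDet_eq (F := fun z => realFactor z₀ z ^ 1 • linProd [] z) hz₀ (m := 1)
    (ps := []) (fun p hp => by simp at hp) ⟨fun _ => 1, holStem_one, by simp, fun z _ => by simp⟩
  rw [ordDet_congr hz₀ h1, ordDet_mul (holStem_factor z₀ 1 []) ht hz₀, h2]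
  exact le_self_add

theorem mem_ball_of_sq {x y : ℝ} (h : x ^ 2 + y ^ 2 < 1) :
    (⟨x, y⟩ : ℂ) ∈ Metric.ball (0 : ℂ) 1 := toC_mem_ball (p := (x, y)) h

theorem sq_of_mem_ball {x y : ℝ} (h : (⟨x, y⟩ : ℂ) ∈ Metric.ball (0 : ℂ) 1) :
    x ^ 2 + y ^ 2 < 1 := by
  rw [mem_ball_zero_iff, ← sq_lt_one_iff₀ (norm_nonneg _), ← Complex.normSq_eq_norm_sq,
    Complex.normSq_mk] at h
  nlinarith

theorem IsSphereFactorization.data {f : ℍ[ℝ] → ℍ[ℝ]} (hf : SliceRegular f) {x y : ℝ} (hy : 0 < y)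
    (hxy : (⟨x, y⟩ : ℂ) ∈ Metric.ball (0 : ℂ) 1) {m : ℕ} {ps : List ℍ[ℝ]}
    (h : IsSphereFactorization f x y m ps) :
    OnSphere ⟨x, y⟩ ps ∧ ps.IsChain (fun p p' => p ≠ star p') ∧
      StemFactor (stemOf f) ⟨x, y⟩ m ps := by
  obtain ⟨h1, h2, h3⟩ := (isSphereFactorization_iff hf hy hxy m ps).1 h
  exact ⟨fun p hp => ⟨(mem_sphereOf_iff hy.le).1 (h1 p hp), hy.ne'⟩, h2, h3⟩

open Classical in
/-- The isolated multiplicities on a sphere, read off from one factorization. -/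
theorem HasIsolatedMultiplicity.eq_of_factor {f : ℍ[ℝ] → ℍ[ℝ]} (hf : SliceRegular f) {x y : ℝ}
    (hy : 0 < y) (hxy : (⟨x, y⟩ : ℂ) ∈ Metric.ball (0 : ℂ) 1) {m : ℕ} {ps : List ℍ[ℝ]}
    (h : IsSphereFactorization f x y m ps) {q : ℍ[ℝ]} (hq : toC q = ⟨x, y⟩) {k : ℕ}
    (hk : HasIsolatedMultiplicity f q k) :
    k = if ps.head? = some q then ps.length else 0 := by
  have h1 : q.re = x := congrArg Complex.re hq
  have h2 : ‖q.im‖ = y := congrArg Complex.im hq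
  have h3 : q.im ≠ 0 := fun h => by rw [h, norm_zero] at h2; exact hy.ne h2
  rw [HasIsolatedMultiplicity, if_neg h3, h1, h2] at hk
  obtain ⟨m', ps', hfac, hk⟩ := hk
  obtain ⟨a1, a2, a3⟩ := h.data hf hy hxy
  obtain ⟨b1, b2, b3⟩ := hfac.data hf hy hxy
  obtain ⟨-, hl, hh⟩ := a3.unique hy hxy a1 b1 a2 b2 b3
  rw [hk, hl, hh]

theorem encard_fiber_biUnion {S : Set ℕ} (a : ℕ → ℍ[ℝ]) (E : Finset ℍ[ℝ]) :
    {n | n ∈ S ∧ a n ∈ E}.encard = ∑ q ∈ E, {n | n ∈ S ∧ a n = q}.encard := by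
  classical
  induction E using Finset.induction_on with
  | empty => simp
  | insert q E hq ih =>
    rw [Finset.sum_insert hq, ← ih, ← Set.encard_union_eq]
    · congr 1
      ext n
      simp only [Set.mem_ofPred_eq, Set.mem_union, Finset.mem_insert]
      tauto
    · rw [Set.disjoint_left]
      rintro n ⟨_, h1⟩ ⟨_, h2⟩
      exact hq (h1 ▸ h2)

open Classical in
/-- The data of a zero sequence on a sphere. -/
theorem IsZeroSequence.sphere_data {f : ℍ[ℝ] → ℍ[ℝ]} (hf : SliceRegular f) {N : ℕ∞}
    {a : ℕ → ℍ[ℝ]} (ha : IsZeroSequence f N a) {x y : ℝ} (hy : 0 < y)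
    (hxy : (⟨x, y⟩ : ℂ) ∈ Metric.ball (0 : ℂ) 1) :
    ∃ (m : ℕ) (ps : List ℍ[ℝ]), IsSphereFactorization f x y m ps ∧
      (∃ c, toC c = ⟨x, y⟩ ∧ ∀ q, toC q = ⟨x, y⟩ →
        {n : ℕ | (n : ℕ∞) < N ∧ a n = q}.encard = (((if q = c ∨ q = star c then m else 0) +
          (if ps.head? = some q then ps.length else 0) : ℕ) : ℕ∞)) ∧
      ∀ l : ℕ, (l : ℕ∞) < N → toC (a l) = ⟨x, y⟩ → (∀ j : ℕ, l = j + 1 → toC (a j) ≠ ⟨x, y⟩) →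
        ∀ k < m, ((l + 2 * k + 1 : ℕ) : ℕ∞) < N ∧
          a (l + 2 * k) = a l ∧ a (l + 2 * k + 1) = star (a l) := by
  obtain ⟨m, ⟨m', ps, hfac, hm⟩, ⟨c, hc, hcnt⟩, hent⟩ := ha.2.2 x y hy (sq_of_mem_ball hxy)
  obtain rfl : m = m' := by omega
  refine ⟨m, ps, hfac, ⟨c, (mem_sphereOf_iff hy.le).1 hc, fun q hq => ?_⟩, ?_⟩
  · obtain ⟨k, hk, hcard⟩ := hcnt q ((mem_sphereOf_iff hy.le).2 hq)
    have := hk.eq_of_factor hf hy hxy hfac hq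
    rw [hcard, this]
  · simpa only [mem_sphereOf_iff hy.le] using hent

theorem star_ne_self {c : ℍ[ℝ]} (h : (toC c).im ≠ 0) : c ≠ star c := by
  intro hc
  apply h
  rw [toC_real_iff]
  have h1 := congrArg (fun q : ℍ[ℝ] => q.imI) hc
  have h2 := congrArg (fun q : ℍ[ℝ] => q.imJ) hc
  have h3 := congrArg (fun q : ℍ[ℝ] => q.imK) hc
  simp only [Quaternion.imI_star, Quaternion.imJ_star, Quaternion.imK_star] at h1 h2 h3
  apply Quaternion.ext
  · simp
  · simp; linarith
  · simp; linarith
  · simp; linarith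

theorem toC_star (c : ℍ[ℝ]) : toC (star c) = toC c := by
  simp [toC]

/-- The zero sequence meets the sphere of `z₀` as often as the order of the symmetrization says. -/
theorem IsZeroSequence.ordDet_eq {f : ℍ[ℝ] → ℍ[ℝ]} (hf : SliceRegular f) {N : ℕ∞}
    {a : ℕ → ℍ[ℝ]} (ha : IsZeroSequence f N a) {z₀ : ℂ} (hz₀ : z₀ ∈ Metric.ball (0 : ℂ) 1)
    (him : 0 ≤ z₀.im) :
    {n : ℕ | (n : ℕ∞) < N ∧ toC (a n) = z₀}.Finite ∧
      ordDet (stemOf f) z₀ = {n : ℕ | (n : ℕ∞) < N ∧ toC (a n) = z₀}.encard * wt z₀ := by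
  classical
  rcases him.eq_or_lt with h0 | hy
  · have hz : z₀ = ((z₀.re : ℝ) : ℂ) := by apply Complex.ext <;> simp [← h0]
    have hC : toC ((z₀.re : ℝ) : ℍ[ℝ]) = z₀ := by
      rw [hz]; apply Complex.ext <;> simp [toC]
    have hb : ((z₀.re : ℝ) : ℍ[ℝ]) ∈ unitBall := by
      rw [mem_unitBall, ← norm_toC, hC]; exact mem_ball_zero_iff.1 hz₀
    obtain ⟨k, hk, hcard⟩ := ha.2.1 z₀.re hb
    rw [hasIsolatedMultiplicity_real_iff hf (by simp) hb, hC] at hk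
    have hset : {n : ℕ | (n : ℕ∞) < N ∧ toC (a n) = z₀} =
        {n : ℕ | (n : ℕ∞) < N ∧ a n = ((z₀.re : ℝ) : ℍ[ℝ])} := by
      ext n
      simp only [Set.mem_ofPred_eq, and_congr_right_iff]
      intro _
      constructor
      · intro h
        have h1 : (a n).im = 0 := by rw [← toC_real_iff, h, ← h0]
        have h2 : (a n).re = z₀.re := congrArg Complex.re h
        rw [← h2]
        conv_lhs => rw [← Quaternion.re_add_im (a n), h1, add_zero]
      · intro h
        rw [h, hC]
    rw [hset, hcard, hk.ordDet_eq hz₀ (fun p hp => by simp at hp), wt, if_pos h0.symm]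
    refine ⟨Set.encard_ne_top_iff.1 (by rw [hcard]; exact ENat.natCast_ne_top _), ?_⟩
    push_cast
    simp [mul_comm]
  · obtain ⟨m, ps, hfac, ⟨c, hc, hcnt⟩, -⟩ := ha.sphere_data hf (x := z₀.re) hy hz₀
    obtain ⟨a1, a2, a3⟩ := hfac.data hf hy hz₀
    have hcs : c ≠ star c := star_ne_self (by rw [hc]; exact hy.ne')
    -- The only points of the sphere that can occur in the sequence. The pair c, `star c`
    -- contributes m terms each and the first linear factor contributes the length of the list, in
    -- total the order of the symmetrization.
    set E : Finset ℍ[ℝ] := {c, star c} ∪ ps.head?.toFinset with hE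
    have hEz : ∀ q ∈ E, toC q = z₀ := by
      intro q hq
      rw [hE, Finset.mem_union, Finset.mem_insert, Finset.mem_singleton, Option.mem_toFinset] at hq
      rcases hq with (rfl | rfl) | hq
      · exact hc
      · rw [toC_star]; exact hc
      · exact (a1 q (List.mem_of_mem_head? hq)).1
    have hset : {n : ℕ | (n : ℕ∞) < N ∧ toC (a n) = z₀} =
        {n | n ∈ {n : ℕ | (n : ℕ∞) < N} ∧ a n ∈ E} := by
      ext n
      simp only [Set.mem_ofPred_eq, and_congr_right_iff]
      intro hn
      refine ⟨fun h => ?_, fun h => hEz _ h⟩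
      have hcn := hcnt (a n) h
      by_contra hnE
      rw [hE, Finset.mem_union, Finset.mem_insert, Finset.mem_singleton, Option.mem_toFinset,
        not_or] at hnE
      rw [if_neg hnE.1, if_neg (by simpa using hnE.2)] at hcn
      simp only [add_zero, Nat.cast_zero, Set.encard_eq_zero] at hcn
      exact Set.notMem_empty n (hcn ▸ ⟨hn, rfl⟩)
    have hsum : ∑ q ∈ E, ((if q = c ∨ q = star c then m else 0) +
        (if ps.head? = some q then ps.length else 0)) = 2 * m + ps.length := by
      rw [Finset.sum_add_distrib]
      congr 1
      · rw [← Finset.sum_filter, Finset.sum_const]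
        have : E.filter (fun q => q = c ∨ q = star c) = {c, star c} := by
          ext q
          simp only [hE, Finset.mem_filter, Finset.mem_union, Finset.mem_insert,
            Finset.mem_singleton]
          tauto
        rw [this, Finset.card_pair hcs, smul_eq_mul]
      · cases ps with
        | nil => simp
        | cons p ps =>
          simp only [List.head?_cons, Option.some.injEq]
          rw [Finset.sum_ite_eq, if_pos]
          simp [hE]
    have hcard : {n : ℕ | (n : ℕ∞) < N ∧ toC (a n) = z₀}.encard =
        ((2 * m + ps.length : ℕ) : ℕ∞) := by
      rw [hset, encard_fiber_biUnion, ← hsum, Nat.cast_sum]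
      exact Finset.sum_congr rfl fun q hq => hcnt q (hEz q hq)
    refine ⟨Set.encard_ne_top_iff.1 (by rw [hcard]; exact ENat.natCast_ne_top _), ?_⟩
    rw [hcard, wt, if_neg hy.ne', mul_one]
    exact a3.ordDet_eq hz₀ a1

/-! ### The Blaschke condition -/

/-- The estimate of the logarithm works with any positive finite exponent, so p = ∞ is absorbed by
taking s = 1. -/
theorem MemHardy.exists_integral_le {p : ℝ≥0∞} (hp : 0 < p) {f : ℍ[ℝ] → ℍ[ℝ]}
    (hf : MemHardy p f) :
    ∃ s : ℝ, 0 < s ∧ ∀ I ∈ imUnits, ∃ K : ℝ, ∀ᶠ r : ℝ in 𝓝[<] (1 : ℝ),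
      ∫ θ in (0 : ℝ)..2 * Real.pi,
        ‖f ((r : ℍ[ℝ]) * ((Real.cos θ : ℍ[ℝ]) + (Real.sin θ : ℍ[ℝ]) * I))‖ ^ s ≤ K := by
  have hnorm := hf.2
  by_cases hpt : p = ∞
  · refine ⟨1, one_pos, fun I hI => ?_⟩
    rw [hardyNorm, if_pos hpt] at hnorm
    set M := ⨆ q ∈ unitBall, ‖f q‖ₑ with hM
    have hle : ∀ q ∈ unitBall, ‖f q‖ ≤ M.toReal := by
      intro q hq
      have h1 : ‖f q‖ₑ ≤ M := le_iSup₂ (f := fun q (_ : q ∈ unitBall) => ‖f q‖ₑ) q hq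
      have := ENNReal.toReal_mono hnorm.ne h1
      simpa using this
    refine ⟨M.toReal * |2 * Real.pi - 0|, ?_⟩
    have h0 : ∀ᶠ r in 𝓝[<] (1 : ℝ), r ∈ Set.Ioo (0 : ℝ) 1 := Ioo_mem_nhdsLT zero_lt_one
    filter_upwards [h0] with r hr
    refine (le_abs_self _).trans ?_
    rw [← Real.norm_eq_abs]
    refine intervalIntegral.norm_integral_le_of_norm_le_const fun θ _ => ?_
    rw [Real.rpow_one, norm_norm]
    apply hle
    have e : (r : ℍ[ℝ]) * ((Real.cos θ : ℍ[ℝ]) + (Real.sin θ : ℍ[ℝ]) * I) =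
        ((r * Real.cos θ : ℝ) : ℍ[ℝ]) + ((r * Real.sin θ : ℝ) : ℍ[ℝ]) * I := by
      push_cast; noncomm_ring
    rw [e, mem_unitBall, ← norm_toC, toC, re_slice _ _ hI, norm_im_slice _ _ hI]
    refine mem_ball_zero_iff.1 (mem_ball_of_sq ?_)
    rw [sq_abs]
    have := Real.sin_sq_add_cos_sq θ
    have h2 : r ^ 2 < 1 := by nlinarith [hr.1, hr.2]
    calc (r * Real.cos θ) ^ 2 + (r * Real.sin θ) ^ 2
        = r ^ 2 * (Real.sin θ ^ 2 + Real.cos θ ^ 2) := by ring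
      _ < 1 := by rw [this, mul_one]; exact h2
  · have hs : 0 < p.toReal := ENNReal.toReal_pos hp.ne' hpt
    refine ⟨p.toReal, hs, fun I hI => ?_⟩
    rw [hardyNorm, if_neg hpt] at hnorm
    have h1 : limsup (fun r : ℝ => integralMean p.toReal f I r) (𝓝[<] (1 : ℝ)) < ∞ :=
      lt_of_le_of_lt (le_iSup₂ (f := fun I (_ : I ∈ imUnits) =>
        limsup (fun r : ℝ => integralMean p.toReal f I r) (𝓝[<] (1 : ℝ))) I hI) hnorm
    obtain ⟨C, hC1, hC2⟩ := exists_between h1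
    have h2 := eventually_lt_of_limsup_lt hC1
    set s := p.toReal
    set c := ENNReal.ofReal (1 / (2 * Real.pi)) with hc
    have hc0 : c ≠ 0 := by
      rw [hc, ne_eq, ENNReal.ofReal_eq_zero, not_le]; positivity
    have hct : c ≠ ∞ := ENNReal.ofReal_ne_top
    have hKt : C ^ s / c ≠ ∞ := ENNReal.div_ne_top (ENNReal.rpow_ne_top_of_nonneg hs.le hC2.ne) hc0
    refine ⟨(C ^ s / c).toReal, ?_⟩
    filter_upwards [h2] with r hr
    rw [integralMean, one_div s] at hr
    have h3 := (ENNReal.rpow_inv_le_iff hs).1 hr.le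
    rw [mul_comm, ← ENNReal.le_div_iff_mul_le (Or.inl hc0) (Or.inl hct)] at h3
    rw [intervalIntegral.integral_of_le (by positivity)]
    have h4 := enorm_integral_le_lintegral_enorm (μ := volume.restrict (Set.Ioc 0 (2 * Real.pi)))
      (fun θ : ℝ => ‖f ((r : ℍ[ℝ]) * ((Real.cos θ : ℍ[ℝ]) + (Real.sin θ : ℍ[ℝ]) * I))‖ ^ s)
    have h5 : ∀ θ : ℝ,
        ‖‖f ((r : ℍ[ℝ]) * ((Real.cos θ : ℍ[ℝ]) + (Real.sin θ : ℍ[ℝ]) * I))‖ ^ s‖ₑ =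
        ‖f ((r : ℍ[ℝ]) * ((Real.cos θ : ℍ[ℝ]) + (Real.sin θ : ℍ[ℝ]) * I))‖ₑ ^ s := by
      intro θ
      rw [Real.enorm_rpow_of_nonneg (norm_nonneg _) hs.le, enorm_norm]
    simp only [h5] at h4
    have h6 := ENNReal.toReal_mono hKt (h4.trans h3)
    rw [toReal_enorm] at h6
    exact (le_abs_self _).trans h6

theorem normSq_stemSplit (A B : ℂ → ℂ) (z : ℂ) : Quaternion.normSq (stemSplit A B z) =
    A z * starRingEnd ℂ (A (starRingEnd ℂ z)) + B z * starRingEnd ℂ (B (starRingEnd ℂ z)) := by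
  rw [Quaternion.normSq_def', stemSplit]
  simp only [re_qmk, imI_qmk, imJ_qmk, imK_qmk]
  generalize starRingEnd ℂ (A (starRingEnd ℂ z)) = A'
  generalize starRingEnd ℂ (B (starRingEnd ℂ z)) = B'
  linear_combination ((1 / 4) * (A' - A z) ^ 2 + (1 / 4) * (B' - B z) ^ 2) * Complex.I_sq

/-- The symmetrization pairs the splitting components at z with those at z̄, so this is
Cauchy–Schwarz in ℂ². -/
theorem norm_normSq_stemOf_le (f : ℍ[ℝ] → ℍ[ℝ]) (z : ℂ) :
    ‖Quaternion.normSq (stemOf f z)‖ ≤ ‖f (z : ℍ[ℝ])‖ * ‖f ((starRingEnd ℂ z : ℂ) : ℍ[ℝ])‖ := by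
  have key : ∀ w : ℂ, ‖f (w : ℍ[ℝ])‖ ^ 2 = ‖splitF f w‖ ^ 2 + ‖splitG f w‖ ^ 2 := by
    intro w
    rw [pow_two ‖f _‖, ← Quaternion.normSq_eq_norm_mul_self, Quaternion.normSq_def',
      ← Complex.normSq_eq_norm_sq, ← Complex.normSq_eq_norm_sq, splitF, splitG, Complex.normSq_mk,
      Complex.normSq_mk]
    ring
  have h1 := key z
  have h2 := key (starRingEnd ℂ z)
  rw [stemOf, normSq_stemSplit]
  refine (norm_add_le _ _).trans ?_
  rw [norm_mul, norm_mul, RCLike.norm_conj, RCLike.norm_conj]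
  apply abs_le_of_sq_le_sq' _ (by positivity) |>.2
  rw [mul_pow, h1, h2]
  nlinarith [sq_nonneg (‖splitF f z‖ * ‖splitG f (starRingEnd ℂ z)‖ -
    ‖splitG f z‖ * ‖splitF f (starRingEnd ℂ z)‖)]

theorem log_mul_le_rpow {s : ℝ} (hs : 0 < s) {u a b : ℝ} (ha : 0 ≤ a) (hb : 0 ≤ b) (hu0 : 0 ≤ u)
    (hu : u ≤ a * b) : Real.log u ≤ (a ^ s + b ^ s) / s := by
  have hnn : 0 ≤ (a ^ s + b ^ s) / s := by positivity
  rcases hu0.eq_or_lt with rfl | hpos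
  · simpa using hnn
  · have hab : a * b ≠ 0 := by linarith
    have ha' : a ≠ 0 := left_ne_zero_of_mul hab
    have hb' : b ≠ 0 := right_ne_zero_of_mul hab
    calc Real.log u ≤ Real.log (a * b) := Real.log_le_log hpos hu
      _ = Real.log a + Real.log b := Real.log_mul ha' hb'
      _ ≤ a ^ s / s + b ^ s / s := add_le_add (Real.log_le_rpow_div ha hs) (Real.log_le_rpow_div hb hs)
      _ = _ := by ring

theorem SliceRegular.continuousOn_slice {f : ℍ[ℝ] → ℍ[ℝ]} (hf : SliceRegular f) :
    ContinuousOn (fun z : ℂ => f (z : ℍ[ℝ])) (Metric.ball 0 1) := by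
  have h1 := (hf unitI unitI_mem).1.continuousOn
  have h2 : ContinuousOn (fun z : ℂ => ((z.re, z.im) : ℝ × ℝ)) (Metric.ball 0 1) := by fun_prop
  refine (h1.comp h2 fun z hz => ?_).congr fun z _ => ?_
  · exact sq_of_mem_ball (x := z.re) (y := z.im) hz
  · rw [coeComplex_eq]; rfl

theorem coe_circleMap (r θ : ℝ) : ((circleMap 0 r θ : ℂ) : ℍ[ℝ]) =
    (r : ℍ[ℝ]) * ((Real.cos θ : ℍ[ℝ]) + (Real.sin θ : ℍ[ℝ]) * unitI) := by
  rw [circleMap_zero, Complex.exp_mul_I]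
  apply Quaternion.ext <;> simp [show unitI = qmk 0 1 0 0 from rfl, Complex.cos_ofReal_re, Complex.sin_ofReal_re]

theorem coe_conj_circleMap (r θ : ℝ) : ((starRingEnd ℂ (circleMap 0 r θ) : ℂ) : ℍ[ℝ]) =
    (r : ℍ[ℝ]) * ((Real.cos θ : ℍ[ℝ]) + (Real.sin θ : ℍ[ℝ]) * (-unitI)) := by
  rw [circleMap_zero, Complex.exp_mul_I]
  apply Quaternion.ext <;> simp [show unitI = qmk 0 1 0 0 from rfl, Complex.cos_ofReal_re, Complex.sin_ofReal_re]

theorem MemHardy.exists_circleAverage_log_le {p : ℝ≥0∞} (hp : 0 < p) {f : ℍ[ℝ] → ℍ[ℝ]}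
    (hf : MemHardy p f) :
    ∃ C : ℝ, ∀ᶠ r in 𝓝[<] (1 : ℝ),
      Real.circleAverage (fun z => Real.log ‖Quaternion.normSq (stemOf f z)‖) 0 r ≤ C := by
  obtain ⟨s, hs, hint⟩ := hf.exists_integral_le hp
  obtain ⟨K₁, hK₁⟩ := hint unitI unitI_mem
  -- The bound for the symmetrization involves f at z and at z̄; the conjugate circle is
  -- parametrized by the unit -i.
  obtain ⟨K₂, hK₂⟩ := hint (-unitI) (neg_mem_imUnits unitI_mem)
  refine ⟨(2 * Real.pi)⁻¹ * ((K₁ + K₂) / s), ?_⟩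
  have h0 : ∀ᶠ r in 𝓝[<] (1 : ℝ), r ∈ Set.Ioo (0 : ℝ) 1 := Ioo_mem_nhdsLT zero_lt_one
  filter_upwards [hK₁, hK₂, h0] with r h1 h2 hr
  have hball : ∀ θ, circleMap 0 r θ ∈ Metric.ball (0 : ℂ) 1 := by
    intro θ
    rw [mem_ball_zero_iff, norm_circleMap_zero, abs_of_pos hr.1]
    exact hr.2
  have hcont1 : Continuous fun θ : ℝ => ‖f ((circleMap 0 r θ : ℂ) : ℍ[ℝ])‖ ^ s :=
    ((hf.1.continuousOn_slice.comp_continuous (continuous_circleMap 0 r) hball).norm).rpow_const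
      fun _ => Or.inr hs.le
  have hcont2 : Continuous fun θ : ℝ =>
      ‖f ((starRingEnd ℂ (circleMap 0 r θ) : ℂ) : ℍ[ℝ])‖ ^ s :=
    ((hf.1.continuousOn_slice.comp_continuous
      (Complex.continuous_conj.comp (continuous_circleMap 0 r))
      fun θ => by simpa using hball θ).norm).rpow_const fun _ => Or.inr hs.le
  set g : ℂ → ℝ := fun z => (‖f (z : ℍ[ℝ])‖ ^ s + ‖f ((starRingEnd ℂ z : ℂ) : ℍ[ℝ])‖ ^ s) / s
    with hg
  have hgc : Continuous fun θ : ℝ => g (circleMap 0 r θ) := (hcont1.add hcont2).div_const s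
  have hsub : Metric.sphere (0 : ℂ) |r| ⊆ Metric.ball 0 1 := by
    intro z hz
    rw [mem_sphere_zero_iff_norm, abs_of_pos hr.1] at hz
    rw [mem_ball_zero_iff, hz]
    exact hr.2
  have hlog : CircleIntegrable (fun z => Real.log ‖Quaternion.normSq (stemOf f z)‖) 0 r :=
    MeromorphicOn.circleIntegrable_log_norm fun z hz =>
      (hf.1.holStem.normSq.analyticAt (hsub hz)).meromorphicAt
  have hgi : CircleIntegrable g 0 r := hgc.intervalIntegrable _ _
  refine (Real.circleAverage_mono hlog hgi fun z hz => ?_).trans ?_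
  · exact log_mul_le_rpow hs (norm_nonneg _) (norm_nonneg _) (norm_nonneg _)
      (norm_normSq_stemOf_le f z)
  · rw [Real.circleAverage_def, smul_eq_mul]
    refine mul_le_mul_of_nonneg_left ?_ (by positivity)
    simp only [hg]
    rw [intervalIntegral.integral_div, intervalIntegral.integral_add
      (hcont1.intervalIntegrable _ _) (hcont2.intervalIntegrable _ _)]
    simp only [coe_circleMap, coe_conj_circleMap]
    gcongr

/-- Jensen's formula bounds the weighted sums over the zeros. -/
theorem exists_sum_divisor_le {h : ℂ → ℂ} (hh : AnalyticOnNhd ℂ h (Metric.ball 0 1))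
    (hfin : ∀ z ∈ Metric.ball (0 : ℂ) 1, analyticOrderAt h z ≠ ⊤) {C : ℝ}
    (hC : ∀ᶠ r in 𝓝[<] (1 : ℝ), Real.circleAverage (fun z => Real.log ‖h z‖) 0 r ≤ C) :
    ∃ C' : ℝ, ∀ᶠ r in 𝓝[<] (1 : ℝ), ∀ E : Finset ℂ, (∀ u ∈ E, u ≠ 0 ∧ ‖u‖ < r) →
      ∑ u ∈ E, (analyticOrderNatAt h u : ℝ) * (r - ‖u‖) ≤ C' := by
  -- Jensen's formula contains the order at 0 times log r and the logarithm of the trailing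
  -- coefficient. For r > 1/2 one has log r ≥ -log 2, which removes the dependence on r.
  refine ⟨C + analyticOrderNatAt h 0 * Real.log 2 - Real.log ‖meromorphicTrailingCoeffAt h 0‖, ?_⟩
  have h0 : ∀ᶠ r in 𝓝[<] (1 : ℝ), r ∈ Set.Ioo (1 / 2 : ℝ) 1 := Ioo_mem_nhdsLT (by norm_num)
  filter_upwards [hC, h0] with r hr hr01 E hE
  have hr0 : 0 < r := by linarith [hr01.1]
  have habs : |r| = r := abs_of_pos hr0
  have hsub : Metric.closedBall (0 : ℂ) |r| ⊆ Metric.ball 0 1 := by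
    intro z hz
    rw [mem_closedBall_zero_iff, habs] at hz
    rw [mem_ball_zero_iff]
    linarith [hr01.2]
  have han : AnalyticOnNhd ℂ h (Metric.closedBall 0 |r|) := hh.mono hsub
  have hdiv : ∀ z ∈ Metric.closedBall (0 : ℂ) |r|,
      MeromorphicOn.divisor h (Metric.closedBall 0 |r|) z = (analyticOrderNatAt h z : ℤ) := by
    intro z hz
    rw [MeromorphicOn.AnalyticOnNhd.divisor_apply han hz]
    rw [← Nat.cast_analyticOrderNatAt (hfin z (hsub hz))]
    rfl
  have hdiv0 : ∀ z ∉ Metric.closedBall (0 : ℂ) |r|,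
      MeromorphicOn.divisor h (Metric.closedBall 0 |r|) z = 0 := fun z hz =>
    Function.locallyFinsuppWithin.apply_eq_zero_of_notMem _ hz
  have hJ := MeromorphicOn.circleAverage_log_norm hr0.ne' han.meromorphicOn
  rw [hJ, hdiv 0 (by simp)] at hr
  have hlog2 : -Real.log 2 ≤ Real.log r := by
    rw [← Real.log_inv]
    exact Real.log_le_log (by norm_num) (by linarith [hr01.1])
  have hterm : ∀ u, 0 ≤ (MeromorphicOn.divisor h (Metric.closedBall 0 |r|) u : ℝ) *
      Real.log (r * ‖0 - u‖⁻¹) := by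
    intro u
    by_cases hu : u ∈ Metric.closedBall (0 : ℂ) |r|
    · rw [hdiv u hu]
      refine mul_nonneg (by positivity) ?_
      rw [zero_sub, norm_neg]
      rcases eq_or_ne u 0 with rfl | hu0
      · simp
      · apply Real.log_nonneg
        rw [mem_closedBall_zero_iff, habs] at hu
        rw [← div_eq_mul_inv, one_le_div (norm_pos_iff.2 hu0)]
        exact hu
    · rw [hdiv0 u hu]; simp
  have hfs := (MeromorphicOn.divisor h (Metric.closedBall 0 |r|)).finiteSupport
    (isCompact_closedBall 0 |r|)
  have hsum : ∑ u ∈ E, (analyticOrderNatAt h u : ℝ) * (r - ‖u‖) ≤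
      ∑ᶠ u, (MeromorphicOn.divisor h (Metric.closedBall 0 |r|) u : ℝ) *
        Real.log (r * ‖0 - u‖⁻¹) := by
    rw [finsum_eq_sum_of_support_subset (s := E ∪ hfs.toFinset)]
    · calc ∑ u ∈ E, (analyticOrderNatAt h u : ℝ) * (r - ‖u‖)
          ≤ ∑ u ∈ E, (MeromorphicOn.divisor h (Metric.closedBall 0 |r|) u : ℝ) *
            Real.log (r * ‖0 - u‖⁻¹) := by
            refine Finset.sum_le_sum fun u hu => ?_
            obtain ⟨hu0, hur⟩ := hE u hu
            have hup : 0 < ‖u‖ := norm_pos_iff.2 hu0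
            rw [hdiv u (by rw [mem_closedBall_zero_iff, habs]; exact hur.le)]
            push_cast
            refine mul_le_mul_of_nonneg_left ?_ (by positivity)
            rw [zero_sub, norm_neg]
            -- This gives log(r/|u|) ≥ 1 - |u|/r = (r - |u|)/r ≥ r - |u|, as r < 1.
            have h1 := Real.one_sub_inv_le_log_of_pos (x := r * ‖u‖⁻¹) (by positivity)
            refine le_trans ?_ h1
            rw [mul_inv, inv_inv]
            have h2 : 1 - r⁻¹ * ‖u‖ = (r - ‖u‖) / r := by field_simp
            rw [h2, le_div_iff₀ hr0]
            nlinarith [hr01.2]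
        _ ≤ _ := Finset.sum_le_sum_of_subset_of_nonneg Finset.subset_union_left
            fun u _ _ => hterm u
    · intro u hu
      simp only [Finset.coe_union, Set.mem_union, Finset.mem_coe, Set.Finite.mem_toFinset]
      right
      rw [Function.mem_support] at hu ⊢
      intro h'
      apply hu
      rw [h']; simp
  have hD : (0 : ℝ) ≤ analyticOrderNatAt h 0 := by positivity
  push_cast at hr
  nlinarith

/-- The order at 0 is a finite count times the weight, and on a connected set finite order at one
point gives finite order everywhere. -/
theorem IsZeroSequence.ordDet_ne_top {f : ℍ[ℝ] → ℍ[ℝ]} (hf : SliceRegular f) {N : ℕ∞}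
    {a : ℕ → ℍ[ℝ]} (ha : IsZeroSequence f N a) {z : ℂ} (hz : z ∈ Metric.ball (0 : ℂ) 1) :
    ordDet (stemOf f) z ≠ ⊤ := by
  have h0 : ordDet (stemOf f) 0 ≠ ⊤ := by
    obtain ⟨h1, h2⟩ := ha.ordDet_eq hf (z₀ := 0) (by simp) le_rfl
    rw [h2]
    exact WithTop.mul_ne_top (Set.encard_ne_top_iff.2 h1) (wt_ne_top 0)
  exact AnalyticOnNhd.analyticOrderAt_ne_top_of_isPreconnected
    (hf.holStem.normSq.2.analyticOnNhd Metric.isOpen_ball)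
    (convex_ball (0 : ℂ) 1).isPreconnected (by simp) hz h0

open Classical in
/-- The Blaschke condition. -/
theorem IsZeroSequence.summable {p : ℝ≥0∞} (hp : 0 < p) {f : ℍ[ℝ] → ℍ[ℝ]} (hf : MemHardy p f)
    {N : ℕ∞} {a : ℕ → ℍ[ℝ]} (ha : IsZeroSequence f N a) :
    Summable fun n : ℕ => if (n : ℕ∞) < N then 1 - ‖a n‖ else 0 := by
  obtain ⟨C, hC⟩ := hf.exists_circleAverage_log_le hp
  have hfin := fun z hz => ha.ordDet_ne_top hf.1 (z := z) hz
  obtain ⟨C', hC'⟩ := exists_sum_divisor_le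
    (hf.1.holStem.normSq.2.analyticOnNhd Metric.isOpen_ball) hfin hC
  -- Terms equal to 0 are set aside, since Jensen's formula treats the origin separately; there are
  -- finitely many of them.
  have h1 : Summable fun n : ℕ => if (n : ℕ∞) < N ∧ a n ≠ 0 then 1 - ‖a n‖ else 0 := by
    have hnn : ∀ n : ℕ, 0 ≤ if (n : ℕ∞) < N ∧ a n ≠ 0 then 1 - ‖a n‖ else 0 := by
      intro n
      split_ifs with h
      · have := mem_unitBall.1 (ha.1 n h.1).1
        linarith
      · exact le_rfl
    refine summable_of_sum_le hnn (c := C') fun T => ?_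
    rw [← Finset.sum_filter]
    set T' := T.filter fun n : ℕ => (n : ℕ∞) < N ∧ a n ≠ 0 with hT'
    have hT : ∀ n ∈ T', (n : ℕ∞) < N ∧ a n ≠ 0 := fun n hn => (Finset.mem_filter.1 hn).2
    have hlim : Tendsto (fun r : ℝ => ∑ n ∈ T', (r - ‖a n‖)) (𝓝[<] 1)
        (𝓝 (∑ n ∈ T', (1 - ‖a n‖))) := by
      refine tendsto_finsetSum _ fun n _ => ?_
      exact (tendsto_nhdsWithin_of_tendsto_nhds tendsto_id).sub_const _
    refine le_of_tendsto hlim ?_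
    have hbig : ∀ᶠ r in 𝓝[<] (1 : ℝ), ∀ n ∈ T', ‖a n‖ < r := by
      rw [Filter.eventually_all_finset]
      intro n hn
      have := mem_unitBall.1 (ha.1 n (hT n hn).1).1
      filter_upwards [Ioo_mem_nhdsLT this] with r hr using hr.1
    filter_upwards [hC', hbig] with r hr hrb
    have hE : ∀ u ∈ T'.image fun n => toC (a n), u ≠ 0 ∧ ‖u‖ < r := by
      intro u hu
      obtain ⟨n, hn, rfl⟩ := Finset.mem_image.1 hu
      rw [norm_toC, ← norm_ne_zero_iff, norm_toC, norm_ne_zero_iff]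
      exact ⟨(hT n hn).2, hrb n hn⟩
    refine le_trans ?_ (hr _ hE)
    -- Terms are grouped by sphere. All terms on one sphere have the same modulus, and their number
    -- is at most the order of the symmetrization.
    rw [← Finset.sum_fiberwise_of_maps_to (g := fun n => toC (a n))
      (fun n hn => Finset.mem_image_of_mem (fun n => toC (a n)) hn)]
    refine Finset.sum_le_sum fun u hu => ?_
    have h2 : ∑ n ∈ T' with toC (a n) = u, (r - ‖a n‖) =
        ((T'.filter fun n => toC (a n) = u).card : ℝ) * (r - ‖u‖) := by
      rw [← nsmul_eq_mul, ← Finset.sum_const]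
      refine Finset.sum_congr rfl fun n hn => ?_
      rw [← (Finset.mem_filter.1 hn).2, norm_toC]
    rw [h2]
    refine mul_le_mul_of_nonneg_right ?_ (by linarith [(hE u hu).2])
    obtain ⟨n₀, hn₀, rfl⟩ := Finset.mem_image.1 hu
    have hub : toC (a n₀) ∈ Metric.ball (0 : ℂ) 1 := toC_mem (ha.1 n₀ (hT n₀ hn₀).1).1
    have h3 := (ha.ordDet_eq hf.1 hub (norm_nonneg _)).2
    have h4 : ((T'.filter fun n => toC (a n) = toC (a n₀)).card : ℕ∞) ≤
        ordDet (stemOf f) (toC (a n₀)) := by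
      rw [h3, ← Set.encard_coe_eq_coe_finsetCard]
      calc _ ≤ {n : ℕ | (n : ℕ∞) < N ∧ toC (a n) = toC (a n₀)}.encard := by
            refine Set.encard_le_encard fun n hn => ?_
            rw [Finset.mem_coe, Finset.mem_filter] at hn
            exact ⟨(hT n hn.1).1, hn.2⟩
        _ ≤ _ := le_mul_of_one_le_right zero_le (Order.one_le_iff_ne_zero.2 (wt_ne_zero _))
    have h5 := Nat.cast_analyticOrderNatAt (hfin _ hub)
    rw [ordDet, ← h5] at h4
    exact_mod_cast h4
  have h2 : Summable fun n : ℕ => if (n : ℕ∞) < N ∧ a n = 0 then (1 : ℝ) else 0 := by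
    obtain ⟨h, -⟩ := ha.ordDet_eq hf.1 (z₀ := 0) (by simp) le_rfl
    refine summable_of_hasFiniteSupport (h.subset fun n hn => ?_)
    rw [Function.mem_support] at hn
    have : (n : ℕ∞) < N ∧ a n = 0 := by
      by_contra h'
      exact hn (if_neg h')
    refine ⟨this.1, ?_⟩
    rw [← norm_eq_zero, norm_toC, this.2, norm_zero]
  refine (h1.add h2).congr fun n => ?_
  by_cases hn : (n : ℕ∞) < N <;> by_cases h0 : a n = 0 <;> simp [hn, h0]

/-! ### Convergence of infinite products of stem functions -/

/-- The partial products of a sequence of stem functions. -/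
def mulSeq (M : ℕ → ℂ → ℍ[ℂ]) : ℕ → ℂ → ℍ[ℂ]
  | 0 => fun _ => 1
  | k + 1 => fun z => mulSeq M k z * M k z

theorem mulSeq_add (M : ℕ → ℂ → ℍ[ℂ]) (k l : ℕ) (z : ℂ) :
    mulSeq M (k + l) z = mulSeq M k z * mulSeq (fun j => M (k + j)) l z := by
  induction l with
  | zero => simp [mulSeq]
  | succ l ih => rw [← add_assoc]; simp only [mulSeq]; rw [ih, mul_assoc]

theorem holStem_mulSeq {M : ℕ → ℂ → ℍ[ℂ]} (hM : ∀ j, HolStem (M j)) (k : ℕ) :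
    HolStem (mulSeq M k) := by
  induction k with
  | zero => exact holStem_one
  | succ k ih => exact ih.mul (hM k)

/-- Induction with (1 + x)(1 + y) - 1 = x(1 + y) + y, which needs no commutativity, and 1 + e ≤ exp
e. -/
theorem norm_mulSeq_sub_one_le {M : ℕ → ℂ → ℍ[ℂ]} {z : ℂ} {e : ℕ → ℝ}
    (he : ∀ j, ‖M j z - 1‖ ≤ e j) (k : ℕ) :
    ‖mulSeq M k z - 1‖ ≤ Real.exp (∑ j ∈ Finset.range k, e j) - 1 := by
  induction k with
  | zero => simp [mulSeq]
  | succ k ih =>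
    have e0 : 0 ≤ e k := (norm_nonneg _).trans (he k)
    have e1 : mulSeq M (k + 1) z - 1 =
        (mulSeq M k z - 1) * (1 + (M k z - 1)) + (M k z - 1) := by
      simp only [mulSeq]; noncomm_ring
    rw [e1, Finset.sum_range_succ, Real.exp_add]
    set E := Real.exp (∑ j ∈ Finset.range k, e j)
    have h1 : ‖1 + (M k z - 1)‖ ≤ 1 + e k :=
      (norm_add_le _ _).trans (by rw [norm_one]; linarith [he k])
    have h2 : ‖(mulSeq M k z - 1) * (1 + (M k z - 1))‖ ≤ (E - 1) * (1 + e k) :=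
      (norm_mul_le _ _).trans (mul_le_mul ih h1 (norm_nonneg _) ((norm_nonneg _).trans ih))
    have h3 : E * (1 + e k) ≤ E * Real.exp (e k) :=
      mul_le_mul_of_nonneg_left (by linarith [Real.add_one_le_exp (e k)]) (Real.exp_pos _).le
    refine (norm_add_le _ _).trans ?_
    linarith [he k]

theorem norm_mulSeq_succ_sub_le {M : ℕ → ℂ → ℍ[ℂ]} {z : ℂ} {e : ℕ → ℝ} (hs : Summable e)
    (he : ∀ j, ‖M j z - 1‖ ≤ e j) (k : ℕ) :
    ‖mulSeq M (k + 1) z - mulSeq M k z‖ ≤ Real.exp (∑' j, e j) * e k := by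
  have e1 : mulSeq M (k + 1) z - mulSeq M k z = mulSeq M k z * (M k z - 1) := by
    simp only [mulSeq]; noncomm_ring
  have h1 := norm_mulSeq_sub_one_le he k
  have h2 : ∑ j ∈ Finset.range k, e j ≤ ∑' j, e j :=
    hs.sum_le_tsum _ fun j _ => (norm_nonneg _).trans (he j)
  have h3 := Real.exp_le_exp.2 h2
  have h4 : ‖mulSeq M k z‖ ≤ ‖mulSeq M k z - 1‖ + 1 := by
    have := norm_add_le (mulSeq M k z - 1) 1
    rwa [sub_add_cancel, norm_one] at this
  rw [e1]
  exact (norm_mul_le _ _).trans (mul_le_mul (by linarith) (he k) (norm_nonneg _) (by positivity))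

open Classical in
/-- The pointwise limit of the partial products inside the unit disc. -/
def infProd (M : ℕ → ℂ → ℍ[ℂ]) (z : ℂ) : ℍ[ℂ] :=
  if ‖z‖ < 1 then 1 + ∑' k, (mulSeq M (k + 1) z - mulSeq M k z) else 1

section Limits

variable {M : ℕ → ℂ → ℍ[ℂ]} {c : ℕ → ℝ}

/-- The differences of consecutive partial products telescope, and on a smaller disc the Weierstrass
M-test applies to them. -/
theorem tendstoUniformlyOn_mulSeq (hc : Summable c)
    (hM : ∀ j, ∀ z ∈ Metric.ball (0 : ℂ) 1, ‖M j z - 1‖ ≤ c j / (1 - ‖z‖) ^ 2) {r : ℝ}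
    (hr : r < 1) :
    TendstoUniformlyOn (mulSeq M) (infProd M) atTop (Metric.closedBall 0 r) := by
  have hc0 : ∀ j, 0 ≤ c j := fun j => by
    simpa using (norm_nonneg _).trans (hM j 0 (by simp))
  have he : ∀ z ∈ Metric.closedBall (0 : ℂ) r, ∀ j, ‖M j z - 1‖ ≤ c j / (1 - r) ^ 2 := by
    intro z hz j
    rw [mem_closedBall_zero_iff] at hz
    refine (hM j z (by rw [mem_ball_zero_iff]; linarith)).trans ?_
    have h1 : 0 < 1 - r := by linarith
    have := hc0 j
    gcongr
  have hs : Summable fun j => c j / (1 - r) ^ 2 := hc.div_const _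
  have h1 := tendstoUniformlyOn_tsum_nat (f := fun k z => mulSeq M (k + 1) z - mulSeq M k z)
    (s := Metric.closedBall (0 : ℂ) r) (hs.mul_left _)
    fun k z hz => norm_mulSeq_succ_sub_le hs (he z hz) k
  rw [Metric.tendstoUniformlyOn_iff] at h1 ⊢
  intro ε hε
  filter_upwards [h1 ε hε] with k hk z hz
  have := hk z hz
  rw [Finset.sum_range_sub fun k => mulSeq M k z] at this
  have hz1 : ‖z‖ < 1 := (mem_closedBall_zero_iff.1 hz).trans_lt hr
  rw [infProd, if_pos hz1]
  rw [dist_eq_norm] at this ⊢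
  simp only [mulSeq] at this ⊢
  rwa [show ∀ a b : ℍ[ℂ], a - (b - 1) = 1 + a - b from fun a b => by abel] at this

theorem tendsto_mulSeq (hc : Summable c)
    (hM : ∀ j, ∀ z ∈ Metric.ball (0 : ℂ) 1, ‖M j z - 1‖ ≤ c j / (1 - ‖z‖) ^ 2) {z : ℂ}
    (hz : z ∈ Metric.ball (0 : ℂ) 1) :
    Tendsto (fun k => mulSeq M k z) atTop (𝓝 (infProd M z)) :=
  (tendstoUniformlyOn_mulSeq hc hM (mem_ball_zero_iff.1 hz)).tendsto_at (by simp)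

theorem holStem_infProd (hh : ∀ j, HolStem (M j)) (hc : Summable c)
    (hM : ∀ j, ∀ z ∈ Metric.ball (0 : ℂ) 1, ‖M j z - 1‖ ≤ c j / (1 - ‖z‖) ^ 2) :
    HolStem (infProd M) := by
  constructor
  · intro z
    by_cases hz : ‖z‖ < 1
    · have hz' : z ∈ Metric.ball (0 : ℂ) 1 := mem_ball_zero_iff.2 hz
      have hzc : starRingEnd ℂ z ∈ Metric.ball (0 : ℂ) 1 := by simpa using hz
      have h1 := tendsto_mulSeq hc hM hz'
      have h2 := tendsto_mulSeq hc hM hzc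
      simp only [(holStem_mulSeq hh _).1 z] at h2
      refine tendsto_nhds_unique h2 ?_
      rw [tendsto_iff_norm_sub_tendsto_zero] at h1 ⊢
      simpa only [← conjC_sub, norm_conjC] using h1
    -- The value 1 assigned off the disc is symmetric, as a stem function must be on the whole
    -- plane.
    · rw [infProd, infProd, if_neg hz, if_neg (by simpa using hz)]
      apply Quaternion.ext <;> simp
  · refine TendstoLocallyUniformlyOn.differentiableOn (F := mulSeq M) (φ := atTop) ?_
      (Eventually.of_forall fun k => (holStem_mulSeq hh k).2) Metric.isOpen_ball
    rw [tendstoLocallyUniformlyOn_iff_forall_isCompact Metric.isOpen_ball]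
    intro K hK hKc
    obtain ⟨r, hr, hKr⟩ : ∃ r < 1, K ⊆ Metric.closedBall (0 : ℂ) r := by
      rcases K.eq_empty_or_nonempty with rfl | hne
      · exact ⟨0, one_pos, Set.empty_subset _⟩
      · obtain ⟨w, hw, hmax⟩ := hKc.exists_isMaxOn hne continuous_norm.continuousOn
        exact ⟨‖w‖, mem_ball_zero_iff.1 (hK hw), fun z hz => mem_closedBall_zero_iff.2 (hmax hz)⟩
    exact (tendstoUniformlyOn_mulSeq hc hM hr).mono hKr

theorem norm_infProd_sub_one_le (hc : Summable c)
    (hM : ∀ j, ∀ z ∈ Metric.ball (0 : ℂ) 1, ‖M j z - 1‖ ≤ c j / (1 - ‖z‖) ^ 2) {z : ℂ}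
    (hz : z ∈ Metric.ball (0 : ℂ) 1) :
    ‖infProd M z - 1‖ ≤ Real.exp ((∑' j, c j) / (1 - ‖z‖) ^ 2) - 1 := by
  have h1 := ((tendsto_mulSeq hc hM hz).sub_const 1).norm
  refine le_of_tendsto h1 (Eventually.of_forall fun k => ?_)
  refine (norm_mulSeq_sub_one_le (fun j => hM j z hz) k).trans ?_
  rw [← tsum_div_const]
  have h2 : ∑ j ∈ Finset.range k, c j / (1 - ‖z‖) ^ 2 ≤ ∑' j, c j / (1 - ‖z‖) ^ 2 :=
    (hc.div_const _).sum_le_tsum _ fun j _ => (norm_nonneg _).trans (hM j z hz)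
  linarith [Real.exp_le_exp.2 h2]

theorem infProd_eq_mul (hc : Summable c)
    (hM : ∀ j, ∀ z ∈ Metric.ball (0 : ℂ) 1, ‖M j z - 1‖ ≤ c j / (1 - ‖z‖) ^ 2) (k : ℕ) {z : ℂ}
    (hz : z ∈ Metric.ball (0 : ℂ) 1) :
    infProd M z = mulSeq M k z * infProd (fun j => M (k + j)) z := by
  have hc' : Summable fun j => c (k + j) := by
    simpa only [add_comm k] using (summable_nat_add_iff k).2 hc
  have h1 := (tendsto_mulSeq (M := fun j => M (k + j)) hc' (fun j => hM (k + j)) hz).const_mul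
    (mulSeq M k z)
  have h2 := (tendsto_add_atTop_iff_nat k).2 (tendsto_mulSeq hc hM hz)
  simp only [add_comm _ k, mulSeq_add] at h2
  exact tendsto_nhds_unique h2 h1

/-- The Neumann series makes s a unit, and the multiplicative map `normSq` preserves units. -/
theorem normSq_ne_zero_of_norm_sub_one_lt {s : ℍ[ℂ]} (h : ‖s - 1‖ < 1) :
    Quaternion.normSq s ≠ 0 := by
  have h1 := isUnit_one_sub_of_norm_lt_one (x := 1 - s) (by rwa [norm_sub_rev])
  rw [sub_sub_cancel] at h1
  exact (h1.map Quaternion.normSq).ne_zero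

theorem eventually_normSq_infProd_ne_zero (hc : Summable c)
    (hM : ∀ j, ∀ z ∈ Metric.ball (0 : ℂ) 1, ‖M j z - 1‖ ≤ c j / (1 - ‖z‖) ^ 2) {z : ℂ}
    (hz : z ∈ Metric.ball (0 : ℂ) 1) :
    ∀ᶠ k in atTop, Quaternion.normSq (infProd (fun j => M (k + j)) z) ≠ 0 := by
  have h1 : Tendsto (fun k => Real.exp ((∑' j, c (j + k)) / (1 - ‖z‖) ^ 2) - 1) atTop (𝓝 0) := by
    have := ((tendsto_sum_nat_add c).div_const ((1 - ‖z‖) ^ 2))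
    rw [zero_div] at this
    have := ((Real.continuous_exp.tendsto 0).comp this).sub_const 1
    rwa [Real.exp_zero, sub_self] at this
  filter_upwards [h1.eventually_lt_const one_pos] with k hk
  have hc' : Summable fun j => c (k + j) := by
    simpa only [add_comm k] using (summable_nat_add_iff k).2 hc
  refine normSq_ne_zero_of_norm_sub_one_lt
    ((norm_infProd_sub_one_le hc' (fun j => hM (k + j)) hz).trans_lt ?_)
  simpa only [add_comm k] using hk

end Limits

theorem norm_induced_sub_le (s t : ℂ → ℍ[ℂ]) (q : ℍ[ℝ]) :
    ‖induced s q - induced t q‖ ≤ 4 * ‖s (toC q) - t (toC q)‖ := by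
  rw [← induced_sub]
  exact norm_evJ_le (norm_dirOf_le q) _

theorem tendstoUniformlyOn_induced {F : ℕ → ℂ → ℍ[ℂ]} {G : ℂ → ℍ[ℂ]}
    (h : ∀ r < 1, TendstoUniformlyOn F G atTop (Metric.closedBall 0 r)) {K : Set ℍ[ℝ]}
    (hK : K ⊆ unitBall) (hKc : IsCompact K) :
    TendstoUniformlyOn (fun k => induced (F k)) (induced G) atTop K := by
  rcases K.eq_empty_or_nonempty with rfl | hne
  · exact tendstoUniformlyOn_empty
  obtain ⟨w, hw, hmax⟩ := hKc.exists_isMaxOn hne continuous_norm.continuousOn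
  have h1 := h ‖w‖ (mem_unitBall.1 (hK hw))
  rw [Metric.tendstoUniformlyOn_iff] at h1 ⊢
  intro ε hε
  filter_upwards [h1 (ε / 4) (by positivity)] with k hk q hq
  have h2 := hk (toC q) (by rw [mem_closedBall_zero_iff, norm_toC]; exact hmax hq)
  rw [dist_eq_norm] at h2 ⊢
  exact (norm_induced_sub_le _ _ _).trans_lt (by linarith)

/-! ### The Blaschke product of the zeros -/

theorem toC_conj (a : ℍ[ℝ]) {w : ℍ[ℝ]} (hw : w ≠ 0) : toC (w⁻¹ * a * w) = toC a := by
  obtain ⟨J, hJ, haJ⟩ := (mem_sphereOf_iff (norm_nonneg a.im)).2 (rfl : toC a = ⟨a.re, ‖a.im‖⟩)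
  rw [conj_eq_slice haJ hw, toC_slice _ _ (conj_mem_imUnits hJ hw) (norm_nonneg _)]
  rfl

theorem induced_of_slice {s : ℂ → ℍ[ℂ]} (hs : IsStem s) {q J : ℍ[ℝ]} (hJ : J ∈ imUnits)
    (hq : q = (q.re : ℍ[ℝ]) + (‖q.im‖ : ℍ[ℝ]) * J) : induced s q = evJ J (s (toC q)) := by
  conv_lhs => rw [hq]
  exact induced_slice hs hJ _ _

theorem normSq_eq_zero_of_induced {s : ℂ → ℍ[ℂ]} (hs : IsStem s) {q : ℍ[ℝ]}
    (h : induced s q = 0) : Quaternion.normSq (s (toC q)) = 0 := by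
  obtain ⟨J, hJ, -, h1⟩ := induced_eq_evJ hs q
  exact normSq_eq_zero_of_evJ hJ (h1 ▸ h)

/-- Zeros survive multiplication on the right, here by the inverse of t. -/
theorem evJ_eq_zero_of_mul {J : ℍ[ℝ]} (hJ : J ∈ imUnits) {s t : ℍ[ℂ]}
    (ht : Quaternion.normSq t ≠ 0) (h : evJ J (s * t) = 0) : evJ J s = 0 := by
  have h1 := evJ_mul_eq_zero hJ (star t * ((Quaternion.normSq t)⁻¹ : ℂ)) h
  rwa [mul_assoc, ← mul_assoc t, Quaternion.self_mul_star, ← Quaternion.coe_mul,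
    mul_inv_cancel₀ ht, Quaternion.coe_one, mul_one] at h1

open Classical in
/-- The stem functions of the Blaschke factors of `(b_n)_{n < N}`, followed by ones. -/
def factorSeq (N : ℕ∞) (b : ℕ → ℍ[ℝ]) (n : ℕ) : ℂ → ℍ[ℂ] :=
  if (n : ℕ∞) < N then blaschkeStem (b n) else fun _ => 1

theorem isStem_factorSeq (N : ℕ∞) (b : ℕ → ℍ[ℝ]) (n : ℕ) : IsStem (factorSeq N b n) := by
  rw [factorSeq]
  split_ifs
  · exact isStem_stemOf _
  · exact isStem_one

theorem isStem_mulSeq {M : ℕ → ℂ → ℍ[ℂ]} (hM : ∀ j, IsStem (M j)) (k : ℕ) :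
    IsStem (mulSeq M k) := by
  induction k with
  | zero => exact isStem_one
  | succ k ih => exact ih.mul (hM k)

theorem partialProd_eq_induced (N : ℕ∞) (b : ℕ → ℍ[ℝ]) (k : ℕ) :
    partialProd N b k = induced (mulSeq (factorSeq N b) k) := by
  induction k with
  | zero => funext q; exact (induced_one q).symm
  | succ k ih =>
    rw [partialProd]
    split_ifs with h
    · rw [starProd_eq_induced, ih, stemOf_induced (isStem_mulSeq (isStem_factorSeq N b) k)]
      simp only [mulSeq, factorSeq, if_pos h]
      rfl
    · rw [ih]
      simp only [mulSeq, factorSeq, if_neg h, mul_one]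

/-- The indices below `n` of the terms on the sphere of `z₀`. -/
def sphereIndices (N : ℕ∞) (a : ℕ → ℍ[ℝ]) (z₀ : ℂ) (n : ℕ) : Set ℕ :=
  {j | j < n ∧ (j : ℕ∞) < N ∧ toC (a j) = z₀}

theorem sphereIndices_finite (N : ℕ∞) (a : ℕ → ℍ[ℝ]) (z₀ : ℂ) (n : ℕ) :
    (sphereIndices N a z₀ n).Finite := (Set.finite_lt_nat n).subset fun _ h => h.1

theorem wt_cancel {z₀ : ℂ} {u v : ℕ∞} (hu : u ≠ ⊤) (hv : v ≠ ⊤) (h : u * wt z₀ = v * wt z₀) :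
    u = v := by
  lift u to ℕ using hu
  lift v to ℕ using hv
  unfold wt at h
  split_ifs at h
  · norm_cast at h ⊢
    omega
  · simpa using h

theorem encard_sphereIndices_succ_of_mem {N : ℕ∞} {a : ℕ → ℍ[ℝ]} {z₀ : ℂ} {n : ℕ}
    (hn : (n : ℕ∞) < N) (h : toC (a n) = z₀) :
    (sphereIndices N a z₀ (n + 1)).encard = (sphereIndices N a z₀ n).encard + 1 := by
  have : sphereIndices N a z₀ (n + 1) = insert n (sphereIndices N a z₀ n) := by
    ext j
    simp only [sphereIndices, Set.mem_insert_iff, Set.mem_ofPred_eq, Nat.lt_succ_iff_lt_or_eq]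
    constructor
    · rintro ⟨h1 | rfl, h2⟩
      · exact Or.inr ⟨h1, h2⟩
      · exact Or.inl rfl
    · rintro (rfl | ⟨h1, h2⟩)
      · exact ⟨Or.inr rfl, hn, h⟩
      · exact ⟨Or.inl h1, h2⟩
  rw [this, Set.encard_insert_of_notMem fun h' => lt_irrefl _ h'.1]

theorem sphereIndices_succ_of_not {N : ℕ∞} {a : ℕ → ℍ[ℝ]} {z₀ : ℂ} {n : ℕ}
    (h : ¬((n : ℕ∞) < N ∧ toC (a n) = z₀)) :
    sphereIndices N a z₀ (n + 1) = sphereIndices N a z₀ n := by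
  ext j
  simp only [sphereIndices, Set.mem_ofPred_eq, Nat.lt_succ_iff_lt_or_eq]
  constructor
  · rintro ⟨h1 | rfl, h2⟩
    · exact ⟨h1, h2⟩
    · exact absurd h2 h
  · rintro ⟨h1, h2⟩
    exact ⟨Or.inl h1, h2⟩

theorem holStem_factorSeq {N : ℕ∞} {b : ℕ → ℍ[ℝ]}
    (hb : ∀ n : ℕ, (n : ℕ∞) < N → b n ∈ unitBall) (n : ℕ) : HolStem (factorSeq N b n) := by
  rw [factorSeq]
  split_ifs with h
  · exact holStem_blaschkeStem (hb n h)
  · exact holStem_one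

/-- A partial product carries the part of the symmetrization order used up so far. -/
theorem ordDet_mulSeq_factorSeq {N : ℕ∞} {a b : ℕ → ℍ[ℝ]}
    (hb : ∀ n : ℕ, (n : ℕ∞) < N → b n ∈ unitBall)
    (hab : ∀ n : ℕ, (n : ℕ∞) < N → toC (b n) = toC (a n)) {z₀ : ℂ}
    (hz₀ : z₀ ∈ Metric.ball (0 : ℂ) 1) (him : 0 ≤ z₀.im) (n : ℕ) :
    ordDet (mulSeq (factorSeq N b) n) z₀ = (sphereIndices N a z₀ n).encard * wt z₀ := by
  induction n with
  | zero =>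
    have : sphereIndices N a z₀ 0 = ∅ := by ext j; simp [sphereIndices]
    rw [this, Set.encard_empty, zero_mul]
    exact (ordDet_eq_zero_iff holStem_one hz₀).2 (by simp)
  | succ n ih =>
    have hh := holStem_factorSeq hb
    have h1 : ordDet (mulSeq (factorSeq N b) (n + 1)) z₀ = _ :=
      ordDet_mul (holStem_mulSeq hh n) (hh n) hz₀
    rw [h1, ih]
    by_cases hn : (n : ℕ∞) < N
    · rw [factorSeq, if_pos hn, ordDet_blaschkeStem (hb n hn) hz₀ him, hab n hn]
      split_ifs with h2
      · rw [encard_sphereIndices_succ_of_mem hn h2, add_mul, one_mul]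
      · rw [sphereIndices_succ_of_not fun h => h2 h.2, add_zero]
    · rw [sphereIndices_succ_of_not fun h => hn h.1, factorSeq, if_neg hn,
        (ordDet_eq_zero_iff holStem_one hz₀).2 (by simp), add_zero]

theorem mulSeq_congr {M M' : ℕ → ℂ → ℍ[ℂ]} {n : ℕ} (h : ∀ j < n, M j = M' j) :
    mulSeq M n = mulSeq M' n := by
  induction n with
  | zero => rfl
  | succ n ih =>
    simp only [mulSeq]
    rw [ih fun j hj => h j (hj.trans n.lt_succ_self), h n n.lt_succ_self]

theorem factorSeq_congr {N : ℕ∞} {b b' : ℕ → ℍ[ℝ]} {n : ℕ} (h : b n = b' n) :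
    factorSeq N b n = factorSeq N b' n := by rw [factorSeq, factorSeq, h]

/-! ### Dividing f by Blaschke factors -/

section Division

variable {f : ℍ[ℝ] → ℍ[ℝ]} {N : ℕ∞} {a : ℕ → ℍ[ℝ]}

/-- The admissible choices of `b_n`, given the earlier ones. -/
def IsDivisorAt (N : ℕ∞) (a b : ℕ → ℍ[ℝ]) (n : ℕ) : Prop :=
  (n : ℕ∞) < N → (∃ w : ℍ[ℝ], w ≠ 0 ∧ b n = w⁻¹ * a n * w) ∧
    (induced (mulSeq (factorSeq N b) n) (a n) ≠ 0 →
      b n = (induced (mulSeq (factorSeq N b) n) (a n))⁻¹ * a n *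
        induced (mulSeq (factorSeq N b) n) (a n))

theorem IsDivisorAt.toC_eq {b : ℕ → ℍ[ℝ]} {n : ℕ} (h : IsDivisorAt N a b n)
    (hn : (n : ℕ∞) < N) : toC (b n) = toC (a n) := by
  obtain ⟨⟨w, hw, h1⟩, -⟩ := h hn
  rw [h1, toC_conj _ hw]

theorem IsDivisorAt.mem_unitBall (ha : IsZeroSequence f N a) {b : ℕ → ℍ[ℝ]} {n : ℕ}
    (h : IsDivisorAt N a b n) (hn : (n : ℕ∞) < N) : b n ∈ unitBall := by
  rw [QHardy.mem_unitBall, ← norm_toC, h.toC_eq hn, norm_toC]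
  exact QHardy.mem_unitBall.1 (ha.1 n hn).1

/-- If g were invertible at the sphere of a_n, P would have the full order of f there. But P
accounts only for indices below n, while n itself also lies on that sphere. -/
theorem exists_factor_step (hf : SliceRegular f) (ha : IsZeroSequence f N a) {n : ℕ}
    {P g : ℂ → ℍ[ℂ]} (hP : HolStem P) (hg : HolStem g)
    (hPg : ∀ z ∈ Metric.ball (0 : ℂ) 1, stemOf f z = P z * g z)
    (hord : ∀ z₀ ∈ Metric.ball (0 : ℂ) 1, 0 ≤ z₀.im →
      ordDet P z₀ = (sphereIndices N a z₀ n).encard * wt z₀) (hn : (n : ℕ∞) < N) :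
    ∃ (b : ℍ[ℝ]) (g' : ℂ → ℍ[ℂ]), HolStem g' ∧ (∃ w : ℍ[ℝ], w ≠ 0 ∧ b = w⁻¹ * a n * w) ∧
      (∀ z ∈ Metric.ball (0 : ℂ) 1, g z = blaschkeStem b z * g' z) ∧
      (induced P (a n) ≠ 0 → b = (induced P (a n))⁻¹ * a n * induced P (a n)) := by
  obtain ⟨hball, hzero⟩ := ha.1 n hn
  have hz := toC_mem hball
  refine exists_division_step hP.1 hg hball ?_ ?_
  · rw [← hzero, hf.eq_induced hball]
    exact (induced_congr hPg hball).symm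
  · by_contra h0
    obtain ⟨hfin, hF⟩ := ha.ordDet_eq hf hz (norm_nonneg _)
    rw [ordDet_congr hz hPg, ordDet_mul hP hg hz, (ordDet_eq_zero_iff hg hz).2 h0, add_zero,
      hord _ hz (norm_nonneg _)] at hF
    have h1 := wt_cancel (Set.encard_ne_top_iff.2 (sphereIndices_finite _ _ _ _))
      (Set.encard_ne_top_iff.2 hfin) hF
    have h2 : sphereIndices N a (toC (a n)) n ⊂ {j : ℕ | (j : ℕ∞) < N ∧ toC (a j) = toC (a n)} :=
      ⟨fun j hj => hj.2, fun h => lt_irrefl n (h (show n ∈ _ from ⟨hn, rfl⟩)).1⟩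
    exact ((sphereIndices_finite _ _ _ _).encard_lt_encard h2).ne h1

/-- The zeros can be divided out one after the other. -/
theorem exists_factorization (hf : SliceRegular f) (ha : IsZeroSequence f N a) :
    ∃ b : ℕ → ℍ[ℝ], (∀ n, IsDivisorAt N a b n) ∧ ∀ n, ∃ g, HolStem g ∧
      ∀ z ∈ Metric.ball (0 : ℂ) 1, stemOf f z = mulSeq (factorSeq N b) n z * g z := by
  classical
  -- Each b_n depends on all earlier choices, so the recursion runs over whole sequences of which
  -- only the terms below n are significant.
  let Good : (ℕ → ℍ[ℝ]) → ℕ → Prop := fun b n => (∀ j < n, IsDivisorAt N a b j) ∧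
    ∃ g, HolStem g ∧ ∀ z ∈ Metric.ball (0 : ℂ) 1, stemOf f z = mulSeq (factorSeq N b) n z * g z
  have hcongr : ∀ {b b' : ℕ → ℍ[ℝ]} {n : ℕ}, (∀ j < n, b j = b' j) →
      mulSeq (factorSeq N b) n = mulSeq (factorSeq N b') n := fun h =>
    mulSeq_congr fun j hj => factorSeq_congr (h j hj)
  have hdiv : ∀ {b b' : ℕ → ℍ[ℝ]} {n : ℕ}, (∀ j ≤ n, b j = b' j) → IsDivisorAt N a b n →
      IsDivisorAt N a b' n := by
    intro b b' n h hb
    rw [IsDivisorAt, hcongr fun j hj => h j hj.le, h n le_rfl] at hb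
    exact hb
  have step : ∀ n b, Good b n → ∃ b', (∀ j < n, b' j = b j) ∧ Good b' (n + 1) := by
    rintro n b ⟨hb, g, hg, hPg⟩
    -- terms from `n` on are irrelevant, so they may be taken in the ball
    have hb1 : ∀ j : ℕ, (j : ℕ∞) < N → (if j < n then b j else a j) ∈ unitBall := by
      intro j hj
      split_ifs with h
      · exact (hb j h).mem_unitBall ha hj
      · exact (ha.1 j hj).1
    have hb2 : ∀ j : ℕ, (j : ℕ∞) < N → toC (if j < n then b j else a j) = toC (a j) := by
      intro j hj
      split_ifs with h
      · exact (hb j h).toC_eq hj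
      · rfl
    have hbc : mulSeq (factorSeq N fun j => if j < n then b j else a j) n =
        mulSeq (factorSeq N b) n := hcongr fun j hj => if_pos hj
    have hP : HolStem (mulSeq (factorSeq N b) n) := by
      rw [← hbc]; exact holStem_mulSeq (holStem_factorSeq hb1) n
    by_cases hn : (n : ℕ∞) < N
    · obtain ⟨c, g', hg', hconj, hgg', hT⟩ := exists_factor_step hf ha hP hg hPg
        (fun z₀ hz₀ him => by rw [← hbc]; exact ordDet_mulSeq_factorSeq hb1 hb2 hz₀ him n) hn
      have hup : ∀ j < n, Function.update b n c j = b j := fun j hj =>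
        Function.update_of_ne hj.ne _ _
      refine ⟨Function.update b n c, hup, fun j hj => ?_, g', hg', fun z hz => ?_⟩
      · rcases Nat.lt_succ_iff_lt_or_eq.1 hj with h | rfl
        · exact hdiv (fun i hi => (hup i (hi.trans_lt h)).symm) (hb j h)
        · intro _
          rw [hcongr hup, Function.update_self]
          exact ⟨hconj, hT⟩
      · simp only [mulSeq]
        rw [hcongr hup, factorSeq, if_pos hn, Function.update_self, mul_assoc, ← hgg' z hz,
          hPg z hz]
    · refine ⟨b, fun _ _ => rfl, fun j hj => ?_, g, hg, fun z hz => ?_⟩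
      · rcases Nat.lt_succ_iff_lt_or_eq.1 hj with h | rfl
        · exact hb j h
        · exact fun h => absurd h hn
      · simp only [mulSeq]
        rw [factorSeq, if_neg hn, mul_one, hPg z hz]
  choose! next hnext hgood using step
  -- The terms of `S n` below n never change again; the diagonal n ↦ `S (n + 1) n` is the required
  -- sequence.
  let S : ℕ → ℕ → ℍ[ℝ] := fun n => Nat.rec (fun _ => 0) (fun n b => next n b) n
  have hS : ∀ n, Good (S n) n := by
    intro n
    induction n with
    | zero => exact ⟨fun j hj => absurd hj (Nat.not_lt_zero j), stemOf f, hf.holStem,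
        fun z _ => by simp [mulSeq]⟩
    | succ n ih => exact hgood n (S n) ih
  have hstab : ∀ n k j, j < n → S (n + k) j = S n j := by
    intro n k j hj
    induction k with
    | zero => rfl
    | succ k ih =>
      rw [← ih]
      exact hnext (n + k) (S (n + k)) (hS (n + k)) j (by omega)
  have hdiag : ∀ n, ∀ j < n, S n j = S (j + 1) j := by
    intro n j hj
    obtain ⟨k, rfl⟩ := Nat.exists_eq_add_of_le (Nat.succ_le_of_lt hj)
    exact hstab (j + 1) k j j.lt_succ_self
  refine ⟨fun n => S (n + 1) n, fun n => ?_, fun n => ?_⟩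
  · exact hdiv (fun j hj => hdiag (n + 1) j (Nat.lt_succ_of_le hj)) ((hS (n + 1)).1 n n.lt_succ_self)
  · obtain ⟨g, hg, h⟩ := (hS n).2
    exact ⟨g, hg, fun z hz => by rw [h z hz, hcongr (hdiag n)]⟩

end Division

/-! ### The Blaschke product has the zeros of f -/

section BlaschkeProduct

variable {f : ℍ[ℝ] → ℍ[ℝ]} {N : ℕ∞} {a b : ℕ → ℍ[ℝ]}

open Classical in
theorem exists_summable_bound (ha : IsZeroSequence f N a)
    (hs : Summable fun n : ℕ => if (n : ℕ∞) < N then 1 - ‖a n‖ else 0)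
    (hb : ∀ n, IsDivisorAt N a b n) :
    ∃ c : ℕ → ℝ, Summable c ∧ ∀ j, ∀ z ∈ Metric.ball (0 : ℂ) 1,
      ‖factorSeq N b j z - 1‖ ≤ c j / (1 - ‖z‖) ^ 2 := by
  refine ⟨_, hs.mul_left 25, fun j z hz => ?_⟩
  rw [factorSeq]
  split_ifs with h
  · have h1 := norm_blaschkeStem_sub_one_le ((hb j).mem_unitBall ha h) hz
    rwa [← norm_toC (b j), (hb j).toC_eq h, norm_toC] at h1
  · simp

/-- Far out in the sequence, neither the remaining quotient of `f` nor the tail of the product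
vanishes on a given sphere. -/
theorem exists_split (hf : SliceRegular f) (ha : IsZeroSequence f N a)
    {c : ℕ → ℝ} (hc : Summable c)
    (hM : ∀ j, ∀ z ∈ Metric.ball (0 : ℂ) 1, ‖factorSeq N b j z - 1‖ ≤ c j / (1 - ‖z‖) ^ 2)
    (hb : ∀ n, IsDivisorAt N a b n)
    (hdiv : ∀ n, ∃ g, HolStem g ∧
      ∀ z ∈ Metric.ball (0 : ℂ) 1, stemOf f z = mulSeq (factorSeq N b) n z * g z) {z₀ : ℂ}
    (hz₀ : z₀ ∈ Metric.ball (0 : ℂ) 1) (him : 0 ≤ z₀.im) :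
    ∃ P g R : ℂ → ℍ[ℂ], HolStem P ∧ HolStem g ∧ HolStem R ∧
      (∀ z ∈ Metric.ball (0 : ℂ) 1, stemOf f z = P z * g z) ∧
      (∀ z ∈ Metric.ball (0 : ℂ) 1, infProd (factorSeq N b) z = P z * R z) ∧
      Quaternion.normSq (g z₀) ≠ 0 ∧ Quaternion.normSq (R z₀) ≠ 0 := by
  have hball : ∀ n : ℕ, (n : ℕ∞) < N → b n ∈ unitBall := fun n hn => (hb n).mem_unitBall ha hn
  have hab : ∀ n : ℕ, (n : ℕ∞) < N → toC (b n) = toC (a n) := fun n hn => (hb n).toC_eq hn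
  have hh := holStem_factorSeq hball
  obtain ⟨hfin, hF⟩ := ha.ordDet_eq hf hz₀ him
  obtain ⟨K, hK⟩ := hfin.bddAbove
  obtain ⟨k, hk1, hk2⟩ := ((eventually_normSq_infProd_ne_zero hc hM hz₀).and
    (eventually_gt_atTop K)).exists
  obtain ⟨g, hg, hfg⟩ := hdiv k
  have hP := holStem_mulSeq hh k
  have hset : sphereIndices N a z₀ k = {j : ℕ | (j : ℕ∞) < N ∧ toC (a j) = z₀} := by
    ext j
    exact ⟨fun h => h.2, fun h => ⟨(hK h).trans_lt hk2, h⟩⟩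
  refine ⟨mulSeq (factorSeq N b) k, g, infProd fun j => factorSeq N b (k + j), hP, hg,
    holStem_infProd (fun j => hh (k + j)) (c := fun j => c (k + j)) ?_ (fun j => hM (k + j)), hfg,
    fun z hz => infProd_eq_mul hc hM k hz, ?_, hk1⟩
  · simpa only [add_comm k] using (summable_nat_add_iff k).2 hc
  · rw [← ordDet_eq_zero_iff hg hz₀]
    rw [ordDet_congr hz₀ hfg, ordDet_mul hP hg hz₀, ordDet_mulSeq_factorSeq hball hab hz₀ him,
      hset] at hF
    -- Past all terms on the sphere, P carries the whole order of f. The order is finite and can be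
    -- cancelled, leaving order 0 for g.
    have htop : {j : ℕ | (j : ℕ∞) < N ∧ toC (a j) = z₀}.encard * wt z₀ ≠ ⊤ :=
      WithTop.mul_ne_top (Set.encard_ne_top_iff.2 hfin) (wt_ne_top z₀)
    exact ENat.add_right_injective_of_ne_top htop (hF.trans (add_zero _).symm)

/-- `B` and `f` have the same factorizations on all spheres of the unit ball. -/
def SameFactors (f B : ℍ[ℝ] → ℍ[ℝ]) : Prop :=
  ∀ z₀ ∈ Metric.ball (0 : ℂ) 1, 0 ≤ z₀.im → ∀ m ps, OnSphere z₀ ps →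
    (StemFactor (stemOf B) z₀ m ps ↔ StemFactor (stemOf f) z₀ m ps)

theorem SameFactors.isSphereFactorization_iff {B : ℍ[ℝ] → ℍ[ℝ]} (h : SameFactors f B)
    (hf : SliceRegular f) (hB : SliceRegular B) {x y : ℝ} (hy : 0 < y)
    (hxy : (⟨x, y⟩ : ℂ) ∈ Metric.ball (0 : ℂ) 1) (m : ℕ) (ps : List ℍ[ℝ]) :
    IsSphereFactorization B x y m ps ↔ IsSphereFactorization f x y m ps := by
  rw [QHardy.isSphereFactorization_iff hf hy hxy, QHardy.isSphereFactorization_iff hB hy hxy]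
  refine and_congr_right fun h1 => and_congr_right fun _ => h _ hxy hy.le m ps fun p hp => ?_
  exact ⟨(mem_sphereOf_iff hy.le).1 (h1 p hp), hy.ne'⟩

theorem SameFactors.hasSphericalMultiplicity_iff {B : ℍ[ℝ] → ℍ[ℝ]} (h : SameFactors f B)
    (hf : SliceRegular f) (hB : SliceRegular B) {x y : ℝ} (hy : 0 < y) (hxy : x ^ 2 + y ^ 2 < 1)
    (k : ℕ) : HasSphericalMultiplicity B x y k ↔ HasSphericalMultiplicity f x y k := by
  simp only [HasSphericalMultiplicity, h.isSphereFactorization_iff hf hB hy (mem_ball_of_sq hxy)]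

theorem SameFactors.hasIsolatedMultiplicity_iff {B : ℍ[ℝ] → ℍ[ℝ]} (h : SameFactors f B)
    (hf : SliceRegular f) (hB : SliceRegular B) {q : ℍ[ℝ]} (hq : q ∈ unitBall) (k : ℕ) :
    HasIsolatedMultiplicity B q k ↔ HasIsolatedMultiplicity f q k := by
  by_cases h0 : q.im = 0
  · rw [hasIsolatedMultiplicity_real_iff hf h0 hq, hasIsolatedMultiplicity_real_iff hB h0 hq]
    exact h _ (toC_mem hq) (norm_nonneg _) k [] fun p hp => by simp at hp
  · simp only [HasIsolatedMultiplicity, if_neg h0,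
      h.isSphereFactorization_iff hf hB (norm_pos_iff.2 h0) (toC_mem hq)]

theorem SameFactors.isZeroSequence {B : ℍ[ℝ] → ℍ[ℝ]} (h : SameFactors f B)
    (hf : SliceRegular f) (hB : SliceRegular B) (ha : IsZeroSequence f N a)
    (hBa : ∀ n : ℕ, (n : ℕ∞) < N → B (a n) = 0) : IsZeroSequence B N a := by
  refine ⟨fun n hn => ⟨(ha.1 n hn).1, hBa n hn⟩, fun x hx => ?_, fun x y hy hxy => ?_⟩
  · obtain ⟨k, hk, hcard⟩ := ha.2.1 x hx
    exact ⟨k, (h.hasIsolatedMultiplicity_iff hf hB hx k).2 hk, hcard⟩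
  · obtain ⟨m, hm, ⟨c, hc, hcnt⟩, hent⟩ := ha.2.2 x y hy hxy
    refine ⟨m, (h.hasSphericalMultiplicity_iff hf hB hy hxy _).2 hm, ⟨c, hc, fun q hq => ?_⟩, hent⟩
    obtain ⟨k, hk, hcard⟩ := hcnt q hq
    have hqb : q ∈ unitBall := by
      rw [mem_unitBall, ← norm_toC, (mem_sphereOf_iff hy.le).1 hq]
      exact mem_ball_zero_iff.1 (mem_ball_of_sq hxy)
    exact ⟨k, (h.hasIsolatedMultiplicity_iff hf hB hqb k).2 hk, hcard⟩

/-- As g is invertible on the sphere, the zero of F = P g at q belongs to P, and it persists in P R.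
-/
theorem induced_mul_eq_zero_of_common_factor {P g R F : ℂ → ℍ[ℂ]} (hP : IsStem P) (hR : IsStem R)
    (hF : IsStem F) {q : ℍ[ℝ]} (hPg : F (toC q) = P (toC q) * g (toC q))
    (hg : Quaternion.normSq (g (toC q)) ≠ 0) (h : induced F q = 0) :
    induced (fun z => P z * R z) q = 0 := by
  obtain ⟨J, hJ, hq⟩ := (mem_sphereOf_iff (norm_nonneg q.im)).2 (rfl : toC q = ⟨q.re, ‖q.im‖⟩)
  rw [induced_of_slice hF hJ hq, hPg] at h
  rw [induced_of_slice (hP.mul hR) hJ hq]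
  exact evJ_mul_eq_zero hJ _ (evJ_eq_zero_of_mul hJ hg h)

/-- The partial product of the earlier factors does not vanish at `a_n` if the earlier terms on
the sphere of `a_n` are all equal to the conjugate of `a_n`, and different from `a_n`. -/
theorem induced_mulSeq_ne_zero (hf : SliceRegular f) (ha : IsZeroSequence f N a)
    (hb : ∀ n, IsDivisorAt N a b n) {n : ℕ} (hn : (n : ℕ∞) < N)
    (H : ∀ j < n, a j ≠ a n ∧ (toC (a j) = toC (a n) → a j = star (a n))) :
    induced (mulSeq (factorSeq N b) n) (a n) ≠ 0 := by
  have hball : ∀ n : ℕ, (n : ℕ∞) < N → b n ∈ unitBall := fun n hn => (hb n).mem_unitBall ha hn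
  have hab : ∀ n : ℕ, (n : ℕ∞) < N → toC (b n) = toC (a n) := fun n hn => (hb n).toC_eq hn
  have hh := holStem_factorSeq hball
  have hP := fun k => holStem_mulSeq hh k
  have hz := toC_mem (ha.1 n hn).1
  have hord := fun k => ordDet_mulSeq_factorSeq hball hab hz (norm_nonneg _) k
  intro h0
  have h1 := normSq_eq_zero_of_induced (hP n).1 h0
  have h2 : (sphereIndices N a (toC (a n)) n).Nonempty := by
    by_contra hne
    rw [Set.not_nonempty_iff_eq_empty] at hne
    have := hord n
    rw [hne, Set.encard_empty, zero_mul, ordDet_eq_zero_iff (hP n) hz] at this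
    exact this h1
  obtain ⟨j, hjn, hjN, hj⟩ := h2
  have hjs : a j = star (a n) := (H j hjn).2 hj
  have him : (a n).im ≠ 0 := by
    intro h
    have hr : a n = ((a n).re : ℍ[ℝ]) := by
      conv_lhs => rw [← Quaternion.re_add_im (a n), h, add_zero]
    apply (H j hjn).1
    rw [hjs, hr, Quaternion.star_coe]
  have hy : 0 < ‖(a n).im‖ := norm_pos_iff.2 him
  have hns : a n ≠ star (a n) := star_ne_self hy.ne'
  obtain ⟨m, ps, -, ⟨c, hc, hcnt⟩, hent⟩ := ha.sphere_data hf hy hz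
  rcases Nat.eq_zero_or_pos m with rfl | hm
  -- Without spherical multiplicity only one point of the sphere can occur in the sequence, yet both
  -- a_n and its conjugate do.
  · have hhead : ∀ i : ℕ, (i : ℕ∞) < N → toC (a i) = toC (a n) → ps.head? = some (a i) := by
      intro i hi hiz
      have h3 := hcnt (a i) hiz
      by_contra h4
      rw [if_neg h4] at h3
      simp only [ite_self, add_zero, Nat.cast_zero, Set.encard_eq_zero] at h3
      exact Set.notMem_empty i (h3 ▸ ⟨hi, rfl⟩)
    have h3 := (hhead n hn rfl).symm.trans (hhead j hjN hj)
    rw [hjs] at h3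
    exact hns (Option.some.inj h3)
  · have hex : ∃ l : ℕ, (l : ℕ∞) < N ∧ toC (a l) = toC (a n) := ⟨j, hjN, hj⟩
    classical
    set l := Nat.find hex with hl
    obtain ⟨hlN, hlz⟩ := Nat.find_spec hex
    rw [← hl] at hlN hlz
    have hmin : ∀ i < l, (i : ℕ∞) < N → toC (a i) ≠ toC (a n) := fun i hi hiN h =>
      Nat.find_min hex hi ⟨hiN, h⟩
    have hlj : l ≤ j := Nat.find_min' hex ⟨hjN, hj⟩
    have hls : a l = star (a n) := (H l (by omega)).2 hlz
    obtain ⟨-, -, hnext⟩ := hent l hlN hlz (fun i hi => hmin i (by omega)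
      (lt_trans (by exact_mod_cast (by omega : i < l)) hlN)) 0 hm
    rw [mul_zero, add_zero, hls, star_star] at hnext
    -- The sequence enters the sphere at l with the conjugate of a_n, so the next term is a_n. As
    -- a_n does not occur before n, that term has index n.
    have hnl : n = l + 1 := by
      by_contra hne
      exact (H (l + 1) (by omega)).1 hnext
    have hempty : sphereIndices N a (toC (a n)) l = ∅ := by
      ext i
      simp only [sphereIndices, Set.mem_ofPred_eq, Set.mem_empty_iff_false, iff_false]
      exact fun h => hmin i h.1 h.2.1 h.2.2
    have hord1 : ordDet (mulSeq (factorSeq N b) n) (toC (a n)) = 1 := by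
      rw [hord n, wt, if_neg (show (toC (a n)).im ≠ 0 from hy.ne'), mul_one]
      conv_lhs => rw [show sphereIndices N a (toC (a n)) n = sphereIndices N a (toC (a n)) (l + 1)
        from by rw [← hnl]]
      rw [encard_sphereIndices_succ_of_mem hlN hlz, hempty, Set.encard_empty, zero_add]
    have hPl : Quaternion.normSq (mulSeq (factorSeq N b) l (toC (a n))) ≠ 0 := by
      rw [← ordDet_eq_zero_iff (hP l) hz, hord l, hempty, Set.encard_empty, zero_mul]
    obtain ⟨J, hJ, hnJ⟩ :=
      (mem_sphereOf_iff (norm_nonneg (a n).im)).2 (rfl : toC (a n) = ⟨(a n).re, ‖(a n).im‖⟩)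
    have hJ' := neg_mem_imUnits hJ
    have hre : (a l).re = (a n).re := congrArg Complex.re hlz
    have him' : ‖(a l).im‖ = ‖(a n).im‖ := congrArg Complex.im hlz
    have hlJ : a l = ((a l).re : ℍ[ℝ]) + (‖(a l).im‖ : ℍ[ℝ]) * (-J) := by
      rw [hre, him', hls]
      conv_lhs => rw [hnJ]
      exact star_slice hJ _ _
    set u := induced (mulSeq (factorSeq N b) l) (a l) with hu
    have hu0 : u ≠ 0 := fun h => hPl (by
      have := normSq_eq_zero_of_induced (hP l).1 h
      rwa [hlz] at this)
    have hue : u = evJ (-J) (mulSeq (factorSeq N b) l (toC (a n))) := by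
      rw [hu, induced_of_slice (hP l).1 hJ' hlJ, hlz]
    have hbl := (hb l hlN).2 hu0
    rw [← hu, conj_eq_slice hlJ hu0, hre, him'] at hbl
    have hv1 : evJ J (mulSeq (factorSeq N b) n (toC (a n))) = 0 := by
      rw [← induced_of_slice (hP n).1 hJ hnJ, h0]
    -- b_l was chosen as T_l(a_l), so that P_n, the product of P_l and M_{b_l}, vanishes at a_l, the
    -- conjugate of a_n. Together with a zero at a_n this makes the stem vanish, against order 1.
    have hv2 : evJ (-J) (mulSeq (factorSeq N b) n (toC (a n))) = 0 := by
      have e : mulSeq (factorSeq N b) n (toC (a n)) =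
          mulSeq (factorSeq N b) l (toC (a n)) * blaschkeStem (b l) (toC (a n)) := by
        conv_lhs => rw [show mulSeq (factorSeq N b) n = mulSeq (factorSeq N b) (l + 1) from by
          rw [← hnl]]
        simp only [mulSeq]
        rw [factorSeq, if_pos hlN]
      rw [e, evJ_mul_of_ne_zero hJ' _ _ hue hu0, blaschkeStem_eq_linStem_mul,
        evJ_mul_eq_zero (conj_mem_imUnits hJ' hu0), mul_zero]
      rw [hbl]
      exact evJ_linStem (conj_mem_imUnits hJ' hu0) _ _
    have hJne : J ≠ -J := by
      intro h
      have h2 : (2 : ℝ) • J = 0 := by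
        rw [two_smul]
        nth_rewrite 2 [h]
        exact add_neg_cancel J
      exact imUnits_ne_zero hJ ((smul_eq_zero.1 h2).resolve_left two_ne_zero)
    have h3 := two_le_ordDet (hP n) hz (eq_zero_of_evJ_two hJne hv1 hv2)
    rw [hord1] at h3
    exact absurd h3 (by norm_num)

end BlaschkeProduct

end

end QHardy

/-! ### The proposition -/

theorem mainTheorem6 (p : ℝ≥0∞) (hp : 0 < p) (f : ℍ[ℝ] → ℍ[ℝ]) (hf : QHardy.MemHardy p f)
    (hf0 : ∃ q ∈ QHardy.unitBall, f q ≠ 0)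
    (N : ℕ∞) (a : ℕ → ℍ[ℝ]) (ha : QHardy.IsZeroSequence f N a) :
    ∃ (b : ℕ → ℍ[ℝ]) (B : ℍ[ℝ] → ℍ[ℝ]),
      QHardy.IsBlaschkeProduct N b B ∧
      QHardy.SliceRegular B ∧
      QHardy.IsZeroSequence B N a ∧
      (∀ x y : ℝ, 0 < y → x ^ 2 + y ^ 2 < 1 → ∀ k : ℕ,
        QHardy.HasSphericalMultiplicity B x y k ↔ QHardy.HasSphericalMultiplicity f x y k) ∧
      (∀ q ∈ QHardy.unitBall, ∀ k : ℕ,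
        QHardy.HasIsolatedMultiplicity B q k ↔ QHardy.HasIsolatedMultiplicity f q k) ∧
      (∀ n : ℕ, (n : ℕ∞) < N →
        (∃ w : ℍ[ℝ], w ≠ 0 ∧ b n = w⁻¹ * a n * w) ∧
        (QHardy.partialProd N b n (a n) ≠ 0 →
          b n = (QHardy.partialProd N b n (a n))⁻¹ * a n * QHardy.partialProd N b n (a n)) ∧
        ((∀ j < n, a j ≠ a n ∧
            (a j ∈ QHardy.sphereOf (a n).re ‖(a n).im‖ → a j = star (a n))) →
          QHardy.partialProd N b n (a n) ≠ 0)) := by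
  open QHardy in
  obtain ⟨b, hb, hdiv⟩ := exists_factorization hf.1 ha
  obtain ⟨c, hc, hM⟩ := exists_summable_bound ha (ha.summable hp hf) hb
  have hball : ∀ n : ℕ, (n : ℕ∞) < N → b n ∈ unitBall := fun n hn => (hb n).mem_unitBall ha hn
  have hR := holStem_infProd (holStem_factorSeq hball) hc hM
  have hB := hR.sliceRegular
  have hsame : SameFactors f (induced (infProd (factorSeq N b))) := by
    intro z₀ hz₀ him m ps hps
    obtain ⟨P, g, R, hP, hg, hR', hfg, hBR, hg0, hR0⟩ :=
      exists_split hf.1 ha hc hM hb hdiv hz₀ him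
    rw [stemOf_induced hR.1]
    -- The same transfer is used twice, with f and the product, and their cofactors g and R,
    -- interchanged.
    exact ⟨StemFactor.transfer hz₀ hps hg hR' hf.1.holStem hfg hBR hR0 hg0,
      StemFactor.transfer hz₀ hps hR' hg hR hBR hfg hg0 hR0⟩
  refine ⟨b, induced (infProd (factorSeq N b)), ⟨hball, fun K hK hKc => ?_⟩, hB,
    hsame.isZeroSequence hf.1 hB ha fun n hn => ?_,
    fun x y hy hxy k => hsame.hasSphericalMultiplicity_iff hf.1 hB hy hxy k,
    fun q hq k => hsame.hasIsolatedMultiplicity_iff hf.1 hB hq k, fun n hn => ?_⟩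
  · simp only [partialProd_eq_induced]
    exact tendstoUniformlyOn_induced (fun r hr => tendstoUniformlyOn_mulSeq hc hM hr) hK hKc
  · obtain ⟨han, hfa⟩ := ha.1 n hn
    obtain ⟨P, g, R, hP, hg, hR', hfg, hBR, hg0, -⟩ :=
      exists_split hf.1 ha hc hM hb hdiv (toC_mem han) (norm_nonneg _)
    rw [induced_congr hBR han]
    exact induced_mul_eq_zero_of_common_factor hP.1 hR'.1 (isStem_stemOf f) (hfg _ (toC_mem han))
      hg0 (by rw [← hf.1.eq_induced han, hfa])
  · rw [partialProd_eq_induced]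
    refine ⟨(hb n hn).1, (hb n hn).2, fun H => induced_mulSeq_ne_zero hf.1 ha hb hn fun j hj => ?_⟩
    refine ⟨(H j hj).1, fun h => (H j hj).2 ?_⟩
    exact (mem_sphereOf_iff (norm_nonneg _)).2 h
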